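/- **Setting.** For a permutation $\sigma$ of length $n$, the Hasse graph of $\sigma$ has the points $(i,\sigma(i))$ as vertices; points $(i,\sigma(i))$, $(j,\sigma(j))$ with $i<j$, $\sigma(i)<\sigma(j)$ are adjacent iff there is no $m$ with $i<m<j$ and $\sigma(i)<\sigma(m)<\sigma(j)$. For positive integers $t,k,\ell,d$ let $\mathcal W(t,k,\ell,d)$ be the set of the 1324-avoiding permutations whose vertices are partitioned into sets $R_0,B_1,R_1,\dots,B_t,R_t$, each inducing a tree in the Hasse graph, such that: each red tree $R_i$ has $k$ vertices and has a root to the lower left of all its other vertices; each blue tree $B_i$ has $\ell$ vertices and has a root, of degree $d$ in $B_i$, to the upper right of all its other vertices; $B_i$ lies below $R_{i-1}$, the root of $R_{i-1}$ is to the left of $B_i$, and the root of $B_i$ is to the right of $R_{i-1}$ (so only non-root vertices are interleaved horizontally); $R_i$ lies to the right of $B_i$, the root of $R_i$ is below $B_i$, and the root of $B_i$ is above $R_i$ (so only non-root vertices are interleaved vertically). For $\lambda>0$ and $0<\delta<1$ put $\mathcal W_{\lambda,\delta}(k)=\mathcal W(k,k,\lceil\lambda k\rceil,\lceil\delta\lambda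 k\rceil)$, whose elements have length $n(k,\lambda)=k(k+\lceil\lambda k\rceil+1)$, and let $$g(\lambda,\delta)=\limsup_{k\to\infty}|\mathcal W_{\lambda,\delta}(k)|^{1/n(k,\lambda)},\qquad E(\lambda,\delta)=4\,\frac{(2-\delta)^{(2-\delta)\lambda}}{(1-\delta)^{(1-\delta)\lambda}}\cdot\frac{(1+\delta\lambda)^{2(1+\delta\lambda)}}{(\delta\lambda)^{2\delta\lambda}}.$$ Plane trees and forests are drawn as point sets as follows. In both colours, the principal subtrees of a vertex (and the components of a forest), taken from left to right, are placed from the upper left to the lower right. In red, each vertex is to the lower left of its descendants; in blue, it is to the upper right of its descendants. For a plane tree $T$ and a (possibly empty) plane forest $F$, let $Q(T,F)$ be the number of ways of horizontally interleaving the non-root vertices of $T$, drawn in blue, with the vertices of $F$, drawn in red above them, without creating a 1324. A *pre-interleaving* of a $k$-vertex red tree $R$ and an $\ell$-vertex blue tree $B$ with root degree $d$ is an arbitrary horizontal interleaving of the $k-1$ non-root vertices of $R$ with the $d$ blue roots, i.e. the roots of the blue subtrees (the principal subtrees of $B$). Let $u$ be a blue root. Its *gap size* is the number of non-root red vertices between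 $u$ and the next blue root to its left (or simply to the left of $u$, if $u$ is the leftmost blue root). Let $x$ be the parent of the nearest red vertex to the right of $u$ (the root of $R$, if no red vertex is to the right of $u$). The *red forest* of $u$ is the forest induced by the red vertices between $x$ and $u$. The *red fringe* of $u$ is the forest induced by the rightmost $\min(j,m)$ vertices of the red forest, where $j$ is the gap size and $m$ is the number of vertices of the red forest. Let $\psi_k(T,F)$ be the proportion of the blue subtrees that are isomorphic to $T$ and whose root has a red fringe isomorphic to $F$, in a uniformly random triple consisting of a $k$-vertex red tree, a blue tree with $\lceil\lambda k\rceil$ vertices and root degree $\lceil\delta\lambda k\rceil$, and a pre-interleaving of them. **Proposition.** Let $\lambda>0$ and $0<\delta<1$. For every plane tree $T$ and every plane forest $F$ the limit $\mu(T,F)=\lim_{k\to\infty}\mathbb E[\psi_k(T,F)]$ exists, and for every finite set $\mathcal S$ of pairs $(T,F)$ composed of a plane tree $T$ and a plane forest $F$, $$g(\lambda,\delta)\;\ge\;\liminf_{k\to\infty}|\mathcal W_{\lambda,\delta}(k)|^{1/n(k,\lambda)}\;\ge\; E(\lambda,\delta)^{1/(1+\lambda)}\prod_{(T,F)\in\mathcal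 S}Q(T,F)^{2\delta\lambda\,\mu(T,F)/(1+\lambda)} .$$ -/

import Mathlib

open Filter Topology

/-! ### Plane trees and plane forests -/

/-- A plane forest, i.e. a finite sequence of plane trees: either empty, or a first tree, given by
the forest `children` of the principal subtrees of its root, followed by the forest `rest`. -/
inductive PlaneForest : Type
  | nil : PlaneForest
  | cons (children rest : PlaneForest) : PlaneForest

/-- A plane tree: a root vertex together with the plane forest of its principal subtrees. -/
structure PlaneTree : Type where
  children : PlaneForest

namespace PlaneForest

/-- Number of vertices of a plane forest. -/
def size : PlaneForest → ℕ
  | nil => 0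
  | cons c r => c.size + 1 + r.size

/-- The sequence of the components, from left to right. -/
def trees : PlaneForest → List PlaneTree
  | nil => []
  | cons c r => ⟨c⟩ :: r.trees

/-- Juxtaposition of two plane forests. -/
def append : PlaneForest → PlaneForest → PlaneForest
  | nil, G => G
  | cons c r, G => cons c (r.append G)

/-- The forest induced by the first `p` vertices in preorder. -/
def take : ℕ → PlaneForest → PlaneForest
  | 0, _ => nil
  | _ + 1, nil => nil
  | p + 1, cons c r => cons (c.take p) (r.take (p - c.size))

/-- The forest induced by all vertices except the first `i` in preorder. (When the first vertex
is deleted, its children become roots.) -/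
def drop : ℕ → PlaneForest → PlaneForest
  | 0, F => F
  | _ + 1, nil => nil
  | i + 1, cons c r => drop i (c.append r)

/-- Regard the forest as the principal subtrees of a root, which has number `0`, and number its
vertices `1, 2, …` in preorder. Then `F.parent j` is the number of the parent of the vertex with
number `j + 1`; it is `0` if there is no such vertex. -/
def parent : PlaneForest → ℕ → ℕ
  | nil, _ => 0
  | cons _ _, 0 => 0
  | cons c r, j + 1 =>
      if j < c.size then c.parent j + 1
      else if r.parent (j - c.size) = 0 then 0
      else r.parent (j - c.size) + c.size + 1

/-- The plane forest drawn in red, with each root to the lower left of the rest of its tree and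
the trees placed from the upper left to the lower right: the sequence of the heights
(`0, 1, 2, …`) of its points, read from left to right. -/
def redSeq : PlaneForest → List ℕ
  | nil => []
  | cons c r => r.size :: (c.redSeq.map (· + (r.size + 1)) ++ r.redSeq)

/-- The plane forest drawn in blue, with each root to the upper right of the rest of its tree and
the trees placed from the upper left to the lower right: the sequence of the heights
(`0, 1, 2, …`) of its points, read from left to right. -/
def blueSeq : PlaneForest → List ℕ
  | nil => []
  | cons c r => c.blueSeq.map (· + r.size) ++ (r.size + c.size) :: r.blueSeq

end PlaneForest

namespace PlaneTree

/-- Number of vertices of a plane tree. -/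
def size (T : PlaneTree) : ℕ := T.children.size + 1

/-- Number of children of the root. -/
def rootDegree (T : PlaneTree) : ℕ := T.children.trees.length

end PlaneTree

/-! ### Permutations avoiding 1324 and their Hasse graphs -/

/-- A sequence of numbers avoids the pattern 1324. -/
def Avoids1324 {n : ℕ} (f : Fin n → ℕ) : Prop :=
  ¬ ∃ a b c d : Fin n, a < b ∧ b < c ∧ c < d ∧ f a < f c ∧ f c < f b ∧ f b < f d

/-- The Hasse graph of a permutation; the vertex `i` is the point `(i, σ i)`. -/
def hasseGraph {n : ℕ} (σ : Equiv.Perm (Fin n)) : SimpleGraph (Fin n) :=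
  SimpleGraph.fromRel fun i j =>
    i < j ∧ σ i < σ j ∧ ¬ ∃ m, i < m ∧ m < j ∧ σ i < σ m ∧ σ m < σ j

/-- `red 0, blue 0, red 1, blue 1, …, blue (t - 1), red t` is a sequence of trees that span the
Hasse graph of `σ`, rooted alternately at the lower left (red trees, with roots `redRoot i`) and at
the upper right (blue trees, with roots `blueRoot i`). Every red tree has `k` vertices; every blue
tree has `l` vertices and root degree `d`. -/
structure IsTreeSequence {n : ℕ} (σ : Equiv.Perm (Fin n)) (t k l d : ℕ)
    (red : Fin (t + 1) → Finset (Fin n)) (blue : Fin t → Finset (Fin n))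
    (redRoot : Fin (t + 1) → Fin n) (blueRoot : Fin t → Fin n) : Prop where
  /-- every vertex lies in exactly one of the trees -/
  partition : ∀ p, ∃! s : Fin (t + 1) ⊕ Fin t, p ∈ Sum.elim red blue s
  red_card : ∀ i, (red i).card = k
  blue_card : ∀ i, (blue i).card = l
  red_tree : ∀ i, ((hasseGraph σ).induce (red i : Set (Fin n))).IsTree
  blue_tree : ∀ i, ((hasseGraph σ).induce (blue i : Set (Fin n))).IsTree
  redRoot_mem : ∀ i, redRoot i ∈ red i
  blueRoot_mem : ∀ i, blueRoot i ∈ blue i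
  /-- a red root is to the lower left of all other vertices of its tree -/
  redRoot_least : ∀ i, ∀ p ∈ red i, redRoot i ≤ p ∧ σ (redRoot i) ≤ σ p
  /-- a blue root is to the upper right of all other vertices of its tree -/
  blueRoot_greatest : ∀ i, ∀ p ∈ blue i, p ≤ blueRoot i ∧ σ p ≤ σ (blueRoot i)
  blueRoot_degree : ∀ i, {p | p ∈ blue i ∧ (hasseGraph σ).Adj (blueRoot i) p}.ncard = d
  /-- A blue tree is below the previous red tree; horizontally, only the non-root vertices of the
  two trees are interleaved, the red root being on the left and the blue root on the right. -/
  horizontal : ∀ i : Fin t, ∀ p ∈ red i.castSucc, ∀ q ∈ blue i,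
    σ q < σ p ∧ redRoot i.castSucc < q ∧ p < blueRoot i
  /-- A red tree is to the right of the previous blue tree; vertically, only the non-root vertices
  of the two trees are interleaved, the red root being below and the blue root above. -/
  vertical : ∀ i : Fin t, ∀ q ∈ blue i, ∀ p ∈ red i.succ,
    q < p ∧ σ (redRoot i.succ) < σ q ∧ σ p < σ (blueRoot i)

/-- The set `𝒲(t, k, l, d)` of 1324-avoiders whose Hasse graph is spanned by an alternating sequence
of `t + 1` red trees with `k` vertices and `t` blue trees with `l` vertices and root degree `d`. -/
def regularAvoiders (t k l d : ℕ) : Set (Equiv.Perm (Fin ((t + 1) * k + t * l))) :=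
  {σ | Avoids1324 (fun i => (σ i : ℕ)) ∧
    ∃ red blue redRoot blueRoot, IsTreeSequence σ t k l d red blue redRoot blueRoot}

/-- Number of vertices of a blue tree. -/
noncomputable def blueSize (lam : ℝ) (k : ℕ) : ℕ := ⌈lam * k⌉₊

/-- Root degree of a blue tree. -/
noncomputable def blueDegree (lam δ : ℝ) (k : ℕ) : ℕ := ⌈δ * lam * k⌉₊

/-- `|𝒲_{λ,δ}(k)| ^ (1 / n(k,λ))`, where `n(k,λ) = k (k + ⌈λ k⌉ + 1)` is the length of the
permutations in `𝒲_{λ,δ}(k) = 𝒲(k, k, ⌈λ k⌉, ⌈δ λ k⌉)`. -/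
noncomputable def rootCount (lam δ : ℝ) (k : ℕ) : ℝ :=
  ((regularAvoiders k k (blueSize lam k) (blueDegree lam δ k)).ncard : ℝ) ^
    (1 / ((k * (k + blueSize lam k + 1) : ℕ) : ℝ))

/-- The upper growth rate `g(λ,δ)` of `⋃ₖ 𝒲_{λ,δ}(k)`. -/
noncomputable def upperGrowthRate (lam δ : ℝ) : ENNReal :=
  limsup (fun k : ℕ => ENNReal.ofReal (rootCount lam δ k)) atTop

/-- The lower growth rate of `⋃ₖ 𝒲_{λ,δ}(k)`. -/
noncomputable def lowerGrowthRate (lam δ : ℝ) : ENNReal :=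
  liminf (fun k : ℕ => ENNReal.ofReal (rootCount lam δ k)) atTop

/-- The function `E(λ,δ)`. -/
noncomputable def growthE (lam δ : ℝ) : ℝ :=
  4 * ((2 - δ) ^ ((2 - δ) * lam) / (1 - δ) ^ ((1 - δ) * lam)) *
    ((1 + δ * lam) ^ (2 * (1 + δ * lam)) / (δ * lam) ^ (2 * (δ * lam)))

/-! ### Interleavings of a blue subtree with a red fringe -/

/-- `Q(T,F)`: the number of ways of interleaving horizontally the non-root vertices of the blue
subtree `T` with the vertices of the red forest `F`, which is placed above, without creating a 1324.
With `b` the number of non-root vertices of `T`, an interleaving is a sequence `w` in which the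
entries less than `b` form the drawing of the blue vertices and the others that of `F`, shifted
by `b`. -/
noncomputable def interleavings (T : PlaneTree) (F : PlaneForest) : ℕ :=
  {w : List ℕ |
    w.filter (fun h => h < T.children.size) = T.children.blueSeq ∧
    w.filter (fun h => T.children.size ≤ h) = F.redSeq.map (· + T.children.size) ∧
    Avoids1324 w.get}.ncard

/-! ### Pre-interleavings, red fringes, and the proportion of `(T,F)`-subtrees -/

/-- Red trees with `k` vertices. -/
abbrev RedTree (k : ℕ) : Type := {T : PlaneTree // T.size = k}

/-- Blue trees with `l` vertices and root degree `d`. -/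
abbrev BlueTree (l d : ℕ) : Type := {T : PlaneTree // T.size = l ∧ T.rootDegree = d}

/-- A pre-interleaving of the `k - 1` non-root vertices of a red tree with `d` blue roots: the
value at `i` is the number of the former that are to the left of the `i`-th blue root. -/
abbrev PreInterleaving (k d : ℕ) : Type := Fin d →o Fin k

/-- The gap size of a blue root: the number of non-root red vertices between it and the next blue
root to its left (or to its left, for the leftmost blue root). -/
def gapSize {k d : ℕ} (P : PreInterleaving k d) (i : Fin d) : ℕ :=
  if h : 0 < (i : ℕ) then (P i : ℕ) - (P ⟨(i : ℕ) - 1, by omega⟩ : ℕ) else (P i : ℕ)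

/-- The number of vertices of the red forest of a blue root `u` with exactly `p` non-root vertices of
the red tree `R` to its left. The red forest consists of the red vertices between `x` and `u`,
where `x` is the parent of the nearest red vertex to the right of `u` (and the root of `R` if there
is no red vertex to the right of `u`). -/
def redForestSize (R : PlaneTree) (p : ℕ) : ℕ := p - R.children.parent p

/-- The red fringe of a blue root with exactly `p` non-root vertices of the red tree `R` to its left
and gap size `j`: the forest induced by the rightmost `min j m` vertices of the red forest, where
`m` is the number of vertices of the red forest. -/
def redFringe (R : PlaneTree) (p j : ℕ) : PlaneForest :=
  (R.children.take p).drop (p - min j (redForestSize R p))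

/-- The proportion of blue subtrees that are `(T,F)`-subtrees, i.e. that are isomorphic to `T` and
have a red fringe isomorphic to `F`. -/
noncomputable def subtreeProportion {k d : ℕ} (R B : PlaneTree) (P : PreInterleaving k d)
    (T : PlaneTree) (F : PlaneForest) : ℝ :=
  ({i : Fin d | B.children.trees[(i : ℕ)]? = some T ∧
    redFringe R (P i) (gapSize P i) = F}.ncard : ℝ) / d

/-- A red tree with `k` vertices, a blue tree with `l` vertices and root degree `d`, and a
pre-interleaving of their red vertices and blue roots. -/
abbrev PreInterleavedPair (k l d : ℕ) : Type :=
  RedTree k × BlueTree l d × PreInterleaving k d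

theorem PlaneForest.finite_size_le (n : ℕ) : {F : PlaneForest | F.size ≤ n}.Finite := by
  induction n with
  | zero =>
    refine (Set.finite_singleton PlaneForest.nil).subset ?_
    rintro (_ | ⟨c, r⟩) h
    · rfl
    · simp [PlaneForest.size] at h
  | succ n ih =>
    refine ((Set.finite_singleton PlaneForest.nil).union
      (ih.image2 PlaneForest.cons ih)).subset ?_
    rintro (_ | ⟨c, r⟩) h
    · exact Or.inl rfl
    · simp only [Set.mem_ofPred_eq, PlaneForest.size] at h
      refine Or.inr ⟨c, ?_, r, ?_, rfl⟩ <;> simp only [Set.mem_ofPred_eq] <;> omega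

instance RedTree.instFinite (k : ℕ) : Finite (RedTree k) := by
  have := (PlaneForest.finite_size_le k).to_subtype
  refine Finite.of_injective (β := {F : PlaneForest | F.size ≤ k})
    (fun T => ⟨T.1.children, ?_⟩) ?_
  · have := T.2
    simp only [PlaneTree.size] at this
    simp only [Set.mem_ofPred_eq]
    omega
  · rintro ⟨⟨c⟩, h⟩ ⟨⟨c'⟩, h'⟩ e
    simpa using e

instance BlueTree.instFinite (l d : ℕ) : Finite (BlueTree l d) :=
  Finite.of_injective (β := RedTree l) (fun T => ⟨T.1, T.2.1⟩) fun _ _ e =>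
    Subtype.ext (congrArg (fun x : RedTree l => x.1) e)

instance PreInterleaving.instFinite (k d : ℕ) : Finite (PreInterleaving k d) :=
  Finite.of_injective (β := Fin d → Fin k) (fun P => P) DFunLike.coe_injective

/-- The mean of `ψₖ(T,F)`: the average of the proportion of `(T,F)`-subtrees over all
(finitely many) pre-interleaved pairs of trees with the parameters of `𝒲_{λ,δ}(k)`. -/
noncomputable def meanProportion (lam δ : ℝ) (k : ℕ) (T : PlaneTree) (F : PlaneForest) : ℝ :=
  (∑ᶠ x : PreInterleavedPair k (blueSize lam k) (blueDegree lam δ k),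
    subtreeProportion x.1.1 x.2.1.1 x.2.2 T F) /
  (Nat.card (PreInterleavedPair k (blueSize lam k) (blueDegree lam δ k)) : ℝ)

/-! The elements of the class are built as staircases: choose the red and blue trees freely, then
interleave each blue tree horizontally with the red tree above it and vertically with the red tree
to its right. Red drawings avoid 213 and blue drawings avoid 132, so a 1324 would have to lie in one
blue tree and one adjacent red tree (`Staircase.Valid.not_1324`). All the interleavings can
therefore be chosen independently, and the permutation determines every choice, because rows and
columns can be read off from it (`Staircase.Valid.eq_of_perm_eq`). Reflection in the diagonal
mirrors the trees and turns a vertical interleaving into a horizontal one. Hence the class has at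
least as many elements as the sum, over all sequences of trees, of products of numbers of
interleavings of single pairs (`sum_prod_le_ncard_regularAvoiders`).

For one pair of trees, fix a pre-interleaving and interleave each blue subtree with the red fringe
of its root. A fringe lies in the gap to the left of its root, so distinct subtrees meet disjoint
stretches of red points. It also contains all descendants of its vertices, so no red vertex of a
fringe has a descendant to the right of the blue root. Hence local avoidance implies global
avoidance, and the number of interleavings of the pair is at least the sum over pre-interleavings of
a product of local counts, each at least the corresponding `Q(T,F)`
(`sum_prod_le_card_treeInterleavings`).

Concavity of the logarithm bounds the logarithm of a sum of N terms below by log N plus the mean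
logarithm. It is used twice, over pre-interleavings and over sequences of trees
(`exp_le_ncard_regularAvoiders`). The mean logarithm is linear in the proportions of
`(T,F)`-subtrees, so only their expectations enter and no concentration result is needed.

The expectations are computed exactly. Having red fringe `F` is a difference of two kinds of events:
the gap has at least |F| points and a complete copy of `F` ends at the root, minus the same for the
forests with one more vertex in front. Such events are counted by products of two binomial
coefficients, one for pre-interleavings (`card_gapSize_ge`) and one for red trees
(`sum_card_endsWith`); the blue trees contribute a ballot number. All arguments grow linearly in
`k`, so the ratios converge (`exists_tendsto_meanProportion`). Stirling's formula gives the
exponential growth of the numbers of trees and pre-interleavings, which combine to `growthE`. -/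

namespace PlaneForest

/-! ### Basic operations on plane forests -/

/-- Number of components of a plane forest. -/
def len : PlaneForest → ℕ
  | nil => 0
  | cons _ r => r.len + 1

theorem size_append (F G : PlaneForest) : (F.append G).size = F.size + G.size := by
  induction F with
  | nil => simp [append, size]
  | cons c r _ ih => simp only [append, size, ih]; omega

theorem len_append (F G : PlaneForest) : (F.append G).len = F.len + G.len := by
  induction F with
  | nil => simp [append, len]
  | cons c r _ ih => simp only [append, len, ih]; omega

theorem append_nil (F : PlaneForest) : F.append nil = F := by
  induction F with
  | nil => rfl
  | cons c r _ ih => simp only [append, ih]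

theorem append_assoc (F G H : PlaneForest) :
    (F.append G).append H = F.append (G.append H) := by
  induction F with
  | nil => rfl
  | cons c r _ ih => simp only [append, ih]

theorem len_eq_length_trees (F : PlaneForest) : F.trees.length = F.len := by
  induction F with
  | nil => rfl
  | cons c r _ ih => simp [trees, len, ih]

theorem size_eq_zero {F : PlaneForest} : F.size = 0 ↔ F = nil := by
  cases F <;> simp [size]

theorem len_le_size (F : PlaneForest) : F.len ≤ F.size := by
  induction F with
  | nil => simp [len, size]
  | cons c r _ ih => simp only [len, size]; omega

theorem append_left_cancel {F G H : PlaneForest} (h : F.append G = F.append H) : G = H := by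
  induction F with
  | nil => exact h
  | cons c r _ ih => simp only [append, cons.injEq, true_and] at h; exact ih h

theorem append_inj {F F' G G' : PlaneForest} (h : F.append G = F'.append G')
    (hs : F.size = F'.size) : F = F' ∧ G = G' := by
  induction F generalizing F' with
  | nil =>
    have : F' = nil := size_eq_zero.1 hs.symm
    subst this
    exact ⟨rfl, h⟩
  | cons c r _ ih =>
    cases F' with
    | nil => simp [size] at hs
    | cons c' r' =>
      simp only [append, cons.injEq] at h
      obtain ⟨rfl, h⟩ := h
      simp only [size] at hs
      obtain ⟨rfl, rfl⟩ := ih h (by omega)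
      exact ⟨rfl, rfl⟩

@[simp] theorem drop_zero (F : PlaneForest) : F.drop 0 = F := by cases F <;> simp [drop]

@[simp] theorem drop_nil (i : ℕ) : nil.drop i = nil := by cases i <;> simp [drop]

@[simp] theorem drop_succ_cons (i : ℕ) (c r : PlaneForest) :
    (cons c r).drop (i + 1) = (c.append r).drop i := by simp [drop]

theorem drop_drop (i j : ℕ) (F : PlaneForest) : (F.drop i).drop j = F.drop (i + j) := by
  induction i generalizing F with
  | zero => simp
  | succ i ih =>
    cases F with
    | nil => simp
    | cons c r => rw [drop_succ_cons, ih, Nat.add_right_comm, drop_succ_cons]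

theorem size_drop (i : ℕ) (F : PlaneForest) : (F.drop i).size = F.size - i := by
  induction i generalizing F with
  | zero => simp
  | succ i ih =>
    cases F with
    | nil => simp [size]
    | cons c r => rw [drop_succ_cons, ih, size_append, size]; omega

/-! ### Counting plane forests -/

theorem finite_size_eq (n : ℕ) : {F : PlaneForest | F.size = n}.Finite :=
  (finite_size_le n).subset fun _ h => le_of_eq h

/-- The plane forests with `n` vertices. -/
noncomputable def ofSize (n : ℕ) : Finset PlaneForest := (finite_size_eq n).toFinset

@[simp] theorem mem_ofSize {n : ℕ} {F : PlaneForest} : F ∈ ofSize n ↔ F.size = n := by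
  simp [ofSize]

theorem ofSize_zero : ofSize 0 = {nil} := by
  ext F; simp [size_eq_zero]

theorem cons_injective : Function.Injective (fun x : PlaneForest × PlaneForest => cons x.1 x.2) := by
  rintro ⟨a, b⟩ ⟨c, d⟩ h
  simpa using h

open Classical in
theorem card_ofSize (n : ℕ) : (ofSize n).card = catalan n := by
  induction n using Nat.strong_induction_on with
  | _ n ih =>
    cases n with
    | zero => simp [ofSize_zero]
    | succ n =>
      have h : ofSize (n + 1) = (Finset.HasAntidiagonal.antidiagonal n).biUnion fun ij =>
          ((ofSize ij.1) ×ˢ (ofSize ij.2)).map ⟨_, cons_injective⟩ := by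
        ext F
        simp only [mem_ofSize, Finset.mem_biUnion, Finset.HasAntidiagonal.mem_antidiagonal, Finset.mem_map,
          Finset.mem_product, Function.Embedding.coeFn_mk, Prod.exists]
        constructor
        · intro h
          cases F with
          | nil => simp [size] at h
          | cons c r => exact ⟨c.size, r.size, by simp only [size] at h; omega, c, r, ⟨rfl, rfl⟩, rfl⟩
        · rintro ⟨i, j, h, c, r, ⟨rfl, rfl⟩, rfl⟩
          simp only [size]; omega
      rw [h, Finset.card_biUnion, catalan_succ']
      · refine Finset.sum_congr rfl fun ij hij => ?_
        rw [Finset.HasAntidiagonal.mem_antidiagonal] at hij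
        rw [Finset.card_map, Finset.card_product, ih _ (by omega), ih _ (by omega)]
      · rintro ⟨a, b⟩ _ ⟨a', b'⟩ _ hne
        rw [Function.onFun, Finset.disjoint_left]
        rintro F h1 h2
        simp only [Finset.mem_map, Finset.mem_product, mem_ofSize, Function.Embedding.coeFn_mk,
          Prod.exists] at h1 h2
        obtain ⟨c, r, ⟨rfl, rfl⟩, rfl⟩ := h1
        obtain ⟨c', r', ⟨rfl, rfl⟩, h⟩ := h2
        simp only [cons.injEq] at h
        obtain ⟨rfl, rfl⟩ := h
        exact hne rfl

/-- The plane forests with `d` components and `n` vertices. -/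
noncomputable def ofLenSize (d n : ℕ) : Finset PlaneForest := {F ∈ ofSize n | F.len = d}

@[simp] theorem mem_ofLenSize {d n : ℕ} {F : PlaneForest} :
    F ∈ ofLenSize d n ↔ F.size = n ∧ F.len = d := by
  simp [ofLenSize]

theorem card_ofLenSize_zero (n : ℕ) : (ofLenSize 0 n).card = if n = 0 then 1 else 0 := by
  split_ifs with h
  · subst h
    rw [Finset.card_eq_one]
    refine ⟨nil, ?_⟩
    ext F
    simp only [mem_ofLenSize, Finset.mem_singleton, size_eq_zero]
    constructor
    · exact And.left
    · rintro rfl; exact ⟨rfl, rfl⟩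
  · rw [Finset.card_eq_zero, Finset.eq_empty_iff_forall_notMem]
    intro F hF
    rw [mem_ofLenSize] at hF
    cases F with
    | nil => exact h hF.1.symm
    | cons c r => simp [len] at hF

open Classical in
-- If the first tree is a single vertex, delete it. Otherwise detach the first principal subtree of
-- its root and put it in front, which adds one component and keeps the number of vertices. Both
-- steps are reversible.
theorem card_ofLenSize_succ (d n : ℕ) : (ofLenSize (d + 1) (n + 1)).card =
    (ofLenSize d n).card + (ofLenSize (d + 2) (n + 1)).card := by
  have h : ofLenSize (d + 1) (n + 1) = ((ofLenSize d n).image (cons nil)) ∪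
      ((ofLenSize (d + 2) (n + 1)).image fun F => match F with
        | cons a (cons b r) => cons (cons a b) r
        | F => F) := by
    ext F
    simp only [mem_ofLenSize, Finset.mem_union, Finset.mem_image]
    constructor
    · rintro ⟨h1, h2⟩
      cases F with
      | nil => simp [size] at h1
      | cons c r =>
        simp only [size, len] at h1 h2
        cases c with
        | nil => left; exact ⟨r, ⟨by simp only [size] at h1; omega, by omega⟩, rfl⟩
        | cons a b =>
          right
          refine ⟨cons a (cons b r), ⟨?_, ?_⟩, rfl⟩
          · simp only [size] at h1 ⊢; omega
          · simp only [len]; omega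
    · rintro (⟨r, ⟨h1, h2⟩, rfl⟩ | ⟨F', ⟨h1, h2⟩, rfl⟩)
      · simp only [size, len]; omega
      · match F', h1, h2 with
        | cons a (cons b r), h1, h2 => simp only [size, len] at h1 h2 ⊢; omega
        | cons a nil, h1, h2 => simp [len] at h2
        | nil, h1, h2 => simp [len] at h2
  rw [h, Finset.card_union_of_disjoint, Finset.card_image_of_injective, Finset.card_image_of_injOn]
  · intro F hF F' hF' h
    simp only [Finset.mem_coe, mem_ofLenSize] at hF hF'
    match F, F', hF, hF', h with
    | cons a (cons b r), cons a' (cons b' r'), hF, hF', h => simpa [and_assoc] using h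
    | cons a nil, _, hF, _, _ => simp [len] at hF
    | nil, _, hF, _, _ => simp [len] at hF
    | _, cons a nil, _, hF, _ => simp [len] at hF
    | _, nil, _, hF, _ => simp [len] at hF
  · intro a b h; simpa using h
  · rw [Finset.disjoint_left]
    intro F h1 h2
    simp only [Finset.mem_image, mem_ofLenSize] at h1 h2
    obtain ⟨r, -, rfl⟩ := h1
    obtain ⟨F', hF', h⟩ := h2
    match F', hF', h with
    | cons a (cons b r'), _, h => simp at h
    | cons a nil, hF, _ => simp [len] at hF
    | nil, hF, _ => simp [len] at hF

theorem card_ofLenSize_of_lt {d n : ℕ} (h : n < d) : (ofLenSize d n).card = 0 := by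
  rw [Finset.card_eq_zero, Finset.eq_empty_iff_forall_notMem]
  intro F hF
  rw [mem_ofLenSize] at hF
  have := F.len_le_size
  omega

theorem card_ofLenSize_self (d : ℕ) : (ofLenSize d d).card = 1 := by
  induction d with
  | zero => simp [card_ofLenSize_zero]
  | succ d ih => rw [card_ofLenSize_succ, ih, card_ofLenSize_of_lt (by omega)]

/-- The ballot number as a difference of binomial coefficients, written without subtraction. The
recursion of `card_ofLenSize_succ` expresses the case `(m + 1, d + 1)` through `(m + 1, d)` and `(m,
d + 2)`, which is Pascal's rule for both binomial coefficients. -/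
theorem card_ofLenSize_add_choose (m d : ℕ) :
    (ofLenSize (d + 1) (d + 1 + (m + 1))).card + (2 * m + d + 2).choose m =
      (2 * m + d + 2).choose (m + 1) := by
  induction m generalizing d with
  | zero =>
    induction d with
    | zero =>
      rw [show 0 + 1 + (0 + 1) = 1 + 1 from rfl, card_ofLenSize_succ, card_ofLenSize_zero,
        card_ofLenSize_self]
      simp
    | succ d ih =>
      rw [show d + 1 + 1 + (0 + 1) = (d + 1 + (0 + 1)) + 1 by omega, card_ofLenSize_succ,
        show d + 1 + (0 + 1) + 1 = d + 1 + 2 by omega, card_ofLenSize_self]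
      simp at ih ⊢
      omega
  | succ m ihm =>
    induction d with
    | zero =>
      have := ihm 1
      rw [show 0 + 1 + (m + 1 + 1) = m + 2 + 1 by omega, card_ofLenSize_succ, card_ofLenSize_zero,
        if_neg (by omega)]
      rw [show 1 + 1 + (m + 1) = m + 2 + 1 by omega, show 1 + 1 = 0 + 2 from rfl] at this
      have h1 := Nat.choose_succ_succ' (2 * m + 3) m
      have h2 := Nat.choose_succ_succ' (2 * m + 3) (m + 1)
      -- There are no nonempty forests with zero components, so one term of the recursion vanishes.
      -- The equality of the two middle binomial coefficients is the matching boundary value.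
      have h3 := Nat.choose_symm_half (m + 1)
      rw [show 2 * (m + 1) + 1 = 2 * m + 3 by omega] at h3
      rw [show 2 * (m + 1) + 0 + 2 = 2 * m + 3 + 1 by omega, h1, h2, h3]
      rw [show 2 * m + 1 + 2 = 2 * m + 3 by omega] at this
      omega
    | succ d ih =>
      have := ihm (d + 2)
      rw [show d + 1 + 1 + (m + 1 + 1) = d + 1 + (m + 1 + 1) + 1 by omega, card_ofLenSize_succ]
      rw [show d + 2 + 1 + (m + 1) = d + 1 + (m + 1 + 1) + 1 by omega] at this
      have h1 := Nat.choose_succ_succ' (2 * m + d + 4) m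
      have h2 := Nat.choose_succ_succ' (2 * m + d + 4) (m + 1)
      rw [show 2 * (m + 1) + (d + 1) + 2 = 2 * m + d + 4 + 1 by omega, h1, h2]
      rw [show 2 * (m + 1) + d + 2 = 2 * m + d + 4 by omega] at ih
      rw [show 2 * m + (d + 2) + 2 = 2 * m + d + 4 by omega] at this
      rw [show d + 1 + 2 = d + 2 + 1 by omega]
      omega

theorem mul_card_ofLenSize (d m : ℕ) :
    (d + 1 + m) * (ofLenSize (d + 1) (d + 1 + m)).card = (d + 1) * (2 * m + d).choose m := by
  cases m with
  | zero => simp [card_ofLenSize_self]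
  | succ m =>
    have h := card_ofLenSize_add_choose m d
    have h2 := Nat.choose_succ_right_eq (2 * m + d + 2) m
    rw [show 2 * m + d + 2 - m = m + d + 2 by omega] at h2
    rw [show 2 * (m + 1) + d = 2 * m + d + 2 by omega]
    nlinarith

/-! ### Positions at which a given forest is next in preorder -/

/-- The number of plane forests which, after the deletion of their first `p` vertices in
preorder, become a given forest with `h` components. -/
def prefixCount : ℕ → ℕ → ℕ
  | 0, _ => 1
  | p + 1, h => ∑ i ∈ Finset.range (h + 1), prefixCount p (i + 1)

open Classical in
/-- The forests which become `F` when their first vertex is deleted. -/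
noncomputable def grafts : PlaneForest → Finset PlaneForest
  | nil => {cons nil nil}
  | cons c r => insert (cons nil (cons c r)) ((grafts r).image fun G => match G with
      | cons a b => cons (cons c a) b
      | nil => nil)

theorem mem_grafts {F G : PlaneForest} : G ∈ grafts F ↔ G.size = F.size + 1 ∧ G.drop 1 = F := by
  induction F generalizing G with
  | nil =>
    cases G with
    | nil => simp [grafts, size]
    | cons c r =>
      simp only [grafts, Finset.mem_singleton, cons.injEq, size, drop_succ_cons, drop_zero]
      constructor
      · rintro ⟨rfl, rfl⟩; simp [size, append]
      · rintro ⟨h, -⟩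
        exact ⟨size_eq_zero.1 (by omega), size_eq_zero.1 (by omega)⟩
  | cons c r _ ih =>
    simp only [grafts, Finset.mem_insert, Finset.mem_image]
    constructor
    · rintro (rfl | ⟨G', h, rfl⟩)
      · simp only [size, drop_succ_cons, drop_zero, append, and_true]; omega
      · rw [ih] at h
        cases G' with
        | nil => simp [size] at h
        | cons a b =>
          simp only [drop_succ_cons, drop_zero] at h
          simp only [drop_succ_cons, drop_zero, append, h.2, size, and_true]
          simp only [size] at h
          omega
    · rintro ⟨h1, h2⟩
      cases G with
      | nil => simp [size] at h1
      | cons a b =>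
        simp only [drop_succ_cons, drop_zero] at h2
        cases a with
        | nil => left; simp only [append] at h2; rw [h2]
        | cons a a' =>
          right
          simp only [append, cons.injEq] at h2
          obtain ⟨rfl, h2⟩ := h2
          refine ⟨cons a' b, ?_, rfl⟩
          rw [ih]
          simp only [size, drop_succ_cons, drop_zero, h2, and_true] at h1 ⊢
          omega

/-- A new first vertex adopts an initial run of the components of `F`, possibly empty, so each
number of components from 1 to `F.len + 1` occurs exactly once. -/
theorem sum_grafts (F : PlaneForest) (φ : ℕ → ℕ) :
    ∑ G ∈ grafts F, φ G.len = ∑ i ∈ Finset.range (F.len + 1), φ (i + 1) := by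
  classical
  induction F with
  | nil => simp [grafts, len]
  | cons c r _ ih =>
    rw [grafts, Finset.sum_insert, Finset.sum_image, Finset.sum_range_succ,
      show (cons c r).len = r.len + 1 from rfl, ← ih, add_comm]
    · congr 1
      refine Finset.sum_congr rfl fun G hG => ?_
      cases G with
      | nil => simp [mem_grafts, size] at hG
      | cons a b => simp [len]
    · intro G hG G' hG' h
      cases G with
      | nil => simp [mem_grafts, size] at hG
      | cons a b =>
        cases G' with
        | nil => simp [mem_grafts, size] at hG'
        | cons a' b' => simpa using h
    · simp only [Finset.mem_image, not_exists, not_and]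
      intro G hG h
      cases G with
      | nil => simp at h
      | cons a b => simp at h

open Classical in
-- The deleted vertices are put back one at a time. The choices at each stage depend only on the
-- current number of components, so the shape of `H` does not matter.
theorem card_drop_eq (p : ℕ) (H : PlaneForest) :
    {G ∈ ofSize (p + H.size) | G.drop p = H}.card = prefixCount p H.len := by
  induction p generalizing H with
  | zero =>
    rw [prefixCount, Finset.card_eq_one]
    refine ⟨H, ?_⟩
    ext G
    simp only [Finset.mem_filter, mem_ofSize, drop_zero, Finset.mem_singleton]
    constructor
    · exact And.right
    · rintro rfl; simp
  | succ p ih =>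
    rw [prefixCount, ← sum_grafts H (prefixCount p)]
    rw [Finset.card_eq_sum_card_fiberwise (f := fun G => G.drop p) (t := grafts H)]
    · refine Finset.sum_congr rfl fun H' hH' => ?_
      rw [← ih]
      congr 1
      ext G
      rw [mem_grafts] at hH'
      simp only [Finset.mem_filter, mem_ofSize, hH'.1]
      constructor
      · rintro ⟨⟨h1, h2⟩, h3⟩; exact ⟨by omega, h3⟩
      · rintro ⟨h1, h2⟩
        refine ⟨⟨by omega, ?_⟩, h2⟩
        rw [← drop_drop, h2, hH'.2]
    · intro G hG
      simp only [Finset.coe_filter, Set.mem_ofPred_eq, mem_ofSize, Finset.mem_coe, mem_grafts] at hG ⊢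
      rw [size_drop, drop_drop]
      exact ⟨by omega, hG.2⟩

/-- For `r = 0` every inner sum classifies all forests with `M` vertices by what remains after `p`
deletions, so the total is `M + 1` Catalan numbers, a central binomial coefficient. Raising `r` by
one adds a single term to each sum over grafts, and these terms form the instance with `M` lowered
by one and `r` raised by two from its old value: Pascal's rule. -/
theorem sum_prefixCount (r M : ℕ) :
    ∑ p ∈ Finset.range (M + 1), ∑ B ∈ ofSize (M - p), prefixCount p (r + B.len) =
      (2 * M + r).choose M := by
  classical
  induction M generalizing r with
  | zero => simp [prefixCount, ofSize_zero]
  | succ M ihM =>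
    induction r with
    | zero =>
      have h : ∀ p ∈ Finset.range (M + 1 + 1),
          ∑ B ∈ ofSize (M + 1 - p), prefixCount p (0 + B.len) = catalan (M + 1) := by
        intro p hp
        rw [Finset.mem_range] at hp
        rw [← card_ofSize, Finset.card_eq_sum_card_fiberwise (f := fun G => G.drop p)
          (t := ofSize (M + 1 - p))]
        · refine Finset.sum_congr rfl fun B hB => ?_
          rw [mem_ofSize] at hB
          rw [Nat.zero_add, ← card_drop_eq, hB]
          rw [show p + (M + 1 - p) = M + 1 by omega]
        · intro G hG
          simp only [Finset.mem_coe, mem_ofSize] at hG ⊢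
          rw [size_drop, hG]
      rw [Finset.sum_congr rfl h, Finset.sum_const, Finset.card_range, smul_eq_mul,
        succ_mul_catalan_eq_centralBinom, Nat.centralBinom_eq_two_mul_choose]
      rfl
    | succ r ih =>
      have h := ihM (r + 2)
      rw [Finset.sum_range_succ'] at ih ⊢
      simp only [Nat.sub_zero, prefixCount, Finset.sum_const, smul_eq_mul, mul_one] at ih ⊢
      have e : ∀ p ∈ Finset.range (M + 1), ∑ B ∈ ofSize (M + 1 - (p + 1)),
          ∑ i ∈ Finset.range (r + 1 + B.len + 1), prefixCount p (i + 1) =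
          (∑ B ∈ ofSize (M + 1 - (p + 1)),
          ∑ i ∈ Finset.range (r + B.len + 1), prefixCount p (i + 1)) +
          ∑ B ∈ ofSize (M - p), prefixCount p (r + 2 + B.len) := by
        intro p _
        rw [Nat.add_sub_add_right, ← Finset.sum_add_distrib]
        refine Finset.sum_congr rfl fun B _ => ?_
        rw [show r + 1 + B.len + 1 = (r + B.len + 1) + 1 by omega, Finset.sum_range_succ,
          show r + B.len + 1 + 1 = r + 2 + B.len by omega]
      rw [Finset.sum_congr rfl e, Finset.sum_add_distrib, h]
      have := Nat.choose_succ_succ' (2 * M + r + 2) M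
      rw [show 2 * (M + 1) + (r + 1) = 2 * M + r + 2 + 1 by omega, this]
      rw [show 2 * (M + 1) + r = 2 * M + r + 2 by omega] at ih
      rw [show 2 * M + (r + 2) = 2 * M + r + 2 by omega]
      omega

open Classical in
-- Classify by the remainder `B`. Only the number of components of `F.append B` matters, so the
-- count depends on `F` only through its size and its number of components.
theorem sum_card_drop_eq_append (F : PlaneForest) (M : ℕ) :
    ∑ q ∈ Finset.range (M + 1),
      {G ∈ ofSize (M + F.size) | ∃ B, G.drop q = F.append B}.card =
      (2 * M + F.len).choose M := by
  rw [← sum_prefixCount]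
  refine Finset.sum_congr rfl fun q hq => ?_
  rw [Finset.mem_range] at hq
  rw [Finset.card_eq_sum_card_fiberwise (f := fun G => G.drop q)
    (t := (ofSize (M - q)).image F.append), Finset.sum_image]
  · refine Finset.sum_congr rfl fun B hB => ?_
    rw [mem_ofSize] at hB
    rw [← len_append, ← card_drop_eq]
    congr 1
    ext G
    simp only [Finset.mem_filter, mem_ofSize, size_append]
    constructor
    · rintro ⟨⟨h1, h2⟩, h3⟩; exact ⟨by omega, h3⟩
    · rintro ⟨h1, h2⟩; exact ⟨⟨by omega, B, h2⟩, h2⟩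
  · intro B _ B' _ h
    exact append_left_cancel h
  · intro G hG
    simp only [Finset.coe_filter, Set.mem_ofPred_eq, mem_ofSize, Finset.coe_image, Set.mem_image,
      Finset.mem_coe] at hG ⊢
    obtain ⟨h, B, hB⟩ := hG
    refine ⟨B, ?_, hB.symm⟩
    have := congrArg size hB
    rw [size_drop, size_append] at this
    omega

end PlaneForest

namespace PlaneForest

/-! ### Red fringes -/

@[simp] theorem take_zero (F : PlaneForest) : F.take 0 = nil := by cases F <;> simp [take]

@[simp] theorem take_nil (p : ℕ) : nil.take p = nil := by cases p <;> simp [take]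

@[simp] theorem take_succ_cons (p : ℕ) (c r : PlaneForest) :
    (cons c r).take (p + 1) = cons (c.take p) (r.take (p - c.size)) := by simp [take]

theorem take_of_size_le {F : PlaneForest} {p : ℕ} (h : F.size ≤ p) : F.take p = F := by
  induction F generalizing p with
  | nil => simp
  | cons c r ihc ihr =>
    simp only [size] at h
    cases p with
    | zero => omega
    | succ p => rw [take_succ_cons, ihc (by omega), ihr (by omega)]

theorem take_append (F G : PlaneForest) (p : ℕ) :
    (F.append G).take p = (F.take p).append (G.take (p - F.size)) := by
  induction F generalizing p with
  | nil => simp [append, size]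
  | cons c r _ ih =>
    cases p with
    | zero => simp [append]
    | succ p =>
      simp only [append, take_succ_cons, ih, size]
      congr 3
      omega

theorem drop_take (F : PlaneForest) (p q : ℕ) : (F.take p).drop q = (F.drop q).take (p - q) := by
  induction q generalizing F p with
  | zero => simp
  | succ q ih =>
    cases p with
    | zero => simp
    | succ p =>
      cases F with
      | nil => simp
      | cons c r => rw [take_succ_cons, drop_succ_cons, drop_succ_cons, ← take_append, ih,
          Nat.add_sub_add_right]

theorem drop_append_of_le {F G : PlaneForest} {q : ℕ} (h : q ≤ F.size) :
    (F.append G).drop q = (F.drop q).append G := by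
  induction q generalizing F with
  | zero => simp
  | succ q ih =>
    cases F with
    | nil => simp [size] at h
    | cons c r =>
      simp only [append, drop_succ_cons]
      rw [← append_assoc, ih]
      rw [size_append]; simp only [size] at h; omega

@[simp] theorem parent_nil (j : ℕ) : nil.parent j = 0 := by simp [parent]

theorem size_cons (c r : PlaneForest) : (cons c r).size = c.size + 1 + r.size := rfl

theorem parent_append (c r : PlaneForest) (j : ℕ) : (c.append r).parent j =
    if j < c.size then c.parent j else
      if r.parent (j - c.size) = 0 then 0 else r.parent (j - c.size) + c.size := by
  induction c generalizing j with
  | nil =>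
    have h : nil.size = 0 := rfl
    rw [h, if_neg (Nat.not_lt_zero _), append, Nat.sub_zero]
    split_ifs <;> omega
  | cons a b _ ih =>
    rw [size_cons]
    cases j with
    | zero => rw [if_pos (by omega)]; simp [append, parent]
    | succ j =>
      simp only [append, parent, ih]
      by_cases h1 : j < a.size
      · rw [if_pos h1, if_pos h1, if_pos (by omega)]
      · rw [if_neg h1, if_neg h1]
        by_cases h2 : j - a.size < b.size
        · rw [if_pos h2, if_pos (show j + 1 < a.size + 1 + b.size by omega)]
        · rw [if_neg h2, if_neg (show ¬ j + 1 < a.size + 1 + b.size by omega), show j + 1 - (a.size + 1 + b.size) =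
            j - a.size - b.size by omega]
          split_ifs <;> omega

/-- Truncated subtraction is what is wanted here: a vertex whose parent has been deleted becomes a
child of the root, which has number 0. -/
theorem parent_drop (F : PlaneForest) (q j : ℕ) :
    (F.drop q).parent j = F.parent (q + j) - q := by
  induction q generalizing F with
  | zero => simp
  | succ q ih =>
    cases F with
    | nil => simp
    | cons c r =>
      rw [drop_succ_cons, ih, parent_append, show q + 1 + j = (q + j) + 1 by omega]
      simp only [parent]
      split_ifs <;> omega

theorem parent_le (F : PlaneForest) (j : ℕ) : F.parent j ≤ j := by
  induction F generalizing j with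
  | nil => simp
  | cons c r ihc ihr =>
    cases j with
    | zero => simp [parent]
    | succ j =>
      simp only [parent]
      have := ihc j
      have := ihr (j - c.size)
      split_ifs <;> omega

/-- A vertex is the root of a component exactly when the vertices before it in preorder form whole
components. At `j = H.size` there is no such vertex; the default value 0 matches the splitting with
`B` empty. -/
theorem parent_eq_zero_iff {H : PlaneForest} {j : ℕ} (hj : j ≤ H.size) :
    H.parent j = 0 ↔ ∃ A B, H = append A B ∧ A.size = j := by
  induction H generalizing j with
  | nil =>
    simp only [size] at hj
    simp only [parent_nil, true_iff]
    exact ⟨nil, nil, rfl, by simp [size]; omega⟩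
  | cons c r _ ih =>
    cases j with
    | zero => simp only [parent, true_iff]; exact ⟨nil, cons c r, rfl, rfl⟩
    | succ j =>
      simp only [size] at hj
      simp only [parent]
      constructor
      · intro h
        split_ifs at h with h1 h2
        obtain ⟨A, B, rfl, hA⟩ := (ih (j := j - c.size) (by omega)).1 h2
        exact ⟨cons c A, B, rfl, by simp only [size]; omega⟩
      · rintro ⟨A, B, h, hA⟩
        cases A with
        | nil => simp [size] at hA
        | cons a b =>
          simp only [append, cons.injEq] at h
          obtain ⟨rfl, h⟩ := h
          simp only [size] at hA
          rw [if_neg (by omega), if_pos]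
          exact (ih (by omega)).2 ⟨b, B, h, by omega⟩

/-- The last vertices, in preorder, among the first `p` vertices of `G` induce the forest `A`,
and their descendants are among these first `p` vertices. -/
def EndsWith (G : PlaneForest) (p : ℕ) (A : PlaneForest) : Prop :=
  A.size ≤ p ∧ ∃ B, G.drop (p - A.size) = A.append B

theorem EndsWith.unique {G A A' : PlaneForest} {p : ℕ} (h : G.EndsWith p A)
    (h' : G.EndsWith p A') (hs : A.size = A'.size) : A = A' := by
  obtain ⟨-, B, h⟩ := h
  obtain ⟨-, B', h'⟩ := h'
  rw [hs, h'] at h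
  exact (append_inj h hs.symm).1.symm

/-- The last `s` of the first `p` vertices contain all their descendants iff the next vertex is a
root once the first `p - s` vertices are deleted, that is, iff its parent is among those or is the
root. This identifies the red forest as the longest complete stretch ending at `p`. -/
theorem exists_endsWith_iff {G : PlaneForest} {p s : ℕ} (hp : p ≤ G.size) (hs : s ≤ p) :
    (∃ A, G.EndsWith p A ∧ A.size = s) ↔ s ≤ p - G.parent p := by
  have h1 := parent_drop G (p - s) s
  rw [Nat.sub_add_cancel hs] at h1
  have h2 := parent_eq_zero_iff (H := G.drop (p - s)) (j := s) (by rw [size_drop]; omega)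
  have := G.parent_le p
  have h3 : s ≤ p - G.parent p ↔ (G.drop (p - s)).parent s = 0 := by rw [h1]; omega
  rw [h3, h2]
  constructor
  · rintro ⟨A, ⟨-, B, h⟩, rfl⟩
    exact ⟨A, B, h, rfl⟩
  · rintro ⟨A, B, h, rfl⟩
    exact ⟨A, ⟨hs, B, h⟩, rfl⟩

theorem EndsWith.of_grafts {G A F : PlaneForest} {p : ℕ} (h : G.EndsWith p A)
    (hA : A ∈ grafts F) : G.EndsWith p F := by
  obtain ⟨h1, B, h2⟩ := h
  rw [mem_grafts] at hA
  refine ⟨by omega, B, ?_⟩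
  rw [show p - F.size = (p - A.size) + 1 by omega, ← drop_drop, h2, drop_append_of_le (by omega),
    hA.2]

theorem mem_grafts_drop_one {A : PlaneForest} {s : ℕ}
    (hs : A.size = s + 1) : A ∈ grafts (A.drop 1) ∧ (A.drop 1).size = s := by
  rw [mem_grafts, size_drop]
  simp only [and_true]
  omega

end PlaneForest

open PlaneForest

/-- The red fringe is complete. -/
theorem endsWith_redFringe {R : PlaneTree} {p : ℕ} (hp : p ≤ R.children.size) (j : ℕ) :
    R.children.EndsWith p (redFringe R p j) ∧
      (redFringe R p j).size = min j (redForestSize R p) := by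
  have h : min j (redForestSize R p) ≤ p - R.children.parent p := min_le_right _ _
  obtain ⟨A, hA, hs⟩ := (exists_endsWith_iff hp (by omega)).2 h
  have : redFringe R p j = A := by
    obtain ⟨h1, B, hB⟩ := hA
    rw [redFringe, drop_take, ← hs, hB, Nat.sub_sub_self h1, take_append, take_of_size_le le_rfl,
      Nat.sub_self, take_zero, append_nil]
  rw [this]
  exact ⟨hA, hs⟩

/-- Complete stretches ending at `p` are determined by their length, and the possible lengths form
an initial segment. A fringe shorter than the gap is thus the longest one, which can be tested by
extending it by a single vertex. -/
theorem redFringe_eq_iff {R : PlaneTree} {p j : ℕ} {F : PlaneForest} (hp : p ≤ R.children.size)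
    (hj : j ≤ p) : redFringe R p j = F ↔ F.size ≤ j ∧ R.children.EndsWith p F ∧
      (F.size + 1 ≤ j → ∀ A ∈ grafts F, ¬ R.children.EndsWith p A) := by
  obtain ⟨h1, h2⟩ := endsWith_redFringe hp j
  constructor
  · rintro rfl
    refine ⟨by omega, h1, fun h3 A hA hA' => ?_⟩
    have := (exists_endsWith_iff (s := (redFringe R p j).size + 1) hp (by omega)).1
      ⟨A, hA', (mem_grafts.1 hA).1⟩
    rw [redForestSize] at h2
    omega
  · rintro ⟨h3, h4, h5⟩
    refine h1.unique h4 ?_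
    have h6 := (exists_endsWith_iff hp h4.1).1 ⟨F, h4, rfl⟩
    rw [redForestSize] at h2
    by_contra hne
    obtain ⟨A, hA, hs⟩ := (exists_endsWith_iff (s := F.size + 1) hp (by omega)).2 (by omega)
    obtain ⟨h7, h8⟩ := mem_grafts_drop_one hs
    have h9 := (hA.of_grafts h7).unique h4 h8
    rw [h9] at h7
    exact h5 (by omega) A h7 hA

open Classical in
/-- The indicator of a red fringe, as a telescoping difference. -/
theorem indicator_redFringe_add {R : PlaneTree} {p j : ℕ} (F : PlaneForest)
    (hp : p ≤ R.children.size) (hj : j ≤ p) :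
    (if redFringe R p j = F then 1 else 0) +
      (if F.size + 1 ≤ j then ∑ A ∈ grafts F, (if R.children.EndsWith p A then 1 else 0) else 0) =
      if F.size ≤ j ∧ R.children.EndsWith p F then 1 else 0 := by
  -- At most one graft of `F` can end at `p`, since all grafts have the same size. If one does, the
  -- sum is 1 and `F` itself ends there too but is not the fringe.
  by_cases h : F.size + 1 ≤ j ∧ ∃ A ∈ grafts F, R.children.EndsWith p A
  · obtain ⟨h1, A, hA, hA'⟩ := h
    rw [if_neg, if_pos h1, if_pos ⟨by omega, hA'.of_grafts hA⟩, Finset.sum_eq_single A]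
    · simp [hA']
    · intro A' hA1 hne
      rw [if_neg]
      intro h2
      refine hne (h2.unique hA' ?_)
      rw [(mem_grafts.1 hA1).1, (mem_grafts.1 hA).1]
    · exact fun hn => absurd hA hn
    · rw [redFringe_eq_iff hp hj]
      rintro ⟨-, -, h3⟩
      exact h3 h1 A hA hA'
  · have h0 : (if F.size + 1 ≤ j then
        ∑ A ∈ grafts F, (if R.children.EndsWith p A then 1 else 0) else 0) = 0 := by
      split_ifs with h1
      · refine Finset.sum_eq_zero fun A hA => if_neg fun h2 => h ⟨h1, A, hA, h2⟩
      · rfl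
    rw [h0, add_zero]
    congr 1
    rw [redFringe_eq_iff hp hj]
    refine propext ⟨fun h => ⟨h.1, h.2.1⟩, fun h' => ⟨h'.1, h'.2, fun h1 A hA hA' => h ⟨h1, A, hA, hA'⟩⟩⟩

open Classical in
-- Positions `p` smaller than the size of `F` contribute nothing; the others are shifted to the
-- number of vertices in front of `F`.
theorem sum_card_endsWith (F : PlaneForest) (M : ℕ) :
    ∑ p ∈ Finset.range (M + F.size + 1), {G ∈ ofSize (M + F.size) | G.EndsWith p F}.card =
      (2 * M + F.len).choose M := by
  rw [← sum_card_drop_eq_append, show M + F.size + 1 = F.size + (M + 1) by omega,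
    Finset.sum_range_add, Finset.sum_eq_zero, zero_add]
  · refine Finset.sum_congr rfl fun q _ => ?_
    congr 1
    ext G
    simp [EndsWith]
  · intro p hp
    rw [Finset.card_eq_zero, Finset.filter_eq_empty_iff]
    intro G _ h
    have := h.1
    rw [Finset.mem_range] at hp
    omega

/-! ### Counting pre-interleavings -/

/-- A weakly increasing sequence is the sorted list of a multiset. -/
theorem card_orderHom_fin (n m : ℕ) :
    Nat.card (Fin n →o Fin m) = Nat.multichoose m n := by
  have h := Sym.card_sym_eq_multichoose (Fin m) n
  rw [Fintype.card_fin, ← Nat.card_eq_fintype_card] at h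
  rw [← h]
  refine Nat.card_eq_of_bijective
    (fun P : Fin n →o Fin m => (⟨(List.ofFn P : Multiset (Fin m)), by simp⟩ : Sym (Fin m) n)) ⟨?_, ?_⟩
  · intro P Q hPQ
    have h1 : (List.ofFn P).Perm (List.ofFn Q) := by
      exact Multiset.coe_eq_coe.1 (congrArg Subtype.val hPQ)
    have h2 : ∀ P : Fin n →o Fin m, (List.ofFn P).Pairwise (· ≤ ·) := by
      intro P
      rw [List.pairwise_ofFn]
      intro i j hij
      exact P.monotone hij.le
    have h3 := h1.eq_of_pairwise (fun a b _ _ h h' => le_antisymm h h') (h2 P) (h2 Q)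
    exact DFunLike.coe_injective (List.ofFn_injective h3)
  · rintro ⟨s, hs⟩
    have hl : (s.sort (· ≤ ·)).length = n := by simp [hs]
    refine ⟨⟨fun i => (s.sort (· ≤ ·)).get (i.cast hl.symm), ?_⟩, ?_⟩
    · intro i j hij
      exact (Multiset.pairwise_sort s (· ≤ ·)).sortedLE.monotone_get (by simpa using hij)
    · apply Subtype.ext
      show ((List.ofFn fun i => (s.sort (· ≤ ·)).get (i.cast hl.symm) : List (Fin m)) :
        Multiset (Fin m)) = s
      conv_rhs => rw [← Multiset.sort_eq s (· ≤ ·)]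
      congr 1
      apply List.ext_get
      · simp [hs]
      · intro i h1 h2
        simp

theorem card_preInterleaving (k d : ℕ) :
    Nat.card (PreInterleaving (k + 1) d) = (k + d).choose d := by
  rw [card_orderHom_fin, Nat.multichoose_eq]
  congr 1
  omega

theorem exists_threshold {e : ℕ} {Q : Fin e → ℕ} (hQ : Monotone Q) (c : ℕ) :
    ∃ i ≤ e, ∀ j : Fin e, (j : ℕ) < i ↔ Q j ≤ c := by
  classical
  have hex : ∃ i, ∀ j : Fin e, i ≤ (j : ℕ) → c < Q j := ⟨e, fun j h => by omega⟩
  refine ⟨Nat.find hex, Nat.find_min' hex (fun j h => by omega), fun j => ⟨fun h => ?_, fun h => ?_⟩⟩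
  · have := Nat.find_min hex h
    push Not at this
    obtain ⟨j', h1, h2⟩ := this
    exact (hQ h1).trans h2
  · by_contra hn
    have := Nat.find_spec hex j (by omega)
    omega

theorem gapSize_le {k d : ℕ} (P : PreInterleaving k d) (i : Fin d) : gapSize P i ≤ (P i : ℕ) := by
  unfold gapSize
  split_ifs <;> omega

theorem le_gapSize {k d s : ℕ} {P : PreInterleaving k d} {i : Fin d} (h : s ≤ gapSize P i) (j : Fin d)
    (hj : (j : ℕ) < i) : (P j : ℕ) + s ≤ P i := by
  unfold gapSize at h
  rw [dif_pos (by omega)] at h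
  have h1 : P j ≤ P ⟨(i : ℕ) - 1, by omega⟩ := P.monotone (by rw [Fin.le_def]; simp only; omega)
  have h2 : P ⟨(i : ℕ) - 1, by omega⟩ ≤ P i := P.monotone (by rw [Fin.le_def]; simp only; omega)
  rw [Fin.le_def] at h1 h2
  omega

theorem le_gapSize_of_forall {k d s : ℕ} {P : PreInterleaving k d} {i : Fin d} (hi : s ≤ (P i : ℕ))
    (h : ∀ j : Fin d, (j : ℕ) < i → (P j : ℕ) + s ≤ P i) : s ≤ gapSize P i := by
  unfold gapSize
  split_ifs with h1
  · have := h ⟨(i : ℕ) - 1, by omega⟩ (by simp only; omega)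
    omega
  · exact hi

/-- Replace the chosen blue root and the `s` red vertices just before it by one marker. This leaves
`k - s` objects to be interleaved with the other `e` roots, and the position of the marker is
prescribed by `p`. The count is therefore independent of `p`, which later lets the sum over trees
and pre-interleavings factor. -/
theorem card_gapSize_ge {k e s p : ℕ} (hs : s ≤ p) (hp : p < k) :
    Nat.card {x : PreInterleaving k (e + 1) × Fin (e + 1) //
      (x.1 x.2 : ℕ) = p ∧ s ≤ gapSize x.1 x.2} = Nat.card (Fin e →o Fin (k - s + 1)) := by
  let φ : {x : PreInterleaving k (e + 1) × Fin (e + 1) //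
      (x.1 x.2 : ℕ) = p ∧ s ≤ gapSize x.1 x.2} → (Fin e →o Fin (k - s + 1)) := fun x =>
    ⟨fun j => if h : (j : ℕ) < x.1.2 then ⟨x.1.1 j.castSucc, by
        have := le_gapSize x.2.2 j.castSucc h
        have := (x.1.1 x.1.2).2
        omega⟩
      else ⟨(x.1.1 j.succ : ℕ) + 1 - s, by
        have := (x.1.1 j.succ).2
        omega⟩, by
      obtain ⟨⟨P, i⟩, h1, h2⟩ := x
      intro j j' hjj
      simp only at h1 h2 ⊢
      rw [Fin.le_def] at hjj
      split_ifs with h3 h4 h4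
      · exact Fin.le_def.2 (P.monotone (Fin.le_def.2 (by simpa using hjj)))
      · have a1 := le_gapSize h2 j.castSucc h3
        have a2 : P i ≤ P j'.succ := P.monotone (by rw [Fin.le_def]; simp; omega)
        rw [Fin.le_def] at a2 ⊢
        simp only
        omega
      · omega
      · have a2 : P j.succ ≤ P j'.succ := P.monotone (by rw [Fin.le_def]; simp; omega)
        rw [Fin.le_def] at a2 ⊢
        simp only
        omega⟩
  have hφ1 : ∀ x (j : Fin e), (j : ℕ) < x.1.2 → (φ x j : ℕ) = x.1.1 j.castSucc := by
    intro x j h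
    show ((if h : (j : ℕ) < x.1.2 then (⟨x.1.1 j.castSucc, _⟩ : Fin (k - s + 1)) else _ : Fin (k - s + 1)) : ℕ) = _
    rw [dif_pos h]
  have hφ2 : ∀ x (j : Fin e), ¬ (j : ℕ) < x.1.2 → (φ x j : ℕ) = (x.1.1 j.succ : ℕ) + 1 - s := by
    intro x j h
    show ((if h : (j : ℕ) < x.1.2 then _ else (⟨(x.1.1 j.succ : ℕ) + 1 - s, _⟩ : Fin (k - s + 1)) : Fin (k - s + 1)) : ℕ) = _
    rw [dif_neg h]
  have hge : ∀ (P : PreInterleaving k (e + 1)) (i : Fin (e + 1)) (j : Fin e), (P i : ℕ) = p →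
      ¬ (j : ℕ) < i → p ≤ P j.succ := by
    intro P i j h h1
    have a2 : P i ≤ P j.succ := P.monotone (by rw [Fin.le_def]; simp; omega)
    rw [Fin.le_def] at a2
    omega
  refine Nat.card_eq_of_bijective φ ⟨?_, ?_⟩
  -- Values coming from roots before the chosen one are at most `p - s`, and those from later roots
  -- are at least `p - s + 1`, so the image determines the index of the chosen root.
  · have key : ∀ x y, φ x = φ y → ¬ (x.1.2 < y.1.2) := by
      intro x y hxy hlt
      have hlt' : (x.1.2 : ℕ) < y.1.2 := hlt
      have hj : (x.1.2 : ℕ) < e := by have := y.1.2.2; omega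
      have h1 := hφ2 x ⟨x.1.2, hj⟩ (lt_irrefl _)
      have h2 := hφ1 y ⟨x.1.2, hj⟩ hlt'
      have h3 := le_gapSize y.2.2 (Fin.castSucc ⟨x.1.2, hj⟩) hlt'
      have h4 := hge x.1.1 x.1.2 ⟨x.1.2, hj⟩ x.2.1 (lt_irrefl _)
      have h5 := y.2.1
      rw [hxy] at h1
      omega
    intro x y hxy
    have hi : x.1.2 = y.1.2 := le_antisymm (not_lt.1 (key y x hxy.symm)) (not_lt.1 (key x y hxy))
    apply Subtype.ext
    refine Prod.ext ?_ hi
    apply OrderHom.ext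
    funext j
    apply Fin.ext
    have hi' : (x.1.2 : ℕ) = y.1.2 := congrArg Fin.val hi
    rcases lt_trichotomy (j : ℕ) x.1.2 with h | h | h
    · have hj : (j : ℕ) < e := by have := x.1.2.2; omega
      have h1 := hφ1 x ⟨j, hj⟩ h
      have h2 := hφ1 y ⟨j, hj⟩ (by simp only; omega)
      rw [hxy, h2] at h1
      exact h1.symm
    · have e1 : j = x.1.2 := Fin.ext h
      have h1 := x.2.1
      have h2 := y.2.1
      rw [← hi, ← e1] at h2
      rw [← e1] at h1
      rw [h1, h2]
    · obtain ⟨j', rfl⟩ : ∃ j' : Fin e, j = j'.succ :=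
        ⟨⟨(j : ℕ) - 1, by have := j.2; omega⟩, Fin.ext (by simp; omega)⟩
      simp only [Fin.val_succ] at h
      have h1 := hφ2 x j' (by omega)
      have h2 := hφ2 y j' (by omega)
      have h3 := hge x.1.1 x.1.2 j' x.2.1 (by omega)
      have h4 := hge y.1.1 y.1.2 j' y.2.1 (by omega)
      rw [hxy] at h1
      omega
  · intro Q
    -- The roots with value at most `p - s` go before the marker. The inverse inserts the value `p`
    -- at this threshold and raises the later values by `s - 1`.
    obtain ⟨i, hi, hQ⟩ := exists_threshold (Q := fun j => (Q j : ℕ)) (fun a b h => Q.monotone h) (p - s)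
    have hQm : ∀ a b : Fin e, (a : ℕ) ≤ b → (Q a : ℕ) ≤ Q b := fun a b h => Q.monotone h
    let f : ℕ → ℕ := fun j => if h : j < i then Q ⟨j, by omega⟩ else if h' : j = i then p else
      if h'' : j - 1 < e then Q ⟨j - 1, h''⟩ + s - 1 else k
    have f1 : ∀ j (h : j < i), f j = Q ⟨j, by omega⟩ := fun j h => dif_pos h
    have f2 : f i = p := by simp [f]
    have f3 : ∀ j (h : i ≤ j) (h' : j < e), f (j + 1) = Q ⟨j, h'⟩ + s - 1 := by
      intro j h h'
      simp only [f]
      rw [dif_neg (by omega), dif_neg (by omega), dif_pos (show j + 1 - 1 < e by omega)]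
      congr 3
    have g1 : ∀ j, j < i → f j + s ≤ p := by
      intro j h
      have := (hQ ⟨j, by omega⟩).1 h
      rw [f1 j h]
      omega
    have g3 : ∀ j, i ≤ j → j < e → p ≤ f (j + 1) ∧ f (j + 1) < k := by
      intro j h h'
      have h1 := mt (hQ ⟨j, h'⟩).2 (by simp only; omega)
      have h2 := (Q ⟨j, h'⟩).2
      rw [f3 j h h']
      omega
    have hfm : ∀ a b, a ≤ b → b < e + 1 → f a ≤ f b := by
      intro a b hab hb
      rcases lt_trichotomy b i with h | h | h
      · rw [f1 b h, f1 a (by omega)]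
        exact hQm _ _ hab
      · subst h
        rcases hab.lt_or_eq with h' | rfl
        · have := g1 a h'; omega
        · exact le_rfl
      · obtain ⟨b, rfl⟩ : ∃ b', b = b' + 1 := ⟨b - 1, by omega⟩
        have hb1 := g3 b (by omega) (by omega)
        rcases lt_trichotomy a i with h' | h' | h'
        · have := g1 a h'; omega
        · subst h'; omega
        · obtain ⟨a, rfl⟩ : ∃ a', a = a' + 1 := ⟨a - 1, by omega⟩
          rw [f3 a (by omega) (by omega), f3 b (by omega) (by omega)]
          have := hQm ⟨a, by omega⟩ ⟨b, by omega⟩ (by simp only; omega)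
          omega
    have hfk : ∀ j, j < e + 1 → f j < k := by
      intro j hj
      rcases lt_trichotomy j i with h | h | h
      · have := g1 j h; omega
      · subst h; omega
      · obtain ⟨j, rfl⟩ : ∃ b', j = b' + 1 := ⟨j - 1, by omega⟩
        exact (g3 j (by omega) (by omega)).2
    let P : PreInterleaving k (e + 1) := ⟨fun j => ⟨f j, hfk j j.2⟩, fun a b h => hfm a b h b.2⟩
    have hP : ∀ j, (P j : ℕ) = f j := fun j => rfl
    refine ⟨⟨(P, ⟨i, by omega⟩), by rw [hP]; exact f2, ?_⟩, ?_⟩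
    · apply le_gapSize_of_forall
      · rw [hP, f2]; exact hs
      · intro j hj
        rw [hP, hP, f2]
        exact g1 j hj
    · apply OrderHom.ext
      funext j
      apply Fin.ext
      by_cases h : (j : ℕ) < i
      · rw [hφ1 _ _ h, hP]
        exact f1 j h
      · rw [hφ2 _ _ h, hP, Fin.val_succ, f3 j (by omega) j.2]
        have h1 := mt (hQ j).2 h
        show (Q j : ℕ) + s - 1 + 1 - s = Q j
        omega

open Classical in
theorem sum_gapSize_ge (k e s : ℕ) [Fintype (PreInterleaving k (e + 1))] (E : ℕ → Prop) :
    ∑ P : PreInterleaving k (e + 1), ∑ i, (if s ≤ gapSize P i ∧ E (P i) then 1 else 0) =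
      Nat.card (Fin e →o Fin (k - s + 1)) *
        ∑ p ∈ Finset.range k, if s ≤ p ∧ E p then 1 else 0 := by
  rw [← Finset.sum_product', Finset.univ_product_univ, Finset.mul_sum]
  have h1 : ∀ x : PreInterleaving k (e + 1) × Fin (e + 1),
      (if s ≤ gapSize x.1 x.2 ∧ E (x.1 x.2) then 1 else 0) = ∑ p ∈ Finset.range k,
        if ((x.1 x.2 : ℕ) = p ∧ s ≤ gapSize x.1 x.2) ∧ E p then 1 else 0 := by
    intro x
    rw [Finset.sum_eq_single (x.1 x.2 : ℕ)]
    · simp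
    · intro p _ h
      rw [if_neg]
      rintro ⟨⟨h1, -⟩, -⟩
      exact h h1.symm
    · simp
  rw [Finset.sum_congr rfl fun x _ => h1 x, Finset.sum_comm]
  refine Finset.sum_congr rfl fun p hp => ?_
  rw [Finset.mem_range] at hp
  by_cases h : s ≤ p
  · rw [← card_gapSize_ge h hp, Nat.card_eq_fintype_card, Fintype.card_subtype]
    by_cases hE : E p
    · simp [h, hE]
    · simp [hE]
  · rw [if_neg (fun h' => h h'.1), mul_zero]
    refine Finset.sum_eq_zero fun x _ => if_neg ?_
    rintro ⟨⟨h1, h2⟩, -⟩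
    have := gapSize_le x.1 x.2
    omega

/-! ### Blue trees with a prescribed principal subtree -/

namespace PlaneForest

/-- Insert the tree with principal subtrees `c` as the component with number `i`. -/
def insertTree (c : PlaneForest) : ℕ → PlaneForest → PlaneForest
  | 0, F => cons c F
  -- The value out of range is chosen so that the map is injective on all forests.
  | _ + 1, nil => cons c nil
  | i + 1, cons a F => cons a (insertTree c i F)

theorem insertTree_injective (c : PlaneForest) (i : ℕ) : Function.Injective (insertTree c i) := by
  induction i with
  | zero => intro F G h; simpa [insertTree] using h
  | succ i ih =>
    have hne : ∀ F : PlaneForest, insertTree c i F ≠ nil := by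
      intro F; cases i <;> cases F <;> simp [insertTree]
    intro F G h
    cases F <;> cases G <;> simp only [insertTree, cons.injEq] at h
    · rfl
    · exact absurd h.2.symm (hne _)
    · exact absurd h.2 (hne _)
    · rw [h.1, ih h.2]

theorem trees_getElem?_eq_some_iff {c G : PlaneForest} {i : ℕ} :
    G.trees[i]? = some ⟨c⟩ ↔
      ∃ H, i ≤ H.len ∧ G.len = H.len + 1 ∧ G.size = H.size + (c.size + 1) ∧ G = insertTree c i H := by
  induction i generalizing G with
  | zero =>
    cases G with
    | nil => simp [trees, insertTree]
    | cons a r =>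
      simp only [trees, List.getElem?_cons_zero, Option.some.injEq, PlaneTree.mk.injEq, insertTree,
        cons.injEq]
      constructor
      · rintro rfl
        exact ⟨r, Nat.zero_le _, rfl, by rw [size_cons]; omega, rfl, rfl⟩
      · rintro ⟨H, -, -, -, h, -⟩; exact h
  | succ i ih =>
    cases G with
    | nil =>
      simp only [trees, List.getElem?_nil, reduceCtorEq, false_iff]
      rintro ⟨H, h1, h2, -⟩
      simp [len] at h2
    | cons a r =>
      simp only [trees, List.getElem?_cons_succ]
      rw [ih]
      constructor
      · rintro ⟨H, h1, h2, h3, h4⟩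
        refine ⟨cons a H, ?_, ?_, ?_, ?_⟩
        · simp only [len]; omega
        · simp only [len]; omega
        · simp only [size_cons]; omega
        · rw [insertTree, ← h4]
      · rintro ⟨H, h1, h2, h3, h4⟩
        cases H with
        | nil => simp [len] at h1
        | cons b H =>
          simp only [len, insertTree, cons.injEq, size_cons] at h1 h2 h3 h4
          obtain ⟨rfl, h4⟩ := h4
          exact ⟨H, by omega, by omega, by omega, h4⟩

open Classical in
-- Removing the prescribed component is a bijection, so the count does not depend on `i`. Hence the
-- blue factor is common to all blue roots in the expected proportion.
theorem card_trees_getElem? {e n i : ℕ} (hi : i ≤ e) (c : PlaneForest) (hc : c.size + 1 ≤ n) :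
    {G ∈ ofLenSize (e + 1) n | G.trees[i]? = some ⟨c⟩}.card =
      (ofLenSize e (n - (c.size + 1))).card := by
  rw [← Finset.card_image_of_injective (ofLenSize e (n - (c.size + 1))) (insertTree_injective c i)]
  congr 1
  ext G
  simp only [Finset.mem_filter, mem_ofLenSize, Finset.mem_image, trees_getElem?_eq_some_iff]
  constructor
  · rintro ⟨⟨h1, h2⟩, H, h3, h4, h5, rfl⟩
    exact ⟨H, ⟨by omega, by omega⟩, rfl⟩
  · rintro ⟨H, ⟨h1, h2⟩, rfl⟩
    have h3 : ∀ i ≤ H.len, (insertTree c i H).len = H.len + 1 ∧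
        (insertTree c i H).size = H.size + (c.size + 1) := by
      clear h1 h2
      induction H with
      | nil =>
        intro i hi
        obtain rfl : i = 0 := by simpa [len] using hi
        simp [insertTree, len, size]
      | cons a r _ ih =>
        intro i hi
        cases i with
        | zero => simp only [insertTree, len, size_cons, true_and]; omega
        | succ i =>
          have := ih i (by simpa [len] using hi)
          simp only [insertTree, len, size_cons]
          omega
    have h4 := h3 i (by omega)
    exact ⟨⟨by omega, by omega⟩, H, by omega, h4.1, h4.2, rfl⟩

end PlaneForest

open PlaneForest

/-! ### The total number of occurrences of a pair of subtree and fringe -/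

theorem sum_redTree {M : Type*} [AddCommMonoid M] (K : ℕ) [Fintype (RedTree (K + 1))]
    (φ : PlaneForest → M) :
    ∑ R : RedTree (K + 1), φ R.1.children = ∑ G ∈ ofSize K, φ G := by
  refine Finset.sum_bij (fun R _ => R.1.children) ?_ ?_ ?_ (fun _ _ => rfl)
  · rintro ⟨⟨c⟩, h⟩ _
    simpa [PlaneTree.size] using h
  · rintro ⟨⟨c⟩, h⟩ _ ⟨⟨c'⟩, h'⟩ _ hcc
    simpa using hcc
  · intro c hc
    rw [mem_ofSize] at hc
    exact ⟨⟨⟨c⟩, by simp [PlaneTree.size, hc]⟩, Finset.mem_univ _, rfl⟩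

theorem sum_blueTree {M : Type*} [AddCommMonoid M] (n d : ℕ) [Fintype (BlueTree (n + 1) d)]
    (φ : PlaneForest → M) :
    ∑ B : BlueTree (n + 1) d, φ B.1.children = ∑ G ∈ ofLenSize d n, φ G := by
  refine Finset.sum_bij (fun R _ => R.1.children) ?_ ?_ ?_ (fun _ _ => rfl)
  · rintro ⟨⟨c⟩, h⟩ _
    simpa [PlaneTree.size, PlaneTree.rootDegree, len_eq_length_trees] using h
  · rintro ⟨⟨c⟩, h⟩ _ ⟨⟨c'⟩, h'⟩ _ hcc
    simpa using hcc
  · intro c hc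
    rw [mem_ofLenSize] at hc
    exact ⟨⟨⟨c⟩, by simp [PlaneTree.size, PlaneTree.rootDegree, len_eq_length_trees, hc]⟩,
      Finset.mem_univ _, rfl⟩

theorem card_redTree (K : ℕ) : Nat.card (RedTree (K + 1)) = catalan K := by
  have := Fintype.ofFinite (RedTree (K + 1))
  rw [Nat.card_eq_fintype_card, ← card_ofSize, Finset.card_eq_sum_ones,
    ← sum_redTree K (fun _ => 1)]
  simp

theorem card_blueTree (n d : ℕ) : Nat.card (BlueTree (n + 1) d) = (ofLenSize d n).card := by
  have := Fintype.ofFinite (BlueTree (n + 1) d)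
  rw [Nat.card_eq_fintype_card, Finset.card_eq_sum_ones, ← sum_blueTree n d (fun _ => 1)]
  simp

open Classical in
-- For every possible position of the blue root the number of pre-interleavings with a large enough
-- gap is the same, so the sum is that number times the number of pairs of a red tree and a position
-- at which `F` ends.
theorem sum_endsWith (K e : ℕ) (F : PlaneForest) (hF : F.size ≤ K)
    [Fintype (RedTree (K + 1))] [Fintype (PreInterleaving (K + 1) (e + 1))] :
    ∑ R : RedTree (K + 1), ∑ P : PreInterleaving (K + 1) (e + 1), ∑ i,
      (if F.size ≤ gapSize P i ∧ R.1.children.EndsWith (P i) F then 1 else 0) =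
    (K + 1 + e - F.size).choose e * (2 * K - (2 * F.size - F.len)).choose (K - F.size) := by
  have hc : Nat.card (Fin e →o Fin (K + 1 - F.size + 1)) = (K + 1 + e - F.size).choose e := by
    rw [card_orderHom_fin, Nat.multichoose_eq]
    congr 1
    omega
  have hl := F.len_le_size
  rw [sum_redTree K fun G => ∑ P : PreInterleaving (K + 1) (e + 1), ∑ i,
      (if F.size ≤ gapSize P i ∧ G.EndsWith (P i) F then 1 else 0)]
  rw [Finset.sum_congr rfl fun G _ => sum_gapSize_ge (K + 1) e F.size (fun p => G.EndsWith p F),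
    ← Finset.mul_sum, hc, Finset.sum_comm]
  congr 1
  have := sum_card_endsWith F (K - F.size)
  rw [Nat.sub_add_cancel hF] at this
  rw [show 2 * K - (2 * F.size - F.len) = 2 * (K - F.size) + F.len by omega, ← this]
  refine Finset.sum_congr rfl fun p _ => ?_
  rw [Finset.card_filter]
  refine Finset.sum_congr rfl fun G _ => ?_
  congr 1
  exact propext ⟨And.right, fun h => ⟨h.1, h⟩⟩

open Classical in
/-- The number of occurrences of a red fringe, in all pairs of a red tree and a pre-interleaving. -/
theorem sum_redFringe_add (K e : ℕ) (F : PlaneForest) (hF : F.size + 1 ≤ K)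
    [Fintype (RedTree (K + 1))] [Fintype (PreInterleaving (K + 1) (e + 1))] :
    (∑ R : RedTree (K + 1), ∑ P : PreInterleaving (K + 1) (e + 1), ∑ i,
      (if redFringe R.1 (P i) (gapSize P i) = F then 1 else 0)) +
    ∑ A ∈ grafts F, (K + 1 + e - (F.size + 1)).choose e *
      (2 * K - (2 * (F.size + 1) - A.len)).choose (K - (F.size + 1)) =
    (K + 1 + e - F.size).choose e * (2 * K - (2 * F.size - F.len)).choose (K - F.size) := by
  rw [← sum_endsWith K e F (by omega)]
  have h1 : ∀ A ∈ grafts F, (K + 1 + e - (F.size + 1)).choose e *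
      (2 * K - (2 * (F.size + 1) - A.len)).choose (K - (F.size + 1)) =
      ∑ R : RedTree (K + 1), ∑ P : PreInterleaving (K + 1) (e + 1), ∑ i,
      (if A.size ≤ gapSize P i ∧ R.1.children.EndsWith (P i) A then 1 else 0) := by
    intro A hA
    rw [mem_grafts] at hA
    rw [sum_endsWith K e A (by omega), hA.1]
  rw [Finset.sum_congr rfl h1, Finset.sum_comm (s := grafts F), ← Finset.sum_add_distrib]
  refine Finset.sum_congr rfl fun R _ => ?_
  rw [Finset.sum_comm (s := grafts F), ← Finset.sum_add_distrib]
  refine Finset.sum_congr rfl fun P _ => ?_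
  rw [Finset.sum_comm (s := grafts F), ← Finset.sum_add_distrib]
  refine Finset.sum_congr rfl fun i _ => ?_
  have hR := R.2
  rw [PlaneTree.size] at hR
  rw [← indicator_redFringe_add F (by have := (P i).2; omega) (gapSize_le P i)]
  congr 1
  split_ifs with h
  · refine Finset.sum_congr rfl fun A hA => ?_
    rw [(mem_grafts.1 hA).1]
    simp [h]
  · refine Finset.sum_eq_zero fun A hA => if_neg ?_
    rw [(mem_grafts.1 hA).1]
    exact fun h' => h h'.1

open Classical in
theorem subtreeProportion_eq_sum {k d : ℕ} (R B : PlaneTree) (P : PreInterleaving k d)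
    (T : PlaneTree) (F : PlaneForest) : subtreeProportion R B P T F =
      (∑ i : Fin d, if B.children.trees[(i : ℕ)]? = some T ∧
        redFringe R (P i) (gapSize P i) = F then (1 : ℝ) else 0) / d := by
  rw [subtreeProportion, Finset.sum_boole, Set.ncard_eq_toFinset_card']
  congr 3
  ext i
  simp

/-- The subtree at a blue root depends only on the blue tree and its fringe only on the red tree and
the pre-interleaving, so the two counts multiply. -/
theorem sum_subtreeProportion (K n e : ℕ) (T : PlaneTree) (F : PlaneForest)
    (hT : T.size ≤ n) (hF : F.size + 1 ≤ K)
    [Fintype (PreInterleavedPair (K + 1) (n + 1) (e + 1))] :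
    ∑ x : PreInterleavedPair (K + 1) (n + 1) (e + 1),
      subtreeProportion x.1.1 x.2.1.1 x.2.2 T F =
    (ofLenSize e (n - T.size)).card *
      (((K + 1 + e - F.size).choose e * (2 * K - (2 * F.size - F.len)).choose (K - F.size) : ℝ) -
      ∑ A ∈ grafts F, ((K + 1 + e - (F.size + 1)).choose e : ℝ) *
      (2 * K - (2 * (F.size + 1) - A.len)).choose (K - (F.size + 1))) / (e + 1 : ℕ) := by
  classical
  have := Fintype.ofFinite (RedTree (K + 1))
  have := Fintype.ofFinite (BlueTree (n + 1) (e + 1))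
  have := Fintype.ofFinite (PreInterleaving (K + 1) (e + 1))
  have h := sum_redFringe_add K e F hF
  have h' := congrArg (Nat.cast (R := ℝ)) h
  push_cast at h'
  rw [← eq_sub_iff_add_eq] at h'
  rw [← h']
  have h1 : ∑ x : PreInterleavedPair (K + 1) (n + 1) (e + 1),
      subtreeProportion x.1.1 x.2.1.1 x.2.2 T F =
      ∑ R : RedTree (K + 1), ∑ B : BlueTree (n + 1) (e + 1),
        ∑ P : PreInterleaving (K + 1) (e + 1), subtreeProportion R.1 B.1 P T F := by
    rw [← Finset.sum_product', ← Finset.sum_product']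
    refine Finset.sum_bij (fun x _ => ((x.1, x.2.1), x.2.2)) ?_ ?_ ?_ ?_
    · intros; simp
    · rintro ⟨a, b, c⟩ _ ⟨a', b', c'⟩ _ h
      simp only [Prod.mk.injEq] at h ⊢
      exact ⟨h.1.1, h.1.2, h.2⟩
    · rintro ⟨⟨a, b⟩, c⟩ _
      exact ⟨(a, b, c), Finset.mem_univ _, rfl⟩
    · intros; rfl
  rw [h1, mul_div_assoc]
  simp_rw [subtreeProportion_eq_sum]
  have h2 : ∀ i : Fin (e + 1), ∑ B : BlueTree (n + 1) (e + 1),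
      (if B.1.children.trees[(i : ℕ)]? = some T then (1 : ℝ) else 0) =
      (ofLenSize e (n - T.size)).card := by
    intro i
    rw [sum_blueTree n (e + 1) (fun G => if G.trees[(i : ℕ)]? = some T then (1 : ℝ) else 0),
      Finset.sum_boole]
    congr 1
    exact card_trees_getElem? (by omega) T.children hT
  simp_rw [← Finset.sum_div]
  rw [← mul_div_assoc]
  congr 1
  rw [Finset.mul_sum]
  refine Finset.sum_congr rfl fun R _ => ?_
  rw [Finset.sum_comm, Finset.mul_sum]
  refine Finset.sum_congr rfl fun P _ => ?_
  rw [Finset.sum_comm, Finset.mul_sum]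
  refine Finset.sum_congr rfl fun i _ => ?_
  rw [← h2 i, Finset.sum_mul]
  refine Finset.sum_congr rfl fun B _ => ?_
  rw [ite_and]
  split_ifs <;> simp

/-! ### Limits of ratios of binomial coefficients -/

/-- `a k` is asymptotically `α k`. -/
def HasSlope (a : ℕ → ℕ) (α : ℝ) : Prop := Tendsto (fun k => (a k : ℝ) / k) atTop (𝓝 α)

theorem HasSlope.tendsto {a : ℕ → ℕ} {α : ℝ} (ha : HasSlope a α) (hα : 0 < α) :
    Tendsto a atTop atTop := by
  rw [← tendsto_natCast_atTop_iff (R := ℝ)]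
  have h : Tendsto (fun k : ℕ => (a k : ℝ) / k * k) atTop atTop :=
    Tendsto.pos_mul_atTop hα ha tendsto_natCast_atTop_atTop
  refine h.congr' ?_
  filter_upwards [eventually_gt_atTop 0] with k hk
  field_simp

theorem HasSlope.add_const {a : ℕ → ℕ} {α : ℝ} (ha : HasSlope a α) (u : ℕ) :
    HasSlope (fun k => a k + u) α := by
  have h := ha.add (tendsto_const_div_atTop_nhds_zero_nat (u : ℝ))
  rw [add_zero] at h
  refine h.congr fun k => ?_
  push_cast
  ring

theorem HasSlope.sub_const {a : ℕ → ℕ} {α : ℝ} (ha : HasSlope a α) (hα : 0 < α) (u : ℕ) :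
    HasSlope (fun k => a k - u) α := by
  have h := ha.sub (tendsto_const_div_atTop_nhds_zero_nat (u : ℝ))
  rw [sub_zero] at h
  refine h.congr' ?_
  filter_upwards [(ha.tendsto hα).eventually_ge_atTop u] with k hk
  rw [Nat.cast_sub hk]
  ring

theorem HasSlope.add {a b : ℕ → ℕ} {α β : ℝ} (ha : HasSlope a α) (hb : HasSlope b β) :
    HasSlope (fun k => a k + b k) (α + β) := by
  refine (Tendsto.add ha hb).congr fun k => ?_
  push_cast
  ring

theorem HasSlope.eventually_lt {a b : ℕ → ℕ} {α β : ℝ} (ha : HasSlope a α) (hb : HasSlope b β)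
    (h : β < α) : ∀ᶠ k in atTop, b k < a k := by
  filter_upwards [Tendsto.eventually_lt hb ha h, eventually_gt_atTop 0] with k hk hk0
  have : (0 : ℝ) < k := by exact_mod_cast hk0
  rw [div_lt_div_iff_of_pos_right this] at hk
  exact_mod_cast hk

theorem HasSlope.sub {a b : ℕ → ℕ} {α β : ℝ} (ha : HasSlope a α) (hb : HasSlope b β)
    (h : β < α) : HasSlope (fun k => a k - b k) (α - β) := by
  refine (Tendsto.sub ha hb).congr' ?_
  filter_upwards [ha.eventually_lt hb h] with k hk
  rw [Nat.cast_sub hk.le]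
  ring

theorem hasSlope_id : HasSlope (fun k => k) 1 := by
  refine tendsto_const_nhds.congr' ?_
  filter_upwards [eventually_gt_atTop 0] with k hk
  rw [div_self (by positivity)]

theorem HasSlope.div {a b : ℕ → ℕ} {α β : ℝ} (ha : HasSlope a α) (hb : HasSlope b β) (h : β ≠ 0) :
    Tendsto (fun k => (a k : ℝ) / b k) atTop (𝓝 (α / β)) := by
  refine (Tendsto.div ha hb h).congr' ?_
  filter_upwards [eventually_gt_atTop 0] with k hk
  have : (k : ℝ) ≠ 0 := by positivity
  rw [Pi.div_apply, div_div_div_cancel_right₀ this]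

theorem tendsto_choose_pred_left {a b : ℕ → ℕ} {α β : ℝ} (ha : HasSlope a α) (hb : HasSlope b β)
    (hβ : 0 < β) (h : β < α) :
    Tendsto (fun k => ((a k - 1).choose (b k) : ℝ) / (a k).choose (b k)) atTop
      (𝓝 ((α - β) / α)) := by
  refine ((ha.sub hb h).div ha (hβ.trans h).ne').congr' ?_
  filter_upwards [ha.eventually_lt hb h] with k hk
  obtain ⟨c, hc⟩ : ∃ c, a k = c + 1 := ⟨a k - 1, by omega⟩
  have h1 := Nat.choose_mul_succ_eq c (b k)
  rw [← hc] at h1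
  have h2 : 0 < (a k).choose (b k) := Nat.choose_pos hk.le
  rw [show a k - 1 = c by omega, div_eq_div_iff (by norm_cast; omega) (by positivity)]
  norm_cast
  linarith

theorem tendsto_choose_pred_right {a b : ℕ → ℕ} {α β : ℝ} (ha : HasSlope a α) (hb : HasSlope b β)
    (hβ : 0 < β) (h : β < α) :
    Tendsto (fun k => ((a k).choose (b k - 1) : ℝ) / (a k).choose (b k)) atTop
      (𝓝 (β / (α - β))) := by
  refine (hb.div ((ha.sub hb h).add_const 1) (by linarith)).congr' ?_
  filter_upwards [ha.eventually_lt hb h, (hb.tendsto hβ).eventually_gt_atTop 0] with k hk hk0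
  obtain ⟨c, hc⟩ : ∃ c, b k = c + 1 := ⟨b k - 1, by omega⟩
  have h1 := Nat.choose_succ_right_eq (a k) c
  rw [← hc] at h1
  have h2 : 0 < (a k).choose (b k) := Nat.choose_pos hk.le
  rw [show b k - 1 = c by omega, div_eq_div_iff (by norm_cast) (by positivity)]
  norm_cast
  rw [show a k - b k + 1 = a k - c by omega]
  linarith

/-- A bounded shift is a bounded number of unit shifts, each of which multiplies the binomial
coefficient by a convergent rational factor. The value of the limit is never needed. -/
theorem exists_tendsto_choose_sub {a b : ℕ → ℕ} {α β : ℝ} (ha : HasSlope a α) (hb : HasSlope b β)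
    (hβ : 0 < β) (h : β < α) (u v : ℕ) :
    ∃ L, Tendsto (fun k => ((a k - u).choose (b k - v) : ℝ) / (a k).choose (b k)) atTop (𝓝 L) := by
  have hne : ∀ u v, ∀ᶠ k in atTop, ((a k - u).choose (b k - v) : ℝ) ≠ 0 := by
    intro u v
    filter_upwards [(ha.sub_const (hβ.trans h) u).eventually_lt (hb.sub_const hβ v) h] with k hk
    have : 0 < (a k - u).choose (b k - v) := Nat.choose_pos hk.le
    positivity
  induction u with
  | zero =>
    induction v with
    | zero =>
      refine ⟨1, tendsto_const_nhds.congr' ?_⟩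
      filter_upwards [hne 0 0] with k hk
      exact (div_self hk).symm
    | succ v ih =>
      obtain ⟨L, hL⟩ := ih
      refine ⟨_, (hL.mul (tendsto_choose_pred_right ha (hb.sub_const hβ v) hβ h)).congr' ?_⟩
      filter_upwards [hne 0 v] with k hk
      simp only [Nat.sub_zero] at hk ⊢
      rw [mul_comm, div_mul_div_cancel₀ hk, Nat.sub_sub]
  | succ u ih =>
    obtain ⟨L, hL⟩ := ih
    refine ⟨_, (hL.mul (tendsto_choose_pred_left (ha.sub_const (hβ.trans h) u)
      (hb.sub_const hβ v) hβ h)).congr' ?_⟩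
    filter_upwards [hne u v] with k hk
    rw [mul_comm, div_mul_div_cancel₀ hk, Nat.sub_sub]

/-! ### The limit of the mean proportion -/

open PlaneForest

theorem hasSlope_ceil {c : ℝ} (hc : 0 ≤ c) : HasSlope (fun k => ⌈c * k⌉₊) c :=
  (tendsto_nat_ceil_mul_div_atTop hc).comp tendsto_natCast_atTop_atTop

theorem card_ofLenSize_eq {d n : ℕ} (hd : 0 < d) (hn : d ≤ n) :
    ((ofLenSize d n).card : ℝ) = d / n * (2 * n - d - 1).choose (n - d) := by
  obtain ⟨d, rfl⟩ : ∃ d', d = d' + 1 := ⟨d - 1, by omega⟩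
  obtain ⟨m, rfl⟩ : ∃ m, n = d + 1 + m := ⟨n - (d + 1), by omega⟩
  have h := mul_card_ofLenSize d m
  have h0 : ((d + 1 + m : ℕ) : ℝ) ≠ 0 := by positivity
  rw [show 2 * (d + 1 + m) - (d + 1) - 1 = 2 * m + d by omega,
    show d + 1 + m - (d + 1) = m by omega, div_mul_eq_mul_div, eq_div_iff h0]
  norm_cast
  linarith

theorem exists_tendsto_card_ofLenSize {d n : ℕ → ℕ} {α β : ℝ} (hd : HasSlope d β)
    (hn : HasSlope n α) (hβ : 0 < β) (h : β < α) (s : ℕ) :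
    ∃ L, Tendsto (fun k => ((ofLenSize (d k - 1) (n k - (s + 1))).card : ℝ) /
      (ofLenSize (d k) (n k)).card) atTop (𝓝 L) := by
  have hα := hβ.trans h
  -- Removing one component with `s + 1` vertices lowers `2n - d - 1` by `2s + 1` and `n - d` by
  -- `s`.
  obtain ⟨L, hL⟩ := exists_tendsto_choose_sub (((hn.add hn).sub hd (by linarith)).sub_const (by linarith) 1)
    (hn.sub hd h) (by linarith) (by linarith) (2 * s + 1) s
  refine ⟨_, ((((hd.sub_const hβ 1).div hd hβ.ne').mul
    (hn.div (hn.sub_const hα (s + 1)) hα.ne')).mul hL).congr' ?_⟩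
  filter_upwards [hn.eventually_lt hd h, (hd.tendsto hβ).eventually_gt_atTop 1,
    (hn.sub_const hα (s + 1)).eventually_lt hd h] with k h1 h2 h3
  rw [card_ofLenSize_eq (by omega) h1.le, card_ofLenSize_eq (by omega) (by omega)]
  rw [show 2 * (n k - (s + 1)) - (d k - 1) - 1 = n k + n k - d k - 1 - (2 * s + 1) by omega,
    show n k - (s + 1) - (d k - 1) = n k - d k - s by omega, ← two_mul]
  have e1 : (n k : ℝ) ≠ 0 := by norm_cast; omega
  have e2 : (d k : ℝ) ≠ 0 := by norm_cast; omega
  have e3 : ((n k - (s + 1) : ℕ) : ℝ) ≠ 0 := by norm_cast; omega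
  field_simp

/-- The factor `k` between the Catalan number and the central binomial coefficient is compensated by
the division by the number `d k` of blue roots. -/
theorem exists_tendsto_fringe {d : ℕ → ℕ} {β : ℝ} (hd : HasSlope d β) (hβ : 0 < β) (f r : ℕ) :
    ∃ L, Tendsto (fun k => ((k - 1 + d k - f).choose (d k - 1) : ℝ) *
      (2 * (k - 1) - r).choose (k - 1 - f) /
      (d k * catalan (k - 1) * (k - 1 + d k).choose (d k))) atTop (𝓝 L) := by
  have hk : HasSlope (fun k => k - 1) 1 := hasSlope_id.sub_const one_pos 1
  obtain ⟨L, hL⟩ := exists_tendsto_choose_sub (hk.add hd) hd hβ (by linarith) f 1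
  obtain ⟨L', hL'⟩ := exists_tendsto_choose_sub (hk.add hk) hk one_pos (by linarith) r f
  refine ⟨_, ((hL.mul hL').mul (hasSlope_id.div hd hβ.ne')).congr' ?_⟩
  filter_upwards [(hd.tendsto hβ).eventually_gt_atTop 0, eventually_gt_atTop 0] with k h1 h2
  have e := succ_mul_catalan_eq_centralBinom (k - 1)
  rw [Nat.centralBinom_eq_two_mul_choose, Nat.sub_add_cancel h2] at e
  rw [← two_mul, ← e]
  have e1 : (d k : ℝ) ≠ 0 := by positivity
  have e2 : (k : ℝ) ≠ 0 := by positivity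
  push_cast
  field_simp

theorem exists_tendsto_meanProportion {lam δ : ℝ} (hlam : 0 < lam) (hδ₀ : 0 < δ) (hδ₁ : δ < 1)
    (T : PlaneTree) (F : PlaneForest) :
    ∃ L, Tendsto (fun k : ℕ => meanProportion lam δ k T F) atTop (𝓝 L) := by
  have hd : HasSlope (blueDegree lam δ) (δ * lam) := hasSlope_ceil (by positivity)
  have hl : HasSlope (blueSize lam) lam := hasSlope_ceil hlam.le
  have hn := hl.sub_const hlam 1
  have hβ : 0 < δ * lam := by positivity
  have hlt : δ * lam < lam := by nlinarith
  obtain ⟨L₁, h₁⟩ := exists_tendsto_card_ofLenSize hd hn hβ hlt T.children.size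
  obtain ⟨L₂, h₂⟩ := exists_tendsto_fringe hd hβ F.size (2 * F.size - F.len)
  choose L₃ h₃ using fun A : PlaneForest =>
    exists_tendsto_fringe hd hβ (F.size + 1) (2 * (F.size + 1) - A.len)
  refine ⟨_, (h₁.mul (h₂.sub (tendsto_finsetSum (grafts F) fun A _ => h₃ A))).congr' ?_⟩
  filter_upwards [(hd.tendsto hβ).eventually_gt_atTop 0, eventually_gt_atTop (F.size + 1),
    (hl.tendsto hlam).eventually_gt_atTop T.size] with k hk1 hk2 hk3
  obtain ⟨K, rfl⟩ : ∃ K, k = K + 1 := ⟨k - 1, by omega⟩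
  rw [meanProportion]
  generalize blueDegree lam δ (K + 1) = d at *
  generalize blueSize lam (K + 1) = l at *
  obtain ⟨e, rfl⟩ : ∃ e, d = e + 1 := ⟨d - 1, by omega⟩
  obtain ⟨n, rfl⟩ : ∃ n, l = n + 1 := ⟨l - 1, by omega⟩
  have := Fintype.ofFinite (PreInterleavedPair (K + 1) (n + 1) (e + 1))
  rw [finsum_eq_sum_of_fintype, sum_subtreeProportion K n e T F (by omega) (by omega),
    Nat.card_prod, Nat.card_prod, card_redTree, card_blueTree, card_preInterleaving]
  simp only [Nat.add_sub_cancel]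
  rw [← Finset.sum_div, show K + 1 + e = K + (e + 1) by omega]
  push_cast
  rw [show T.size = T.children.size + 1 from rfl]
  generalize ((ofLenSize e (n - (T.children.size + 1))).card : ℝ) = x1
  generalize ((ofLenSize (e + 1) n).card : ℝ) = x2
  rw [← sub_div, div_mul_div_comm, div_div]
  congr 1
  ring

namespace PlaneForest

/-! ### The drawings of plane forests -/

/-- The number of proper descendants of the vertex with number `a` in preorder. -/
def desc : PlaneForest → ℕ → ℕ
  | nil, _ => 0
  | cons c _, 0 => c.size
  | cons c r, a + 1 => if a < c.size then c.desc a else r.desc (a - c.size)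

/-- The height of the point with number `a` from the left in the red drawing. -/
def redHeight : PlaneForest → ℕ → ℕ
  | nil, _ => 0
  | cons _ r, 0 => r.size
  | cons c r, a + 1 => if a < c.size then c.redHeight a + (r.size + 1) else r.redHeight (a - c.size)

/-- The number of proper descendants of the vertex with number `i` in postorder. -/
def postDesc : PlaneForest → ℕ → ℕ
  | nil, _ => 0
  | cons c r, i => if i < c.size then c.postDesc i else
      if i = c.size then c.size else r.postDesc (i - (c.size + 1))

/-- The height of the point with number `i` from the left in the blue drawing. -/
def blueHeight : PlaneForest → ℕ → ℕ
  | nil, _ => 0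
  | cons c r, i => if i < c.size then c.blueHeight i + r.size else
      if i = c.size then r.size + c.size else r.blueHeight (i - (c.size + 1))

/-- The mirror image of a plane forest. -/
def mirror : PlaneForest → PlaneForest
  | nil => nil
  | cons c r => r.mirror.append (cons c.mirror nil)

@[simp] theorem size_nil : nil.size = 0 := rfl

theorem size_mirror (F : PlaneForest) : F.mirror.size = F.size := by
  induction F with
  | nil => rfl
  | cons c r ihc ihr => simp only [mirror, size_append, size_cons, ihc, ihr, size_nil]; omega

theorem len_mirror (F : PlaneForest) : F.mirror.len = F.len := by
  induction F with
  | nil => rfl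
  | cons c r ihc ihr => simp only [mirror, len_append, len, ihr]

theorem mirror_append (F G : PlaneForest) :
    (F.append G).mirror = G.mirror.append F.mirror := by
  induction F with
  | nil => simp only [append, mirror, append_nil]
  | cons c r _ ih => simp only [append, mirror, ih, append_assoc]

theorem mirror_mirror (F : PlaneForest) : F.mirror.mirror = F := by
  induction F with
  | nil => rfl
  | cons c r ihc ihr => simp only [mirror, mirror_append, ihc, ihr, append]

theorem desc_lt {F : PlaneForest} {a : ℕ} (h : a < F.size) : a + F.desc a < F.size := by
  induction F generalizing a with
  | nil => simp at h
  | cons c r ihc ihr =>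
    rw [size_cons] at h ⊢
    cases a with
    | zero => simp only [desc]; omega
    | succ a =>
      simp only [desc]
      split_ifs with h1
      · have := ihc h1; omega
      · have := ihr (a := a - c.size) (by omega); omega

theorem redHeight_lt {F : PlaneForest} {a : ℕ} (h : a < F.size) : F.redHeight a < F.size := by
  induction F generalizing a with
  | nil => simp at h
  | cons c r ihc ihr =>
    rw [size_cons] at h ⊢
    cases a with
    | zero => simp only [redHeight]; omega
    | succ a =>
      simp only [redHeight]
      split_ifs with h1
      · have := ihc h1; omega
      · have := ihr (a := a - c.size) (by omega); omega

/-- Left to right is preorder, so the descendants of `a` directly follow it; they are above `a`, and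
everything after them is in a lower tree. -/
theorem redHeight_lt_iff {F : PlaneForest} {a b : ℕ} (hab : a < b) (hb : b < F.size) :
    (F.redHeight a < F.redHeight b ↔ b ≤ a + F.desc a) ∧ F.redHeight a ≠ F.redHeight b := by
  induction F generalizing a b with
  | nil => simp at hb
  | cons c r ihc ihr =>
    rw [size_cons] at hb
    obtain ⟨b, rfl⟩ : ∃ b', b = b' + 1 := ⟨b - 1, by omega⟩
    cases a with
    | zero =>
      simp only [redHeight, desc]
      split_ifs with h1
      · omega
      · have := redHeight_lt (F := r) (a := b - c.size) (by omega); omega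
    | succ a =>
      simp only [redHeight, desc]
      by_cases h1 : a < c.size
      · rw [if_pos h1, if_pos h1]
        by_cases h2 : b < c.size
        · rw [if_pos h2]; have := ihc (a := a) (b := b) (by omega) h2; omega
        · rw [if_neg h2]
          have := redHeight_lt (F := r) (a := b - c.size) (by omega)
          have := desc_lt h1
          omega
      · rw [if_neg h1, if_neg h1, if_neg (show ¬ b < c.size by omega)]
        have := ihr (a := a - c.size) (b := b - c.size) (by omega) (by omega)
        omega

theorem postDesc_le (F : PlaneForest) (i : ℕ) : F.postDesc i ≤ i := by
  induction F generalizing i with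
  | nil => simp [postDesc]
  | cons c r ihc ihr =>
    simp only [postDesc]
    have := ihc i
    have := ihr (i - (c.size + 1))
    split_ifs <;> omega

theorem blueHeight_lt {F : PlaneForest} {i : ℕ} (h : i < F.size) : F.blueHeight i < F.size := by
  induction F generalizing i with
  | nil => simp at h
  | cons c r ihc ihr =>
    rw [size_cons] at h ⊢
    simp only [blueHeight]
    split_ifs with h1 h2
    · have := ihc h1; omega
    · omega
    · have := ihr (i := i - (c.size + 1)) (by omega); omega

/-- Left to right is postorder in blue, so the descendants of `j` directly precede it. -/
theorem blueHeight_lt_iff {F : PlaneForest} {i j : ℕ} (hij : i < j) (hj : j < F.size) :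
    (F.blueHeight i < F.blueHeight j ↔ j - F.postDesc j ≤ i) ∧
      F.blueHeight i ≠ F.blueHeight j := by
  induction F generalizing i j with
  | nil => simp at hj
  | cons c r ihc ihr =>
    rw [size_cons] at hj
    simp only [blueHeight, postDesc]
    by_cases h1 : j < c.size
    · rw [if_pos h1, if_pos h1, if_pos (hij.trans h1)]
      have := ihc hij h1
      omega
    · rw [if_neg h1, if_neg h1]
      by_cases h2 : j = c.size
      · rw [if_pos h2, if_pos h2, if_pos (by omega)]
        have := blueHeight_lt (F := c) (i := i) (by omega)
        omega
      · rw [if_neg h2, if_neg h2]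
        have h5 := blueHeight_lt (F := r) (i := j - (c.size + 1)) (by omega)
        have h6 := postDesc_le r (j - (c.size + 1))
        by_cases h3 : i < c.size
        · rw [if_pos h3]; omega
        · rw [if_neg h3]
          by_cases h4 : i = c.size
          · rw [if_pos h4]; omega
          · rw [if_neg h4]
            have := ihr (i := i - (c.size + 1)) (j := j - (c.size + 1)) (by omega) (by omega)
            omega

theorem redHeight_append (F G : PlaneForest) (a : ℕ) : (F.append G).redHeight a =
    if a < F.size then F.redHeight a + G.size else G.redHeight (a - F.size) := by
  induction F generalizing a with
  | nil => simp [append]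
  | cons c r _ ih =>
    rw [size_cons]
    cases a with
    | zero => simp [append, redHeight, size_append]
    | succ a =>
      simp only [append, redHeight, ih, size_append]
      by_cases h1 : a < c.size
      · rw [if_pos h1, if_pos h1, if_pos (show a + 1 < c.size + 1 + r.size by omega)]; omega
      · rw [if_neg h1, if_neg h1]
        by_cases h2 : a - c.size < r.size
        · rw [if_pos h2, if_pos (show a + 1 < c.size + 1 + r.size by omega)]
        · rw [if_neg h2, if_neg (show ¬ a + 1 < c.size + 1 + r.size by omega)]
          congr 1
          omega

theorem blueHeight_append (F G : PlaneForest) (i : ℕ) : (F.append G).blueHeight i =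
    if i < F.size then F.blueHeight i + G.size else G.blueHeight (i - F.size) := by
  induction F generalizing i with
  | nil => simp [append]
  | cons c r _ ih =>
    rw [size_cons]
    simp only [append, blueHeight, ih, size_append]
    by_cases h1 : i < c.size
    · rw [if_pos h1, if_pos h1, if_pos (show i < c.size + 1 + r.size by omega)]; omega
    · rw [if_neg h1, if_neg h1]
      by_cases h3 : i = c.size
      · rw [if_pos h3, if_pos h3, if_pos (show i < c.size + 1 + r.size by omega)]; omega
      · rw [if_neg h3, if_neg h3]
        by_cases h2 : i - (c.size + 1) < r.size
        · rw [if_pos h2, if_pos (show i < c.size + 1 + r.size by omega)]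
        · rw [if_neg h2, if_neg (show ¬ i < c.size + 1 + r.size by omega)]
          congr 1
          omega

theorem desc_append (F G : PlaneForest) (a : ℕ) : (F.append G).desc a =
    if a < F.size then F.desc a else G.desc (a - F.size) := by
  induction F generalizing a with
  | nil => simp [append]
  | cons c r _ ih =>
    rw [size_cons]
    cases a with
    | zero => simp [append, desc]
    | succ a =>
      simp only [append, desc, ih]
      by_cases h1 : a < c.size
      · rw [if_pos h1, if_pos h1, if_pos (show a + 1 < c.size + 1 + r.size by omega)]
      · rw [if_neg h1, if_neg h1]
        by_cases h2 : a - c.size < r.size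
        · rw [if_pos h2, if_pos (show a + 1 < c.size + 1 + r.size by omega)]
        · rw [if_neg h2, if_neg (show ¬ a + 1 < c.size + 1 + r.size by omega)]
          congr 1
          omega

theorem desc_drop (F : PlaneForest) (q a : ℕ) : (F.drop q).desc a = F.desc (q + a) := by
  induction q generalizing F with
  | zero => simp
  | succ q ih =>
    cases F with
    | nil => simp [desc]
    | cons c r => rw [drop_succ_cons, ih, desc_append, Nat.add_right_comm, desc]

/-- Reflection in the diagonal exchanges upper left and lower right but keeps the lower left, so it
reverses the order of siblings. The heights of the mirror image thus form the inverse permutation;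
the same holds in blue. -/
theorem redHeight_mirror {F : PlaneForest} {a : ℕ} (h : a < F.size) :
    F.mirror.redHeight (F.redHeight a) = a := by
  induction F generalizing a with
  | nil => simp at h
  | cons c r ihc ihr =>
    rw [size_cons] at h
    rw [mirror, redHeight_append, size_mirror]
    cases a with
    | zero => simp [redHeight]
    | succ a =>
      by_cases h1 : a < c.size
      · have e : (cons c r).redHeight (a + 1) = c.redHeight a + (r.size + 1) := by
          simp [redHeight, h1]
        rw [e, if_neg (by omega), show c.redHeight a + (r.size + 1) - r.size =
          c.redHeight a + 1 by omega, redHeight, size_mirror, if_pos (redHeight_lt h1), ihc h1]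
        rfl
      · have h2 := redHeight_lt (F := r) (a := a - c.size) (by omega)
        have e : (cons c r).redHeight (a + 1) = r.redHeight (a - c.size) := by
          simp [redHeight, h1]
        rw [e, if_pos h2, ihr (by omega), size_cons, size_mirror, size_nil]
        omega

theorem blueHeight_mirror {F : PlaneForest} {i : ℕ} (h : i < F.size) :
    F.mirror.blueHeight (F.blueHeight i) = i := by
  induction F generalizing i with
  | nil => simp at h
  | cons c r ihc ihr =>
    rw [size_cons] at h
    rw [mirror, blueHeight_append, size_mirror]
    by_cases h1 : i < c.size
    · have e : (cons c r).blueHeight i = c.blueHeight i + r.size := by simp [blueHeight, h1]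
      rw [e, if_neg (by omega), Nat.add_sub_cancel, blueHeight, size_mirror,
        if_pos (blueHeight_lt h1), ihc h1]
      rfl
    · by_cases h2 : i = c.size
      · have e : (cons c r).blueHeight i = r.size + c.size := by simp [blueHeight, h2]
        rw [e, if_neg (by omega), Nat.add_sub_cancel_left, blueHeight, size_mirror,
          if_neg (lt_irrefl _), if_pos rfl, size_nil]
        omega
      · have h3 := blueHeight_lt (F := r) (i := i - (c.size + 1)) (by omega)
        have e : (cons c r).blueHeight i = r.blueHeight (i - (c.size + 1)) := by
          simp [blueHeight, h1, h2]
        rw [e, if_pos h3, ihr (by omega), size_cons, size_mirror, size_nil]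
        omega

theorem eq_of_redHeight_eq {F G : PlaneForest} (hs : F.size = G.size)
    (h : ∀ a < F.size, F.redHeight a = G.redHeight a) : F = G := by
  induction F generalizing G with
  | nil => exact (size_eq_zero.1 hs.symm).symm
  | cons c r ihc ihr =>
    cases G with
    | nil => simp [size_cons] at hs
    | cons c' r' =>
      rw [size_cons] at h hs
      rw [size_cons] at hs
      -- The leftmost point is the root of the first tree, and exactly the other trees are below it.
      have h0 := h 0 (by omega)
      simp only [redHeight] at h0
      have hc : c.size = c'.size := by omega
      congr 1
      · refine ihc hc fun a ha => ?_
        have := h (a + 1) (by omega)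
        simp only [redHeight] at this
        rw [if_pos ha, if_pos (hc ▸ ha)] at this
        omega
      · refine ihr h0 fun a ha => ?_
        have := h (a + c.size + 1) (by omega)
        simp only [redHeight] at this
        rw [if_neg (by omega), if_neg (by omega), ← hc, Nat.add_sub_cancel] at this
        exact this

theorem eq_of_blueHeight_eq {F G : PlaneForest} (hs : F.size = G.size)
    (h : ∀ i < F.size, F.blueHeight i = G.blueHeight i) : F = G := by
  induction F generalizing G with
  | nil => exact (size_eq_zero.1 hs.symm).symm
  | cons c r ihc ihr =>
    cases G with
    | nil => simp [size_cons] at hs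
    | cons c' r' =>
      have hne := @blueHeight_lt_iff (cons c' r') c.size c'.size
      have hne' := @blueHeight_lt_iff (cons c r) c'.size c.size
      rw [size_cons] at h hs hne hne'
      rw [size_cons] at hs
      have h0 := h c.size (by omega)
      have h0' : (cons c r).blueHeight c.size = r.size + c.size := by simp [blueHeight]
      have h1 : (cons c' r').blueHeight c'.size = r'.size + c'.size := by simp [blueHeight]
      -- The highest point of a blue forest is the root of its first tree, so its position gives the
      -- size of that tree.
      have hc : c.size = c'.size := by
        rcases lt_trichotomy c.size c'.size with h2 | h2 | h2
        · exact absurd (by omega) (hne h2 (by omega)).2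
        · exact h2
        · have h4 := h c'.size (by omega)
          exact absurd (by omega) (hne' h2 (by omega)).2
      congr 1
      · refine ihc hc fun i hi => ?_
        have := h i (by omega)
        simp only [blueHeight] at this
        rw [if_pos hi, if_pos (hc ▸ hi)] at this
        omega
      · refine ihr (by omega) fun i hi => ?_
        have := h (i + (c.size + 1)) (by omega)
        simp only [blueHeight] at this
        rw [if_neg (by omega), if_neg (by omega), if_neg (by omega), if_neg (by omega), ← hc,
          Nat.add_sub_cancel] at this
        exact this

/-- The roots of a blue forest are the points with no other point to the upper right. -/
theorem card_blue_roots (F : PlaneForest) :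
    {i ∈ Finset.range F.size | ∀ j < F.size, i < j → F.blueHeight j < F.blueHeight i}.card =
      F.len := by
  induction F with
  | nil => simp [len]
  | cons c r _ ih =>
    have key : ({i ∈ Finset.range (cons c r).size | ∀ j < (cons c r).size, i < j →
        (cons c r).blueHeight j < (cons c r).blueHeight i}) = insert c.size
        (({i ∈ Finset.range r.size | ∀ j < r.size, i < j → r.blueHeight j < r.blueHeight i}).map
          (addRightEmbedding (c.size + 1))) := by
      ext i
      simp only [Finset.mem_filter, Finset.mem_range, Finset.mem_insert, Finset.mem_map,
        addRightEmbedding_apply]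
      rw [size_cons]
      have hsh : ∀ j, (cons c r).blueHeight (j + (c.size + 1)) = r.blueHeight j := by
        intro j
        simp only [blueHeight]
        rw [if_neg (by omega), if_neg (by omega), Nat.add_sub_cancel]
      have h0 : (cons c r).blueHeight c.size = r.size + c.size := by simp [blueHeight]
      constructor
      · rintro ⟨h1, h2⟩
        rcases lt_trichotomy i c.size with h3 | h3 | h3
        · have h4 := h2 c.size (by omega) h3
          rw [h0] at h4
          simp only [blueHeight] at h4
          rw [if_pos h3] at h4
          have := blueHeight_lt h3
          omega
        · exact Or.inl h3
        · right
          obtain ⟨i, rfl⟩ : ∃ i', i = i' + (c.size + 1) := ⟨i - (c.size + 1), by omega⟩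
          refine ⟨i, ⟨by omega, fun j hj hij => ?_⟩, rfl⟩
          have := h2 (j + (c.size + 1)) (by omega) (by omega)
          rwa [hsh, hsh] at this
      · rintro (rfl | ⟨i, ⟨h1, h2⟩, rfl⟩)
        · refine ⟨by omega, fun j hj hij => ?_⟩
          obtain ⟨j, rfl⟩ : ∃ i', j = i' + (c.size + 1) := ⟨j - (c.size + 1), by omega⟩
          rw [hsh, h0]
          have := blueHeight_lt (F := r) (i := j) (by omega)
          omega
        · refine ⟨by omega, fun j hj hij => ?_⟩
          obtain ⟨j, rfl⟩ : ∃ i', j = i' + (c.size + 1) := ⟨j - (c.size + 1), by omega⟩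
          rw [hsh, hsh]
          exact h2 j (by omega) (by omega)
    rw [key, Finset.card_insert_of_notMem, Finset.card_map, ih, len]
    simp only [Finset.mem_map, addRightEmbedding_apply, not_exists, not_and]
    intro i _
    omega

theorem redSeq_eq_map (F : PlaneForest) : F.redSeq = (List.range F.size).map F.redHeight := by
  induction F with
  | nil => rfl
  | cons c r ihc ihr =>
    rw [size_cons, show c.size + 1 + r.size = (c.size + r.size) + 1 by omega,
      List.range_succ_eq_map, List.range_add]
    simp only [redSeq, List.map_cons, List.map_append, List.map_map, redHeight]
    congr 2
    · rw [ihc, List.map_map]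
      refine List.map_congr_left fun a ha => ?_
      rw [List.mem_range] at ha
      simp [redHeight, ha]
    · rw [ihr]
      refine List.map_congr_left fun a _ => ?_
      simp [redHeight]

theorem blueSeq_eq_map (F : PlaneForest) :
    F.blueSeq = (List.range F.size).map F.blueHeight := by
  induction F with
  | nil => rfl
  | cons c r ihc ihr =>
    rw [size_cons, show c.size + 1 + r.size = c.size + (1 + r.size) by omega, List.range_add,
      List.range_add]
    simp only [blueSeq, List.map_append, List.map_map, List.range_one, List.map_cons,
      List.singleton_append]
    congr 1
    · rw [ihc, List.map_map]
      refine List.map_congr_left fun a ha => ?_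
      rw [List.mem_range] at ha
      simp [blueHeight, ha]
    · congr 1
      · simp [blueHeight]
      · rw [ihr]
        refine List.map_congr_left fun a _ => ?_
        simp only [Function.comp, blueHeight]
        rw [if_neg (by omega), if_neg (by omega)]
        congr 1
        omega

end PlaneForest

/-! ### Admissible interleavings -/

/-- The lists of length `n` with entries at most `m`. -/
def boundedLists (n m : ℕ) : Finset (List ℕ) :=
  Finset.univ.image fun f : Fin n → Fin (m + 1) => List.ofFn fun i => (f i : ℕ)

theorem mem_boundedLists {n m : ℕ} {h : List ℕ} :
    h ∈ boundedLists n m ↔ h.length = n ∧ ∀ y ∈ h, y ≤ m := by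
  simp only [boundedLists, Finset.mem_image, Finset.mem_univ, true_and]
  constructor
  · rintro ⟨f, rfl⟩
    refine ⟨by simp, fun y hy => ?_⟩
    rw [List.mem_ofFn] at hy
    obtain ⟨i, rfl⟩ := hy
    have := (f i).2
    omega
  · rintro ⟨rfl, h2⟩
    refine ⟨fun i => ⟨h[i], by have := h2 h[i] (List.getElem_mem _); omega⟩, ?_⟩
    simp

/-- An interleaving of the points of the blue forest `G` with red points is recorded as the list
`h` of the numbers of red points to the left of the blue points. Here `ρ a` is the number of
descendants of the red point with number `a`. There is no 1324 if the interleaving is admissible. -/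
def Admissible (ρ : ℕ → ℕ) (G : PlaneForest) (h : List ℕ) : Prop :=
  h.length = G.size ∧ ∀ i j, i < j → j < G.size → h.getD i 0 ≤ h.getD j 0 ∧
    (j - G.postDesc j ≤ i → ∀ a, h.getD i 0 ≤ a → a < h.getD j 0 → a + ρ a < h.getD j 0)

namespace PlaneForest

theorem postDesc_cons (c r : PlaneForest) (i : ℕ) : (cons c r).postDesc i =
    if i < c.size then c.postDesc i else
      if i = c.size then c.size else r.postDesc (i - (c.size + 1)) := rfl

end PlaneForest

open PlaneForest

theorem getD_append_cons {h₁ h₂ : List ℕ} {x n : ℕ} (hn : h₁.length = n) (i : ℕ) :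
    (h₁ ++ x :: h₂).getD i 0 =
      if i < n then h₁.getD i 0 else if i = n then x else h₂.getD (i - (n + 1)) 0 := by
  subst hn
  split_ifs with h1 h2
  · rw [List.getD_append _ _ _ _ h1]
  · subst h2; rw [List.getD_append_right _ _ _ _ le_rfl]; simp
  · rw [List.getD_append_right _ _ _ _ (by omega),
      show i - h₁.length = (i - (h₁.length + 1)) + 1 by omega, List.getD_cons_succ]

theorem getD_mem_of_lt {h : List ℕ} {i : ℕ} (hi : i < h.length) : h.getD i 0 ∈ h := by
  rw [List.getD_eq_getElem _ _ hi]
  exact List.getElem_mem _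

/-- Vertices of different trees are never comparable, so beyond monotonicity the only new condition
concerns the new root and its descendants. -/
theorem Admissible.cons {ρ : ℕ → ℕ} {c r : PlaneForest} {h₁ h₂ : List ℕ} {x : ℕ}
    (hc : Admissible ρ c h₁) (hr : Admissible ρ r h₂)
    (h1 : ∀ y ∈ h₁, y ≤ x ∧ ∀ a, y ≤ a → a < x → a + ρ a < x) (h2 : ∀ z ∈ h₂, x ≤ z) :
    Admissible ρ (cons c r) (h₁ ++ x :: h₂) := by
  refine ⟨by simp [size_cons, hc.1, hr.1]; omega, fun i j hij hj => ?_⟩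
  rw [size_cons] at hj
  rw [getD_append_cons hc.1, getD_append_cons hc.1, postDesc_cons]
  rcases lt_trichotomy j c.size with h3 | h3 | h3
  · rw [if_pos (hij.trans h3), if_pos h3, if_pos h3]
    exact hc.2 i j hij h3
  · have h4 := h1 _ (getD_mem_of_lt (h := h₁) (i := i) (by rw [hc.1]; omega))
    rw [if_pos (by omega), if_neg (by omega), if_pos h3, if_neg (by omega), if_pos h3]
    exact ⟨h4.1, fun _ => h4.2⟩
  · rw [if_neg (show ¬ j < c.size by omega), if_neg (show ¬ j = c.size by omega),
      if_neg (show ¬ j < c.size by omega), if_neg (show ¬ j = c.size by omega)]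
    have h5 := postDesc_le r (j - (c.size + 1))
    have h6 := h2 _ (getD_mem_of_lt (h := h₂) (i := j - (c.size + 1)) (by rw [hr.1]; omega))
    rcases lt_trichotomy i c.size with h4 | h4 | h4
    · rw [if_pos h4]
      have h7 := h1 _ (getD_mem_of_lt (h := h₁) (i := i) (by rw [hc.1]; omega))
      exact ⟨h7.1.trans h6, fun h => by omega⟩
    · rw [if_neg (by omega), if_pos h4]
      exact ⟨h6, fun h => by omega⟩
    · rw [if_neg (by omega), if_neg (by omega)]
      have h8 := hr.2 (i - (c.size + 1)) (j - (c.size + 1)) (by omega) (by omega)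
      exact ⟨h8.1, fun h => h8.2 (by omega)⟩

theorem Admissible.map_add {ρ ρ' : ℕ → ℕ} {c : PlaneForest} {q : List ℕ} {s m : ℕ}
    (h : Admissible ρ c q) (hq : ∀ y ∈ q, y ≤ m) (hρ : ∀ a < m, ρ' (a + s) = ρ a) :
    Admissible ρ' c (q.map (· + s)) := by
  refine ⟨by simp [h.1], fun i j hij hj => ?_⟩
  have e : ∀ i < c.size, (q.map (· + s)).getD i 0 = q.getD i 0 + s := by
    intro i hi
    rw [← h.1] at hi
    rw [List.getD_eq_getElem _ _ (by simpa using hi), List.getD_eq_getElem _ _ hi, List.getElem_map]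
  rw [e i (by omega), e j hj]
  have h1 := h.2 i j hij hj
  have h2 := hq _ (getD_mem_of_lt (h := q) (i := j) (by rw [h.1]; omega))
  refine ⟨by omega, fun h3 a h4 h5 => ?_⟩
  have h6 := h1.2 h3 (a - s) (by omega) (by omega)
  rw [← hρ (a - s) (by omega), Nat.sub_add_cancel (by omega)] at h6
  omega

open Classical in
/-- The admissible interleavings of the blue forest `c` with the red forest `F`. -/
noncomputable def admissibles (c F : PlaneForest) : Finset (List ℕ) :=
  {h ∈ boundedLists c.size F.size | Admissible F.desc c h}

theorem mem_admissibles {c F : PlaneForest} {h : List ℕ} :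
    h ∈ admissibles c F ↔ Admissible F.desc c h ∧ ∀ y ∈ h, y ≤ F.size := by
  simp only [admissibles, Finset.mem_filter, mem_boundedLists]
  constructor
  · rintro ⟨⟨-, h1⟩, h2⟩; exact ⟨h2, h1⟩
  · rintro ⟨h1, h2⟩; exact ⟨⟨h1.1, h2⟩, h1⟩

theorem card_admissibles_pos (c F : PlaneForest) : 0 < (admissibles c F).card := by
  rw [Finset.card_pos]
  -- All blue vertices are placed to the left of all red ones.
  refine ⟨List.replicate c.size 0, ?_⟩
  rw [mem_admissibles]
  refine ⟨⟨by simp, fun i j hij hj => ?_⟩, ?_⟩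
  · have e : ∀ i < c.size, (List.replicate c.size 0).getD i 0 = 0 := by
      intro i hi
      rw [List.getD_eq_getElem _ _ (by simpa using hi), List.getElem_replicate]
    rw [e i (by omega), e j hj]
    exact ⟨le_rfl, fun _ a _ h => by omega⟩
  · intro y hy
    rw [List.mem_replicate] at hy
    omega

/-! ### Words avoiding 1324 give admissible interleavings -/

/-- For each entry less than `b` of a word, the number of the preceding entries that are at
least `b`, increased by `n`. -/
def precedingCounts (b : ℕ) : List ℕ → ℕ → List ℕ
  | [], _ => []
  | x :: w, n => if x < b then n :: precedingCounts b w n else precedingCounts b w (n + 1)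

theorem le_of_mem_precedingCounts {b : ℕ} {w : List ℕ} {n y : ℕ}
    (h : y ∈ precedingCounts b w n) : n ≤ y := by
  induction w generalizing n with
  | nil => simp [precedingCounts] at h
  | cons x w ih =>
    simp only [precedingCounts] at h
    split_ifs at h
    · rcases List.mem_cons.1 h with rfl | h
      · exact le_rfl
      · exact ih h
    · have := ih h; omega

theorem mem_precedingCounts_le {b : ℕ} {w : List ℕ} {n y : ℕ}
    (h : y ∈ precedingCounts b w n) : y ≤ n + (w.filter fun x => b ≤ x).length := by
  induction w generalizing n with
  | nil => simp [precedingCounts] at h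
  | cons x w ih =>
    simp only [precedingCounts] at h
    split_ifs at h with h1
    · rw [List.filter_cons_of_neg (by simpa using h1)]
      rcases List.mem_cons.1 h with rfl | h
      · omega
      · exact ih h
    · rw [List.filter_cons_of_pos (by simpa using h1), List.length_cons]
      have := ih h; omega

theorem length_precedingCounts (b : ℕ) (w : List ℕ) (n : ℕ) :
    (precedingCounts b w n).length = (w.filter fun x => x < b).length := by
  induction w generalizing n with
  | nil => rfl
  | cons x w ih =>
    simp only [precedingCounts]
    split_ifs with h1
    · rw [List.filter_cons_of_pos (by simpa using h1), List.length_cons, List.length_cons, ih]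
    · rw [List.filter_cons_of_neg (by simpa using h1), ih]

/-- At the first place where one word has a small entry and the other a large one, the next recorded
count is `n` in one and at least `n + 1` in the other. -/
theorem eq_of_precedingCounts_eq {b : ℕ} {w w' : List ℕ} {n : ℕ}
    (h1 : (w.filter fun x => x < b) = w'.filter fun x => x < b)
    (h2 : (w.filter fun x => b ≤ x) = w'.filter fun x => b ≤ x)
    (h3 : precedingCounts b w n = precedingCounts b w' n) : w = w' := by
  induction w generalizing w' n with
  | nil =>
    cases w' with
    | nil => rfl
    | cons x w =>
      exfalso
      by_cases h : x < b
      · rw [List.filter_cons_of_pos (by simpa using h)] at h1; simp at h1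
      · rw [List.filter_cons_of_pos (by simpa using h)] at h2; simp at h2
  | cons x w ih =>
    cases w' with
    | nil =>
      exfalso
      by_cases h : x < b
      · rw [List.filter_cons_of_pos (by simpa using h)] at h1; simp at h1
      · rw [List.filter_cons_of_pos (by simpa using h)] at h2; simp at h2
    | cons x' w' =>
      simp only [precedingCounts] at h3
      by_cases h : x < b <;> by_cases h' : x' < b
      · rw [List.filter_cons_of_pos (by simpa using h),
          List.filter_cons_of_pos (by simpa using h'), List.cons.injEq] at h1
        rw [List.filter_cons_of_neg (by simpa using h),
          List.filter_cons_of_neg (by simpa using h')] at h2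
        rw [if_pos h, if_pos h', List.cons.injEq] at h3
        rw [h1.1, ih h1.2 h2 h3.2]
      · rw [if_pos h, if_neg h'] at h3
        have := le_of_mem_precedingCounts (b := b) (w := w') (n := n + 1) (y := n)
          (by rw [← h3]; exact List.mem_cons_self)
        omega
      · rw [if_neg h, if_pos h'] at h3
        have := le_of_mem_precedingCounts (b := b) (w := w) (n := n + 1) (y := n)
          (by rw [h3]; exact List.mem_cons_self)
        omega
      · rw [List.filter_cons_of_pos (by simpa using h),
          List.filter_cons_of_pos (by simpa using h'), List.cons.injEq] at h2
        rw [List.filter_cons_of_neg (by simpa using h),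
          List.filter_cons_of_neg (by simpa using h')] at h1
        rw [if_neg h, if_neg h'] at h3
        rw [h2.1, ih h1 h2.2 h3]

theorem exists_getElem_filter {P : ℕ → Bool} {w : List ℕ} {i : ℕ} (hi : i < (w.filter P).length) :
    ∃ (p : ℕ) (hp : p < w.length), w[p] = (w.filter P)[i] ∧ P w[p] ∧ (w.take p).countP P = i := by
  induction w generalizing i with
  | nil => simp at hi
  | cons x w ih =>
    by_cases h : P x
    · cases i with
      | zero => exact ⟨0, by simp, by simp [h], by simpa using h, by simp⟩
      | succ i =>
        simp only [List.filter_cons_of_pos h, List.length_cons] at hi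
        obtain ⟨p, hp, h1, h2, h3⟩ := ih (i := i) (by omega)
        exact ⟨p + 1, by simpa using hp, by simpa [h] using h1, by simpa using h2,
          by simp [h, h3]⟩
    · simp only [List.filter_cons_of_neg h] at hi
      obtain ⟨p, hp, h1, h2, h3⟩ := ih hi
      exact ⟨p + 1, by simpa using hp, by simpa [h] using h1, by simpa using h2, by simp [h, h3]⟩

theorem precedingCounts_getD {b : ℕ} {w : List ℕ} {n p : ℕ} (hp : p < w.length) (h : w[p] < b) :
    (precedingCounts b w n).getD ((w.take p).countP fun x => x < b) 0 =
      n + (w.take p).countP fun x => b ≤ x := by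
  induction w generalizing n p with
  | nil => simp at hp
  | cons x w ih =>
    cases p with
    | zero =>
      simp only [List.getElem_cons_zero] at h
      simp [precedingCounts, h]
    | succ p =>
      simp only [List.getElem_cons_succ] at h
      simp only [List.length_cons, Nat.add_lt_add_iff_right] at hp
      simp only [precedingCounts, List.take_succ_cons, List.countP_cons]
      by_cases h1 : x < b
      · have := ih (n := n) hp h
        simp [h1, not_le.2 h1]
        simpa using this
      · have := ih (n := n + 1) hp h
        simp [h1, not_lt.1 h1]
        simp at this
        rw [this]
        omega

theorem countP_take_mono {P : ℕ → Bool} {w : List ℕ} {p q : ℕ} (h : p ≤ q) :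
    (w.take p).countP P ≤ (w.take q).countP P :=
  (List.take_sublist_take_left h).countP_le

theorem countP_take_lt {P : ℕ → Bool} {w : List ℕ} {p q : ℕ} (hp : p < w.length) (hP : P w[p])
    (h : p < q) : (w.take p).countP P < (w.take q).countP P := by
  refine lt_of_lt_of_le ?_ (countP_take_mono (p := p + 1) h)
  rw [List.take_succ_eq_append_getElem hp, List.countP_append]
  simp [hP]

/-- If admissibility fails, some red `a` lies between a blue vertex `j` and its descendant `i`,
while a descendant of `a` lies to the right of `j`. Then `i`, `a`, `j` and that descendant form a
1324. Only this inequality is needed. -/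
theorem interleavings_le_card_admissibles (T : PlaneTree) (F : PlaneForest) :
    interleavings T F ≤ (admissibles T.children F).card := by
  rw [interleavings, ← Set.ncard_coe_finset]
  refine Set.ncard_le_ncard_of_injOn (fun w => precedingCounts T.children.size w 0) ?_ ?_
    (Finset.finite_toSet _)
  · rintro w ⟨h1, h2, h3⟩
    simp only [Finset.mem_coe, mem_admissibles]
    generalize T.children = c at *
    have hl1 : (w.filter fun x => x < c.size).length = c.size := by
      rw [h1, blueSeq_eq_map]; simp
    have hl2 : (w.filter fun x => c.size ≤ x).length = F.size := by
      rw [h2, redSeq_eq_map]; simp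
    refine ⟨⟨by rw [length_precedingCounts, hl1], fun i j hij hj => ?_⟩, fun y hy => ?_⟩
    · obtain ⟨p1, hp1, v1, b1, c1⟩ := exists_getElem_filter (P := fun x => x < c.size) (w := w)
        (i := i) (by rw [hl1]; omega)
      obtain ⟨p3, hp3, v3, b3, c3⟩ := exists_getElem_filter (P := fun x => x < c.size) (w := w)
        (i := j) (by rw [hl1]; omega)
      have g1 := precedingCounts_getD (b := c.size) (n := 0) hp1 (by simpa using b1)
      have g3 := precedingCounts_getD (b := c.size) (n := 0) hp3 (by simpa using b3)
      rw [c1, Nat.zero_add] at g1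
      rw [c3, Nat.zero_add] at g3
      have h13 : p1 < p3 := by
        by_contra hn
        have := countP_take_mono (P := fun x => x < c.size) (w := w) (not_lt.1 hn)
        omega
      refine ⟨by rw [g1, g3]; exact countP_take_mono h13.le, fun hji a ha1 ha2 => ?_⟩
      by_contra hcon
      rw [not_lt] at hcon
      have hj2 : (precedingCounts c.size w 0).getD j 0 ≤ F.size := by
        have := mem_precedingCounts_le (getD_mem_of_lt (h := precedingCounts c.size w 0) (i := j)
          (by rw [length_precedingCounts, hl1]; omega))
        omega
      have ha : a < F.size := by omega
      have hda := desc_lt ha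
      -- The first red vertex to the right of `j` has number `a'`; by `hcon` it is a descendant of
      -- `a` and can play the role of the 4.
      generalize hA : (precedingCounts c.size w 0).getD j 0 = a' at *
      obtain ⟨p2, hp2, v2, b2, c2⟩ := exists_getElem_filter (P := fun x => c.size ≤ x) (w := w)
        (i := a) (by rw [hl2]; omega)
      obtain ⟨p4, hp4, v4, b4, c4⟩ := exists_getElem_filter (P := fun x => c.size ≤ x) (w := w)
        (i := a') (by rw [hl2]; omega)
      have h12 : p1 < p2 := by
        rcases lt_trichotomy p1 p2 with h | h | h
        · exact h
        · subst h; simp at b1 b2; omega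
        · have := countP_take_lt (P := fun x => c.size ≤ x) hp2 b2 h; omega
      have h23 : p2 < p3 := by
        by_contra hn
        have := countP_take_mono (P := fun x => c.size ≤ x) (w := w) (not_lt.1 hn)
        omega
      have h34 : p3 < p4 := by
        rcases lt_trichotomy p3 p4 with h | h | h
        · exact h
        · subst h; simp at b3 b4; omega
        · have := countP_take_lt (P := fun x => c.size ≤ x) hp4 b4 h; omega
      simp only [h1, h2, blueSeq_eq_map, redSeq_eq_map, List.getElem_map, List.getElem_range]
        at v1 v2 v3 v4
      refine h3 ⟨⟨p1, hp1⟩, ⟨p2, hp2⟩, ⟨p3, hp3⟩, ⟨p4, hp4⟩, h12, h23, h34, ?_⟩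
      simp only [List.get_eq_getElem, v1, v2, v3, v4]
      have r1 := ((blueHeight_lt_iff hij hj).1).2 hji
      have r2 := ((redHeight_lt_iff (F := F) (a := a) (b := a') ha2 (by omega)).1).2 hcon
      have r3 := blueHeight_lt hj
      omega
    · have := mem_precedingCounts_le hy
      omega
  · rintro w ⟨h1, h2, -⟩ w' ⟨h1', h2', -⟩ h
    exact eq_of_precedingCounts_eq (h1.trans h1'.symm) (h2.trans h2'.symm) h

open PlaneForest

/-! ### Interleavings that refine a pre-interleaving -/

open Classical in
/-- The interleavings of the blue forest `G` with the red tree `R` in which the numbers of non-root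
red vertices to the left of the roots of `G` are `ps`, and the other vertices of each
component of `G` are interleaved with the red fringe of its root. There are `prev` non-root red
vertices to the left of the previous blue root. -/
noncomputable def refinements (R : PlaneTree) : ℕ → PlaneForest → List ℕ → Finset (List ℕ)
  | _, nil, [] => {[]}
  | prev, cons c r, p :: ps =>
      (admissibles c (redFringe R p (p - prev)) ×ˢ refinements R p r ps).image fun x =>
        x.1.map (· + (p + 1 - (redFringe R p (p - prev)).size)) ++ (p + 1) :: x.2
  | _, _, _ => ∅

/-- The product, over the components of `G`, of the numbers of their admissible interleavings. -/
noncomputable def refinementCount (R : PlaneTree) : ℕ → PlaneForest → List ℕ → ℕ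
  | _, nil, [] => 1
  | prev, cons c r, p :: ps =>
      (admissibles c (redFringe R p (p - prev))).card * refinementCount R p r ps
  | _, _, _ => 0

theorem card_refinements (R : PlaneTree) (prev : ℕ) (G : PlaneForest) (ps : List ℕ) :
    (refinements R prev G ps).card = refinementCount R prev G ps := by
  induction G generalizing prev ps with
  | nil => cases ps <;> simp [refinements, refinementCount]
  | cons c r _ ih =>
    cases ps with
    | nil => simp [refinements, refinementCount]
    | cons p ps =>
      rw [refinements, refinementCount, Finset.card_image_of_injOn, Finset.card_product, ih]
      rintro ⟨q, h⟩ hx ⟨q', h'⟩ hx' e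
      simp only [Finset.coe_product, Set.mem_prod, Finset.mem_coe, mem_admissibles] at hx hx'
      have hl := hx.1.1.1.trans hx'.1.1.1.symm
      have := List.append_inj e (by simp [hl])
      exact Prod.ext ((List.map_injective_iff.2 (add_left_injective _)) this.1)
        (List.cons.inj this.2).2

/-- The entries at the blue roots recover the pre-interleaving, so different pre-interleavings have
disjoint sets of refinements. -/
theorem eq_of_mem_refinements {R : PlaneTree} {prev : ℕ} {G : PlaneForest} {ps ps' h : List ℕ}
    (h1 : h ∈ refinements R prev G ps) (h2 : h ∈ refinements R prev G ps') : ps = ps' := by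
  induction G generalizing prev ps ps' h with
  | nil => cases ps <;> cases ps' <;> simp [refinements] at h1 h2 ⊢
  | cons c r _ ih =>
    cases ps with
    | nil => simp [refinements] at h1
    | cons p ps =>
      cases ps' with
      | nil => simp [refinements] at h2
      | cons p' ps' =>
        simp only [refinements, Finset.mem_image, Finset.mem_product, mem_admissibles,
          Prod.exists] at h1 h2
        obtain ⟨q, h, ⟨hq, hh⟩, rfl⟩ := h1
        obtain ⟨q', h', ⟨hq', hh'⟩, e⟩ := h2
        have := List.append_inj e (by simp [hq.1.1, hq'.1.1])
        obtain ⟨e1, rfl⟩ := List.cons.inj this.2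
        obtain rfl : p' = p := by omega
        rw [ih hh hh']

/-- The red tree `R` as a plane forest. -/
def PlaneTree.toForest (R : PlaneTree) : PlaneForest := cons R.children nil

theorem PlaneTree.size_toForest (R : PlaneTree) : R.toForest.size = R.size := rfl

theorem PlaneTree.desc_toForest_succ {R : PlaneTree} {a : ℕ} (h : a < R.children.size) :
    R.toForest.desc (a + 1) = R.children.desc a := by
  simp [PlaneTree.toForest, desc, h]

/-- The fringe is complete, so passing to it loses no descendants. The shift includes 1 for the root
of `R`. -/
theorem desc_redFringe {R : PlaneTree} {p : ℕ} (hp : p ≤ R.children.size) (j : ℕ) {a : ℕ}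
    (ha : a < (redFringe R p j).size) :
    R.toForest.desc (a + (p + 1 - (redFringe R p j).size)) = (redFringe R p j).desc a := by
  obtain ⟨h1, B, h2⟩ := (endsWith_redFringe hp j).1
  have h3 := desc_drop R.children (p - (redFringe R p j).size) a
  rw [h2, desc_append, if_pos ha] at h3
  rw [h3, show a + (p + 1 - (redFringe R p j).size) = (p - (redFringe R p j).size + a) + 1 by omega,
    PlaneTree.desc_toForest_succ (by omega)]

/-- Inside a blue subtree admissibility is inherited from the fringe. Red points between a vertex of
the subtree and its root belong to the fringe, so their descendants end before the root. The fringe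
fits in the gap, so nothing moves to the left of the previous blue root. -/
theorem refinements_spec {R : PlaneTree} {prev : ℕ} {G : PlaneForest} {ps h : List ℕ}
    (hps : (prev :: ps).Pairwise (· ≤ ·)) (hR : ∀ p ∈ ps, p ≤ R.children.size)
    (hh : h ∈ refinements R prev G ps) :
    Admissible R.toForest.desc G h ∧ ∀ y ∈ h, prev + 1 ≤ y ∧ y ≤ R.children.size + 1 := by
  induction G generalizing prev ps h with
  | nil =>
    cases ps with
    | nil =>
      obtain rfl : h = [] := by simpa [refinements] using hh
      exact ⟨⟨rfl, fun i j _ hj => by simp at hj⟩, by simp⟩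
    | cons p ps => simp [refinements] at hh
  | cons c r _ ih =>
    cases ps with
    | nil => simp [refinements] at hh
    | cons p ps =>
      simp only [refinements, Finset.mem_image, Finset.mem_product, mem_admissibles,
          Prod.exists] at hh
      obtain ⟨q, h, ⟨⟨hq1, hq2⟩, hh⟩, rfl⟩ := hh
      rw [List.pairwise_cons] at hps
      have hp := hR p List.mem_cons_self
      have hprev := hps.1 p List.mem_cons_self
      obtain ⟨i1, i2⟩ := ih hps.2 (fun p hp => hR p (List.mem_cons_of_mem _ hp)) hh
      obtain ⟨f1, f2⟩ := endsWith_redFringe hp (p - prev)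
      have f3 := f1.1
      have f4 := fun a => @desc_redFringe R p hp (p - prev) a
      generalize redFringe R p (p - prev) = F at *
      have f5 : F.size ≤ p - prev := by omega
      refine ⟨(hq1.map_add hq2 f4).cons i1 ?_ ?_, ?_⟩
      · intro y hy
        rw [List.mem_map] at hy
        obtain ⟨y, hy, rfl⟩ := hy
        have := hq2 y hy
        refine ⟨by omega, fun a ha1 ha2 => ?_⟩
        have ha : a - (p + 1 - F.size) < F.size := by omega
        have e := f4 (a - (p + 1 - F.size)) ha
        rw [Nat.sub_add_cancel (by omega)] at e
        have := desc_lt ha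
        omega
      · intro z hz
        exact (i2 z hz).1
      · intro y hy
        rw [List.mem_append, List.mem_cons, List.mem_map] at hy
        rcases hy with ⟨y, hy, rfl⟩ | rfl | hy
        · have := hq2 y hy; omega
        · omega
        · have := i2 y hy; omega

open Classical in
/-- The interleavings of the blue tree `B` and the red tree `R` in which the first vertex is the
red root and the last one is the blue root, and which do not create a 1324. -/
noncomputable def treeInterleavings (R B : PlaneTree) : Finset (List ℕ) :=
  {h ∈ boundedLists B.size R.size | Admissible R.toForest.desc B.toForest h ∧ (∀ y ∈ h, 1 ≤ y) ∧
    h.getD B.children.size 0 = R.size}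

theorem sum_refinementCount_le (R B : PlaneTree) (S : Finset (List ℕ))
    (hS : ∀ ps ∈ S, ps.Pairwise (· ≤ ·) ∧ ∀ p ∈ ps, p ≤ R.children.size) :
    ∑ ps ∈ S, refinementCount R 0 B.children ps ≤ (treeInterleavings R B).card := by
  classical
  have hspec : ∀ ps ∈ S, ∀ h ∈ refinements R 0 B.children ps,
      Admissible R.toForest.desc B.children h ∧ ∀ y ∈ h, 0 + 1 ≤ y ∧ y ≤ R.children.size + 1 := by
    intro ps hps h hh
    refine refinements_spec ?_ (hS ps hps).2 hh
    rw [List.pairwise_cons]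
    exact ⟨fun _ _ => Nat.zero_le _, (hS ps hps).1⟩
  simp_rw [← card_refinements]
  rw [← Finset.card_biUnion]
  -- The root of `B` is placed to the right of all red points, where no red descendant can follow
  -- it.
  · refine Finset.card_le_card_of_injOn (fun h => h ++ [R.size]) ?_ ?_
    · intro h hh
      simp only [Finset.coe_biUnion, Set.mem_iUnion, Finset.mem_coe] at hh
      obtain ⟨ps, hps, hh⟩ := hh
      obtain ⟨h1, h2⟩ := hspec ps hps h hh
      have h3 : Admissible R.toForest.desc B.toForest (h ++ [R.size]) := by
        refine h1.cons ⟨rfl, fun i j _ hj => by simp at hj⟩ (fun y hy => ⟨(h2 y hy).2, ?_⟩) (by simp)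
        intro a _ ha
        exact desc_lt (F := R.toForest) ha
      simp only [treeInterleavings, Finset.coe_filter, Set.mem_ofPred_eq, mem_boundedLists]
      refine ⟨⟨h3.1, ?_⟩, h3, ?_, ?_⟩
      · intro y hy
        rw [List.mem_append, List.mem_singleton] at hy
        rcases hy with hy | rfl
        · exact (h2 y hy).2
        · exact le_rfl
      · intro y hy
        rw [List.mem_append, List.mem_singleton] at hy
        rcases hy with hy | rfl
        · exact (h2 y hy).1
        · rw [PlaneTree.size]; omega
      · rw [getD_append_cons h1.1, if_neg (lt_irrefl _), if_pos rfl]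
    · intro h _ h' _ e
      exact List.append_cancel_right e
  · intro ps _ ps' _ hne
    rw [Function.onFun, Finset.disjoint_left]
    intro h h1 h2
    exact hne (eq_of_mem_refinements h1 h2)

theorem refinementCount_ofFn (R : PlaneTree) (G : PlaneForest) (d : ℕ) (hd : G.len = d) (prev : ℕ)
    (p : Fin d → ℕ) (gap : Fin d → ℕ)
    (hgap : ∀ i : Fin d, gap i = p i - if h : 0 < (i : ℕ) then p ⟨(i : ℕ) - 1, by omega⟩ else prev) :
    refinementCount R prev G (List.ofFn p) =
      ∏ i : Fin d, (admissibles ((G.trees.getD i ⟨nil⟩).children)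
        (redFringe R (p i) (gap i))).card := by
  induction G generalizing d prev with
  | nil =>
    obtain rfl : d = 0 := hd.symm
    simp [refinementCount]
  | cons c r _ ih =>
    rw [len] at hd
    subst hd
    rw [List.ofFn_succ, refinementCount, Fin.prod_univ_succ,
      ih r.len rfl (p 0) (fun i => p i.succ) (fun i => gap i.succ)]
    · congr 1
      have := hgap 0
      simp only [Fin.val_zero, lt_irrefl] at this
      rw [this]
      simp [trees]
    · intro i
      rw [hgap i.succ, dif_pos (by simp)]
      congr 1
      split_ifs with h
      · congr 1
        apply Fin.ext
        simp
        omega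
      · congr 1
        apply Fin.ext
        simp
        omega

/-- The bound for one pair of trees to which concavity of the logarithm is applied. -/
theorem sum_prod_le_card_treeInterleavings {k d : ℕ} (R B : PlaneTree) (hR : R.size = k)
    (hB : B.rootDegree = d) [Fintype (PreInterleaving k d)] :
    ∑ P : PreInterleaving k d, ∏ i : Fin d, (admissibles (B.children.trees.getD i ⟨nil⟩).children
        (redFringe R (P i) (gapSize P i))).card ≤ (treeInterleavings R B).card := by
  classical
  have hinj : Function.Injective
      (fun P : PreInterleaving k d => List.ofFn fun i => (P i : ℕ)) := by
    intro P P' h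
    have := List.ofFn_injective h
    apply OrderHom.ext
    funext i
    exact Fin.ext (congrFun this i)
  have h := sum_refinementCount_le R B (Finset.univ.map ⟨_, hinj⟩) ?_
  · rw [Finset.sum_map] at h
    refine le_trans (le_of_eq (Finset.sum_congr rfl fun P _ => ?_)) h
    refine (refinementCount_ofFn R B.children d ?_ 0 (fun i => (P i : ℕ)) (gapSize P) ?_).symm
    · rw [← len_eq_length_trees]; exact hB
    · intro i
      unfold gapSize
      split_ifs <;> simp
  · intro ps hps
    simp only [Finset.mem_map, Finset.mem_univ, true_and, Function.Embedding.coeFn_mk] at hps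
    obtain ⟨P, rfl⟩ := hps
    constructor
    · rw [List.pairwise_ofFn]
      intro i j hij
      exact P.monotone hij.le
    · intro p hp
      rw [List.mem_ofFn] at hp
      obtain ⟨i, rfl⟩ := hp
      have := (P i).2
      rw [PlaneTree.size] at hR
      omega

/-! ### Hasse graphs of forests -/

/-- `q` covers `p` with respect to `r`. -/
def CoversRel {V : Type*} (r : V → V → Prop) (p q : V) : Prop := r p q ∧ ¬ ∃ m, r p m ∧ r m q

/-- If the lower sets of the elements of a convex set with a least element are chains, the Hasse
graph of this set is a tree. -/
theorem isTree_induce_of_chain {V : Type*} [Finite V] {G : SimpleGraph V} {r : V → V → Prop}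
    (htrans : ∀ {a b c}, r a b → r b c → r a c) (hirr : ∀ a, ¬ r a a)
    (hadj : ∀ p q, G.Adj p q ↔ CoversRel r p q ∨ CoversRel r q p)
    {S : Finset V} (hconv : ∀ p ∈ S, ∀ q ∈ S, ∀ m, r p m → r m q → m ∈ S)
    (hchain : ∀ a ∈ S, ∀ b ∈ S, ∀ c ∈ S, r a c → r b c → a = b ∨ r a b ∨ r b a)
    {root : V} (hroot : root ∈ S) (hleast : ∀ p ∈ S, p ≠ root → r root p) :
    (G.induce (S : Set V)).IsTree := by
  classical
  have : IsTrans V r := ⟨fun _ _ _ => htrans⟩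
  have : Std.Irrefl r := ⟨hirr⟩
  have : IsTrans V (Function.swap r) := ⟨fun _ _ _ h1 h2 => htrans h2 h1⟩
  have : Std.Irrefl (Function.swap r) := ⟨hirr⟩
  have hwf : WellFounded r := Finite.wellFounded_of_trans_of_irrefl r
  have hwf' : WellFounded (Function.swap r) := Finite.wellFounded_of_trans_of_irrefl _
  -- The parent of `v` is a maximal element of `S` below `v`; convexity of `S` makes it a cover in
  -- the whole order, and the chain condition makes it unique.
  have hpar : ∀ v ∈ S, v ≠ root → ∃ u ∈ S, CoversRel r u v := by
    intro v hv hne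
    obtain ⟨u, ⟨hu, huv⟩, hmax⟩ := hwf'.has_min {u | u ∈ S ∧ r u v} ⟨root, hroot, hleast v hv hne⟩
    refine ⟨u, hu, huv, ?_⟩
    rintro ⟨m, h1, h2⟩
    exact hmax m ⟨hconv u hu v hv m h1 h2, h2⟩ h1
  have huniq : ∀ u ∈ S, ∀ u' ∈ S, ∀ v ∈ S, CoversRel r u v → CoversRel r u' v → u = u' := by
    intro u hu u' hu' v hv h h'
    rcases hchain u hu u' hu' v hv h.1 h'.1 with h1 | h1 | h1
    · exact h1
    · exact absurd ⟨u', h1, h'.1⟩ h.2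
    · exact absurd ⟨u, h1, h.1⟩ h'.2
  have hrootmin : ∀ u ∈ S, ¬ r u root := by
    intro u hu h
    by_cases hne : u = root
    · subst hne; exact hirr _ h
    · exact hirr _ (htrans h (hleast u hu hne))
  choose! par hparS hparC using hpar
  rw [SimpleGraph.isTree_iff_connected_and_card]
  constructor
  · have key : ∀ v, ∀ hv : v ∈ S,
        (G.induce (S : Set V)).Reachable ⟨v, hv⟩ ⟨root, hroot⟩ := by
      intro v
      induction v using hwf.induction with
      | _ v ih =>
        intro hv
        by_cases hne : v = root
        · subst hne; exact SimpleGraph.Reachable.refl _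
        · have h1 := hparC v hv hne
          refine SimpleGraph.Reachable.trans (SimpleGraph.Adj.reachable ?_)
            (ih (par v) h1.1 (hparS v hv hne))
          rw [SimpleGraph.induce_adj, hadj]
          exact Or.inr h1
    have : Nonempty (S : Set V) := ⟨⟨root, hroot⟩⟩
    exact ⟨fun u v => (key u.1 u.2).trans (key v.1 v.2).symm⟩
  -- Sending a vertex to the edge to its parent is a bijection, so there is one edge fewer than
  -- there are vertices.
  · have h1 : Nat.card (G.induce (S : Set V)).edgeSet = Nat.card {v : V // v ∈ S ∧ v ≠ root} := by
      symm
      refine Nat.card_eq_of_bijective (fun v => ⟨s(⟨v.1, v.2.1⟩, ⟨par v.1, hparS v.1 v.2.1 v.2.2⟩), ?_⟩)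
        ⟨?_, ?_⟩
      · rw [SimpleGraph.mem_edgeSet, SimpleGraph.induce_adj, hadj]
        exact Or.inr (hparC v.1 v.2.1 v.2.2)
      · rintro ⟨v, hv, hne⟩ ⟨w, hw, hne'⟩ h
        simp only [Subtype.mk.injEq, Sym2.eq_iff] at h
        rcases h with ⟨h, -⟩ | ⟨h1, h2⟩
        · exact Subtype.ext h
        · exfalso
          have a1 := (hparC v hv hne).1
          have a2 := (hparC w hw hne').1
          rw [← h1] at a2
          rw [h2] at a1
          exact hirr _ (htrans a1 a2)
      · rintro ⟨e, he⟩
        induction e with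
        | _ u v =>
          rw [SimpleGraph.mem_edgeSet, SimpleGraph.induce_adj, hadj] at he
          rcases he with h | h
          · have hne : (v : V) ≠ root := fun hv => hrootmin u u.2 (hv ▸ h.1)
            refine ⟨⟨v, v.2, hne⟩, Subtype.ext ?_⟩
            simp only
            rw [Sym2.eq_swap]
            congr 2
            exact huniq _ (hparS v v.2 hne) _ u.2 _ v.2 (hparC v v.2 hne) h
          · have hne : (u : V) ≠ root := fun hv => hrootmin v v.2 (hv ▸ h.1)
            refine ⟨⟨u, u.2, hne⟩, Subtype.ext ?_⟩
            simp only
            congr 2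
            exact huniq _ (hparS u u.2 hne) _ v.2 _ u.2 (hparC u u.2 hne) h
    rw [h1]
    have h2 : Nat.card {v : V // v ∈ S ∧ v ≠ root} = (S.erase root).card := by
      rw [← Nat.card_eq_finsetCard]
      refine Nat.card_congr (Equiv.subtypeEquivRight fun v => ?_)
      simp [and_comm]
    have h3 : Nat.card (S : Set V) = S.card := by simp
    rw [h2, h3, Finset.card_erase_add_one hroot]

theorem exists_rank {X : Type*} [Fintype X] {n : ℕ} (hn : Fintype.card X = n) {κ : X → ℕ}
    (hκ : Function.Injective κ) : ∃ e : X ≃ Fin n, ∀ p q, e p < e q ↔ κ p < κ q := by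
  let _ : LinearOrder X := LinearOrder.lift' κ hκ
  refine ⟨(Fintype.orderIsoFinOfCardEq X hn).toEquiv.symm, fun p q => ?_⟩
  exact (Fintype.orderIsoFinOfCardEq X hn).symm.lt_iff_lt

/-! ### Staircases of red and blue trees -/

/-- The data of a staircase: the heights `rh c a` of the point with number `a` in the red cell `c`,
the heights `bh c i` of the point with number `i` in the blue cell `c`, the number `hx c i` of red
points of the same column to the left of the point with number `i` of the blue cell `c`, and the
number `hy c j` of red points of the same row below the point of height `j` of the
blue cell `c`. -/
structure Staircase where
  rh : ℕ → ℕ → ℕ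
  bh : ℕ → ℕ → ℕ
  hx : ℕ → ℕ → ℕ
  hy : ℕ → ℕ → ℕ

/-- The points of a staircase. -/
abbrev StairPoint (t k l : ℕ) : Type := (Fin (t + 1) × Fin k) ⊕ (Fin t × Fin l)

namespace Staircase

structure Valid (D : Staircase) (t k l d : ℕ) : Prop where
  k_pos : 0 < k
  l_pos : 0 < l
  rh_lt : ∀ c ≤ t, ∀ a < k, D.rh c a < k
  rh_ne : ∀ c ≤ t, ∀ b < k, ∀ a < b, D.rh c a ≠ D.rh c b
  rh_zero : ∀ c ≤ t, D.rh c 0 = 0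
  rh_213 : ∀ c ≤ t, ∀ m < k, ∀ b < m, ∀ a < b, D.rh c b < D.rh c a → ¬ D.rh c a < D.rh c m
  bh_lt : ∀ c < t, ∀ i < l, D.bh c i < l
  bh_ne : ∀ c < t, ∀ j < l, ∀ i < j, D.bh c i ≠ D.bh c j
  bh_last : ∀ c < t, D.bh c (l - 1) = l - 1
  bh_132 : ∀ c < t, ∀ m < l, ∀ j < m, ∀ i < j, D.bh c i < D.bh c m → ¬ D.bh c m < D.bh c j
  bh_degree : ∀ c < t, {i ∈ Finset.range (l - 1) |
    ∀ j < l - 1, i < j → D.bh c j < D.bh c i}.card = d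
  hx_mono : ∀ c < t, ∀ j < l, ∀ i < j, D.hx c i ≤ D.hx c j
  hx_pos : ∀ c < t, ∀ i < l, 0 < D.hx c i
  hx_le : ∀ c < t, ∀ i < l, D.hx c i ≤ k
  hx_last : ∀ c < t, D.hx c (l - 1) = k
  hx_avoid : ∀ c < t, ∀ j < l, ∀ i < j, ∀ b < k, ∀ a < b, D.bh c i < D.bh c j →
    D.rh c a < D.rh c b → D.hx c i ≤ a → a < D.hx c j → ¬ D.hx c j ≤ b
  hy_mono : ∀ c < t, ∀ j < l, ∀ i < j, D.hy c i ≤ D.hy c j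
  hy_pos : ∀ c < t, ∀ i < l, 0 < D.hy c i
  hy_le : ∀ c < t, ∀ i < l, D.hy c i ≤ k
  hy_last : ∀ c < t, D.hy c (l - 1) = k
  hy_avoid : ∀ c < t, ∀ j < l, ∀ i < j, ∀ b < k, ∀ a < b, D.bh c i < D.bh c j →
    D.rh (c + 1) a < D.rh (c + 1) b → D.hy c (D.bh c i) ≤ D.rh (c + 1) a →
    D.rh (c + 1) a < D.hy c (D.bh c j) → ¬ D.hy c (D.bh c j) ≤ D.rh (c + 1) b

variable {t k l d : ℕ}

/-- The horizontal positions of the points of a staircase are in the order of these keys. -/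
def keyX (D : Staircase) : StairPoint t k l → ℕ
  -- The offset `l` puts red point `a` after every blue point with exactly `a` red points to its
  -- left, since blue offsets are less than `l`.
  | .inl (c, a) => c * ((k + 1) * (l + 1)) + (a * (l + 1) + l)
  | .inr (c, i) => c * ((k + 1) * (l + 1)) + (D.hx c i * (l + 1) + i)

/-- The vertical positions of the points of a staircase are in the order of these keys. -/
def keyY (D : Staircase) : StairPoint t k l → ℕ
  | .inl (c, a) => (t - c) * ((k + 1) * (l + 1)) + (D.rh c a * (l + 1) + l)
  -- Blue cell `c` shares its row with red cell `c + 1`, and rows go downwards.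
  | .inr (c, i) => (t - (c + 1)) * ((k + 1) * (l + 1)) + (D.hy c (D.bh c i) * (l + 1) + D.bh c i)

theorem mul_add_lt_mul_add_iff {W u v x y : ℕ} (hx : x < W) (hy : y < W) :
    u * W + x < v * W + y ↔ u < v ∨ u = v ∧ x < y := by
  constructor
  · intro h
    rcases lt_trichotomy u v with h1 | h1 | h1
    · exact Or.inl h1
    · subst h1; right; omega
    · exfalso
      have : (v + 1) * W ≤ u * W := Nat.mul_le_mul_right _ h1
      rw [Nat.add_mul] at this
      omega
  · rintro (h | ⟨rfl, h⟩)
    · have : (u + 1) * W ≤ v * W := Nat.mul_le_mul_right _ h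
      rw [Nat.add_mul] at this
      omega
    · omega

theorem mul_add_lt_mul {k W a x : ℕ} (ha : a ≤ k) (hx : x < W) : a * W + x < (k + 1) * W := by
  have : a * W ≤ k * W := Nat.mul_le_mul_right _ ha
  rw [Nat.add_mul]
  omega

variable {D : Staircase}

theorem Valid.keyX_rr (hD : D.Valid t k l d) (c c' : Fin (t + 1)) (a a' : Fin k) :
    D.keyX (.inl (c, a) : StairPoint t k l) < D.keyX (.inl (c', a') : StairPoint t k l) ↔
      (c : ℕ) < c' ∨ (c : ℕ) = c' ∧ (a : ℕ) < a' := by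
  have h := hD.l_pos
  simp only [keyX]
  rw [mul_add_lt_mul_add_iff (mul_add_lt_mul a.2.le (by omega)) (mul_add_lt_mul a'.2.le (by omega)),
    mul_add_lt_mul_add_iff (by omega) (by omega)]
  omega

theorem Valid.keyX_rb (hD : D.Valid t k l d) (c : Fin (t + 1)) (c' : Fin t) (a : Fin k)
    (i : Fin l) :
    D.keyX (.inl (c, a) : StairPoint t k l) < D.keyX (.inr (c', i) : StairPoint t k l) ↔
      (c : ℕ) < c' ∨ (c : ℕ) = c' ∧ (a : ℕ) < D.hx c' i := by
  simp only [keyX]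
  rw [mul_add_lt_mul_add_iff (mul_add_lt_mul a.2.le (by omega))
    (mul_add_lt_mul (hD.hx_le c' c'.2 i i.2) (by omega)),
    mul_add_lt_mul_add_iff (by omega) (by omega)]
  omega

theorem Valid.keyX_br (hD : D.Valid t k l d) (c : Fin t) (c' : Fin (t + 1)) (i : Fin l)
    (a : Fin k) :
    D.keyX (.inr (c, i) : StairPoint t k l) < D.keyX (.inl (c', a) : StairPoint t k l) ↔
      (c : ℕ) < c' ∨ (c : ℕ) = c' ∧ D.hx c i ≤ (a : ℕ) := by
  simp only [keyX]
  rw [mul_add_lt_mul_add_iff (mul_add_lt_mul (hD.hx_le c c.2 i i.2) (by omega))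
    (mul_add_lt_mul a.2.le (by omega)), mul_add_lt_mul_add_iff (by omega) (by omega)]
  omega

theorem Valid.keyX_bb (hD : D.Valid t k l d) (c c' : Fin t) (i i' : Fin l) :
    D.keyX (.inr (c, i) : StairPoint t k l) < D.keyX (.inr (c', i') : StairPoint t k l) ↔
      (c : ℕ) < c' ∨ (c : ℕ) = c' ∧ (i : ℕ) < i' := by
  simp only [keyX]
  rw [mul_add_lt_mul_add_iff (mul_add_lt_mul (hD.hx_le c c.2 i i.2) (by omega))
    (mul_add_lt_mul (hD.hx_le c' c'.2 i' i'.2) (by omega)),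
    mul_add_lt_mul_add_iff (by omega) (by omega)]
  refine or_congr_right (and_congr_right fun hc => ?_)
  rw [← hc]
  rcases lt_trichotomy (i : ℕ) i' with h | h | h
  · have := hD.hx_mono c c.2 i' i'.2 i h; omega
  · rw [h]; omega
  · have := hD.hx_mono c c.2 i i.2 i' h; omega

theorem Valid.keyY_rr (hD : D.Valid t k l d) (c c' : Fin (t + 1)) (a a' : Fin k) :
    D.keyY (.inl (c, a) : StairPoint t k l) < D.keyY (.inl (c', a') : StairPoint t k l) ↔
      (c' : ℕ) < c ∨ (c' : ℕ) = c ∧ D.rh c a < D.rh c' a' := by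
  have h := hD.l_pos
  simp only [keyY]
  rw [mul_add_lt_mul_add_iff (mul_add_lt_mul (hD.rh_lt c (by omega) a a.2).le (by omega))
    (mul_add_lt_mul (hD.rh_lt c' (by omega) a' a'.2).le (by omega)),
    mul_add_lt_mul_add_iff (by omega) (by omega)]
  omega

theorem Valid.keyY_rb (hD : D.Valid t k l d) (c : Fin (t + 1)) (c' : Fin t) (a : Fin k)
    (i : Fin l) :
    D.keyY (.inl (c, a) : StairPoint t k l) < D.keyY (.inr (c', i) : StairPoint t k l) ↔
      (c' : ℕ) + 1 < c ∨ (c' : ℕ) + 1 = c ∧ D.rh c a < D.hy c' (D.bh c' i) := by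
  have h := hD.bh_lt c' c'.2 i i.2
  simp only [keyY]
  rw [mul_add_lt_mul_add_iff (mul_add_lt_mul (hD.rh_lt c (by omega) a a.2).le (by omega))
    (mul_add_lt_mul (hD.hy_le c' c'.2 _ h) (by omega)),
    mul_add_lt_mul_add_iff (by omega) (by omega)]
  omega

theorem Valid.keyY_br (hD : D.Valid t k l d) (c : Fin t) (c' : Fin (t + 1)) (i : Fin l)
    (a : Fin k) :
    D.keyY (.inr (c, i) : StairPoint t k l) < D.keyY (.inl (c', a) : StairPoint t k l) ↔
      (c' : ℕ) < c + 1 ∨ (c' : ℕ) = c + 1 ∧ D.hy c (D.bh c i) ≤ D.rh c' a := by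
  have h := hD.bh_lt c c.2 i i.2
  simp only [keyY]
  rw [mul_add_lt_mul_add_iff (mul_add_lt_mul (hD.hy_le c c.2 _ h) (by omega))
    (mul_add_lt_mul (hD.rh_lt c' (by omega) a a.2).le (by omega)),
    mul_add_lt_mul_add_iff (by omega) (by omega)]
  omega

theorem Valid.keyY_bb (hD : D.Valid t k l d) (c c' : Fin t) (i i' : Fin l) :
    D.keyY (.inr (c, i) : StairPoint t k l) < D.keyY (.inr (c', i') : StairPoint t k l) ↔
      (c' : ℕ) < c ∨ (c' : ℕ) = c ∧ D.bh c i < D.bh c' i' := by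
  have h := hD.bh_lt c c.2 i i.2
  have h' := hD.bh_lt c' c'.2 i' i'.2
  simp only [keyY]
  rw [mul_add_lt_mul_add_iff (mul_add_lt_mul (hD.hy_le c c.2 _ h) (by omega))
    (mul_add_lt_mul (hD.hy_le c' c'.2 _ h') (by omega)),
    mul_add_lt_mul_add_iff (by omega) (by omega),
    show t - ((c : ℕ) + 1) < t - ((c' : ℕ) + 1) ↔ (c' : ℕ) < c by omega,
    show t - ((c : ℕ) + 1) = t - ((c' : ℕ) + 1) ↔ (c' : ℕ) = c by omega]
  refine or_congr_right (and_congr_right fun hc => ?_)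
  rw [hc] at h' ⊢
  rcases lt_trichotomy (D.bh c i) (D.bh c i') with h1 | h1 | h1
  · have := hD.hy_mono c c.2 _ h' _ h1; omega
  · rw [h1]; omega
  · have := hD.hy_mono c c.2 _ h _ h1; omega

theorem Valid.keyX_injective (hD : D.Valid t k l d) :
    Function.Injective (D.keyX : StairPoint t k l → ℕ) := by
  intro p q h
  have h1 := h.not_lt
  have h2 := h.not_gt
  rcases p with ⟨c, a⟩ | ⟨c, a⟩ <;> rcases q with ⟨c', a'⟩ | ⟨c', a'⟩ <;>
    simp only [hD.keyX_rr, hD.keyX_rb, hD.keyX_br, hD.keyX_bb] at h1 h2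
  · congr 2 <;> apply Fin.ext <;> omega
  · omega
  · omega
  · congr 2 <;> apply Fin.ext <;> omega

theorem Valid.keyY_injective (hD : D.Valid t k l d) :
    Function.Injective (D.keyY : StairPoint t k l → ℕ) := by
  intro p q h
  have h1 := h.not_lt
  have h2 := h.not_gt
  rcases p with ⟨c, a⟩ | ⟨c, a⟩ <;> rcases q with ⟨c', a'⟩ | ⟨c', a'⟩ <;>
    simp only [hD.keyY_rr, hD.keyY_rb, hD.keyY_br, hD.keyY_bb] at h1 h2
  · obtain rfl : c = c' := Fin.ext (by omega)
    congr 2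
    apply Fin.ext
    rcases lt_trichotomy (a : ℕ) a' with h3 | h3 | h3
    · have := hD.rh_ne c (by omega) a' a'.2 a h3; omega
    · exact h3
    · have := hD.rh_ne c (by omega) a a.2 a' h3; omega
  · omega
  · omega
  · obtain rfl : c = c' := Fin.ext (by omega)
    congr 2
    apply Fin.ext
    rcases lt_trichotomy (a : ℕ) a' with h3 | h3 | h3
    · have := hD.bh_ne c c.2 a' a'.2 a h3; omega
    · exact h3
    · have := hD.bh_ne c c.2 a a.2 a' h3; omega

/-- The positions of the cells exclude most colourings. What remains has 2, 3, 4 forming a 213 in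
one red tree, or 1, 2, 3 forming a 132 in one blue tree, or two blue and two red points in adjacent
cells; the last is excluded by `hx_avoid` in a column and by `hy_avoid` in a row. -/
theorem Valid.not_1324 (hD : D.Valid t k l d) (p₁ p₂ p₃ p₄ : StairPoint t k l)
    (x12 : D.keyX p₁ < D.keyX p₂) (x23 : D.keyX p₂ < D.keyX p₃) (x34 : D.keyX p₃ < D.keyX p₄)
    (y13 : D.keyY p₁ < D.keyY p₃) (y32 : D.keyY p₃ < D.keyY p₂) (y24 : D.keyY p₂ < D.keyY p₄) :
    False := by
  have x13 := x12.trans x23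
  have x24 := x23.trans x34
  have y12 := y13.trans y32
  have y34 := y32.trans y24
  rcases p₁ with ⟨c₁, a₁⟩ | ⟨c₁, a₁⟩ <;> rcases p₂ with ⟨c₂, a₂⟩ | ⟨c₂, a₂⟩ <;>
    rcases p₃ with ⟨c₃, a₃⟩ | ⟨c₃, a₃⟩ <;> rcases p₄ with ⟨c₄, a₄⟩ | ⟨c₄, a₄⟩ <;>
    simp only [hD.keyX_rr, hD.keyX_rb, hD.keyX_br, hD.keyX_bb, hD.keyY_rr, hD.keyY_rb, hD.keyY_br,
      hD.keyY_bb] at x12 x23 x34 x13 x24 y13 y32 y24 y12 y34 <;> try omega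
  · have e3 : (c₃ : ℕ) = c₂ := by omega
    have e4 : (c₄ : ℕ) = c₂ := by omega
    rw [e3] at x23 x34 y32 y34
    rw [e4] at x34 x24 y24 y34
    exact hD.rh_213 c₂ (by omega) a₄ a₄.2 a₃ (by omega) a₂ (by omega) (by omega) (by omega)
  · have e3 : (c₃ : ℕ) = c₂ := by omega
    have e4 : (c₄ : ℕ) = c₂ := by omega
    rw [e3] at x23 x34 y32 y34
    rw [e4] at x34 x24 y24 y34
    exact hD.rh_213 c₂ (by omega) a₄ a₄.2 a₃ (by omega) a₂ (by omega) (by omega) (by omega)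
  · have e2 : (c₂ : ℕ) = c₁ := by omega
    have e3 : (c₃ : ℕ) = c₁ := by omega
    have e4 : (c₄ : ℕ) = c₁ := by omega
    rw [e2] at x12 x23 x24 y12 y24 y32
    rw [e3] at x23 x13 x34 y13 y32 y34
    rw [e4] at x34 x24 y24 y34
    exact hD.hx_avoid c₁ c₁.2 a₃ a₃.2 a₁ (by omega) a₄ a₄.2 a₂ (by omega) (by omega) (by omega)
      (by omega) (by omega) (by omega)
  · have e2 : (c₂ : ℕ) = c₁ := by omega
    have e3 : (c₃ : ℕ) = c₁ + 1 := by omega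
    have e4 : (c₄ : ℕ) = c₁ + 1 := by omega
    rw [e2] at x12 x23 x24 y12 y24 y32
    rw [e3] at x23 x13 x34 y13 y32 y34
    rw [e4] at x34 x24 y24 y34
    exact hD.hy_avoid c₁ c₁.2 a₂ a₂.2 a₁ (by omega) a₄ a₄.2 a₃ (by omega) (by omega) (by omega)
      (by omega) (by omega) (by omega)
  all_goals
    have e2 : (c₂ : ℕ) = c₁ := by omega
    have e3 : (c₃ : ℕ) = c₁ := by omega
    rw [e2] at x12 x23 x24 y12 y24 y32
    rw [e3] at x23 x13 x34 y13 y32 y34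
    exact hD.bh_132 c₁ c₁.2 a₃ a₃.2 a₂ (by omega) a₁ (by omega) (by omega) (by omega)

end Staircase

/-! ### The permutation of a staircase and its spanning trees -/

namespace Staircase

variable {t k l d : ℕ} {D : Staircase}

/-- The dominance order on the points of a permutation. -/
def LowerLeft {n : ℕ} (σ : Equiv.Perm (Fin n)) (p q : Fin n) : Prop := p < q ∧ σ p < σ q

theorem hasseGraph_adj {n : ℕ} (σ : Equiv.Perm (Fin n)) (p q : Fin n) :
    (hasseGraph σ).Adj p q ↔ CoversRel (LowerLeft σ) p q ∨ CoversRel (LowerLeft σ) q p := by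
  have h : ∀ p q : Fin n, (p < q ∧ σ p < σ q ∧ ¬ ∃ m, p < m ∧ m < q ∧ σ p < σ m ∧ σ m < σ q) ↔
      CoversRel (LowerLeft σ) p q := by
    intro p q
    simp only [CoversRel, LowerLeft]
    constructor
    · rintro ⟨h1, h2, h3⟩
      exact ⟨⟨h1, h2⟩, fun ⟨m, ⟨h4, h5⟩, h6, h7⟩ => h3 ⟨m, h4, h6, h5, h7⟩⟩
    · rintro ⟨⟨h1, h2⟩, h3⟩
      exact ⟨h1, h2, fun ⟨m, h4, h6, h5, h7⟩ => h3 ⟨m, ⟨h4, h5⟩, h6, h7⟩⟩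
  rw [hasseGraph, SimpleGraph.fromRel_adj, h, h]
  constructor
  · exact And.right
  · intro h
    refine ⟨?_, h⟩
    rintro rfl
    rcases h with h | h <;> exact lt_irrefl _ h.1.1

theorem coversRel_swap {V : Type*} {r : V → V → Prop} {p q : V} :
    CoversRel (Function.swap r) p q ↔ CoversRel r q p := by
  simp only [CoversRel, Function.swap]
  refine and_congr_right fun _ => not_congr (exists_congr fun m => and_comm)

variable {ex ey : StairPoint t k l ≃ Fin ((t + 1) * k + t * l)}

/-- The points of the red tree `i`. -/
def redSet (ex : StairPoint t k l ≃ Fin ((t + 1) * k + t * l)) (i : Fin (t + 1)) :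
    Finset (Fin ((t + 1) * k + t * l)) :=
  Finset.univ.image fun a => ex (.inl (i, a))

/-- The points of the blue tree `i`. -/
def blueSet (ex : StairPoint t k l ≃ Fin ((t + 1) * k + t * l)) (i : Fin t) :
    Finset (Fin ((t + 1) * k + t * l)) :=
  Finset.univ.image fun a => ex (.inr (i, a))

theorem mem_redSet {i : Fin (t + 1)} {x : StairPoint t k l} :
    ex x ∈ redSet ex i ↔ ∃ a, x = .inl (i, a) := by
  simp only [redSet, Finset.mem_image, Finset.mem_univ, true_and, EmbeddingLike.apply_eq_iff_eq]
  exact exists_congr fun a => eq_comm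

theorem mem_blueSet {i : Fin t} {x : StairPoint t k l} :
    ex x ∈ blueSet ex i ↔ ∃ a, x = .inr (i, a) := by
  simp only [blueSet, Finset.mem_image, Finset.mem_univ, true_and, EmbeddingLike.apply_eq_iff_eq]
  exact exists_congr fun a => eq_comm

theorem lowerLeft_iff (hex : ∀ p q, ex p < ex q ↔ D.keyX p < D.keyX q)
    (hey : ∀ p q, ey p < ey q ↔ D.keyY p < D.keyY q) (p q : StairPoint t k l) :
    LowerLeft (ex.symm.trans ey) (ex p) (ex q) ↔
      D.keyX p < D.keyX q ∧ D.keyY p < D.keyY q := by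
  simp [LowerLeft, hex, hey]

theorem LowerLeft.trans {n : ℕ} {σ : Equiv.Perm (Fin n)} {p q r : Fin n} (h : LowerLeft σ p q)
    (h' : LowerLeft σ q r) : LowerLeft σ p r := ⟨h.1.trans h'.1, h.2.trans h'.2⟩

theorem LowerLeft.irrefl {n : ℕ} {σ : Equiv.Perm (Fin n)} (p : Fin n) : ¬ LowerLeft σ p p :=
  fun h => lt_irrefl _ h.1

/-- No point of another cell lies between two points of a cell in both directions, so the Hasse
graph restricted to the cell is the Hasse graph of the cell. -/
theorem Valid.red_convex (hD : D.Valid t k l d) {i : Fin (t + 1)} {a b : Fin k}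
    {m : StairPoint t k l} (h1 : D.keyX (.inl (i, a) : StairPoint t k l) < D.keyX m) (h2 : D.keyX m < D.keyX (.inl (i, b) : StairPoint t k l))
    (h3 : D.keyY (.inl (i, a) : StairPoint t k l) < D.keyY m) (h4 : D.keyY m < D.keyY (.inl (i, b) : StairPoint t k l)) :
    ∃ c, m = .inl (i, c) := by
  rcases m with ⟨c, m⟩ | ⟨c, m⟩ <;>
    simp only [hD.keyX_rr, hD.keyX_rb, hD.keyX_br, hD.keyY_rr, hD.keyY_rb, hD.keyY_br]
      at h1 h2 h3 h4
  · obtain rfl : c = i := Fin.ext (by omega)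
    exact ⟨m, rfl⟩
  · omega

theorem Valid.blue_convex (hD : D.Valid t k l d) {i : Fin t} {a b : Fin l}
    {m : StairPoint t k l} (h1 : D.keyX (.inr (i, a) : StairPoint t k l) < D.keyX m) (h2 : D.keyX m < D.keyX (.inr (i, b) : StairPoint t k l))
    (h3 : D.keyY (.inr (i, a) : StairPoint t k l) < D.keyY m) (h4 : D.keyY m < D.keyY (.inr (i, b) : StairPoint t k l)) :
    ∃ c, m = .inr (i, c) := by
  rcases m with ⟨c, m⟩ | ⟨c, m⟩ <;>
    simp only [hD.keyX_bb, hD.keyX_rb, hD.keyX_br, hD.keyY_bb, hD.keyY_rb, hD.keyY_br]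
      at h1 h2 h3 h4
  · omega
  · obtain rfl : c = i := Fin.ext (by omega)
    exact ⟨m, rfl⟩

theorem Valid.red_isTree (hD : D.Valid t k l d)
    (hex : ∀ p q, ex p < ex q ↔ D.keyX p < D.keyX q)
    (hey : ∀ p q, ey p < ey q ↔ D.keyY p < D.keyY q) (i : Fin (t + 1)) :
    ((hasseGraph (ex.symm.trans ey)).induce (redSet ex i : Set _)).IsTree := by
  have hi : (i : ℕ) ≤ t := by omega
  refine isTree_induce_of_chain (r := LowerLeft (ex.symm.trans ey)) LowerLeft.trans LowerLeft.irrefl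
    (hasseGraph_adj _) ?_ ?_ (root := ex (.inl (i, ⟨0, hD.k_pos⟩))) (mem_redSet.2 ⟨_, rfl⟩) ?_
  · intro p hp q hq m h1 h2
    obtain ⟨p, rfl⟩ := ex.surjective p
    obtain ⟨q, rfl⟩ := ex.surjective q
    obtain ⟨m, rfl⟩ := ex.surjective m
    rw [mem_redSet] at hp hq ⊢
    obtain ⟨a, rfl⟩ := hp
    obtain ⟨b, rfl⟩ := hq
    rw [lowerLeft_iff hex hey] at h1 h2
    exact hD.red_convex h1.1 h2.1 h1.2 h2.2
  · intro p hp q hq m hm h1 h2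
    obtain ⟨p, rfl⟩ := ex.surjective p
    obtain ⟨q, rfl⟩ := ex.surjective q
    obtain ⟨m, rfl⟩ := ex.surjective m
    rw [mem_redSet] at hp hq hm
    obtain ⟨a, rfl⟩ := hp
    obtain ⟨b, rfl⟩ := hq
    obtain ⟨c, rfl⟩ := hm
    rw [lowerLeft_iff hex hey, hD.keyX_rr, hD.keyY_rr] at h1 h2 ⊢
    rw [lowerLeft_iff hex hey, hD.keyX_rr, hD.keyY_rr]
    rcases lt_trichotomy (a : ℕ) b with h | h | h
    · have := hD.rh_ne i hi b b.2 a h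
      have := hD.rh_213 i hi c c.2 b (by omega) a h
      omega
    · left; rw [Fin.ext h]
    · have := hD.rh_ne i hi a a.2 b h
      have := hD.rh_213 i hi c c.2 a (by omega) b h
      omega
  · intro p hp hne
    obtain ⟨p, rfl⟩ := ex.surjective p
    rw [mem_redSet] at hp
    obtain ⟨a, rfl⟩ := hp
    rw [lowerLeft_iff hex hey, hD.keyX_rr, hD.keyY_rr]
    have ha : 0 < (a : ℕ) := by
      rcases Nat.eq_zero_or_pos (a : ℕ) with h | h
      · exact absurd (by rw [show a = ⟨0, hD.k_pos⟩ from Fin.ext h]) hne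
      · exact h
    have h1 := hD.rh_ne i hi a a.2 0 ha
    have h2 := hD.rh_zero i hi
    exact ⟨Or.inr ⟨rfl, ha⟩, Or.inr ⟨rfl, by simp only [h2] at h1 ⊢; omega⟩⟩

theorem Valid.blue_isTree (hD : D.Valid t k l d)
    (hex : ∀ p q, ex p < ex q ↔ D.keyX p < D.keyX q)
    (hey : ∀ p q, ey p < ey q ↔ D.keyY p < D.keyY q) (i : Fin t) :
    ((hasseGraph (ex.symm.trans ey)).induce (blueSet ex i : Set _)).IsTree := by
  have hl := hD.l_pos
  -- Blue trees are rooted at the upper right, so the tree criterion is applied to the reversed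
  -- order.
  refine isTree_induce_of_chain (r := Function.swap (LowerLeft (ex.symm.trans ey)))
    (fun h h' => LowerLeft.trans h' h) LowerLeft.irrefl
    (fun p q => by
      rw [hasseGraph_adj]
      exact or_comm.trans (or_congr coversRel_swap.symm coversRel_swap.symm)) ?_ ?_
    (root := ex (.inr (i, ⟨l - 1, by omega⟩))) (mem_blueSet.2 ⟨_, rfl⟩) ?_
  · intro p hp q hq m h1 h2
    obtain ⟨p, rfl⟩ := ex.surjective p
    obtain ⟨q, rfl⟩ := ex.surjective q
    obtain ⟨m, rfl⟩ := ex.surjective m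
    rw [mem_blueSet] at hp hq ⊢
    obtain ⟨a, rfl⟩ := hp
    obtain ⟨b, rfl⟩ := hq
    rw [Function.swap, lowerLeft_iff hex hey] at h1 h2
    exact hD.blue_convex h2.1 h1.1 h2.2 h1.2
  · intro p hp q hq m hm h1 h2
    obtain ⟨p, rfl⟩ := ex.surjective p
    obtain ⟨q, rfl⟩ := ex.surjective q
    obtain ⟨m, rfl⟩ := ex.surjective m
    rw [mem_blueSet] at hp hq hm
    obtain ⟨a, rfl⟩ := hp
    obtain ⟨b, rfl⟩ := hq
    obtain ⟨c, rfl⟩ := hm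
    rw [Function.swap, lowerLeft_iff hex hey, hD.keyX_bb, hD.keyY_bb] at h1 h2 ⊢
    rw [Function.swap, lowerLeft_iff hex hey, hD.keyX_bb, hD.keyY_bb]
    rcases lt_trichotomy (a : ℕ) b with h | h | h
    · have := hD.bh_ne i i.2 b b.2 a h
      have := hD.bh_132 i i.2 b b.2 a h c (by omega)
      omega
    · left; rw [Fin.ext h]
    · have := hD.bh_ne i i.2 a a.2 b h
      have := hD.bh_132 i i.2 a a.2 b h c (by omega)
      omega
  · intro p hp hne
    obtain ⟨p, rfl⟩ := ex.surjective p
    rw [mem_blueSet] at hp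
    obtain ⟨a, rfl⟩ := hp
    rw [Function.swap, lowerLeft_iff hex hey, hD.keyX_bb, hD.keyY_bb]
    have ha : (a : ℕ) < l - 1 := by
      rcases (show (a : ℕ) ≤ l - 1 by omega).lt_or_eq with h | h
      · exact h
      · exact absurd (by rw [show a = ⟨l - 1, by omega⟩ from Fin.ext h]) hne
    have h1 := hD.bh_ne i i.2 (l - 1) (by omega) a ha
    have h2 := hD.bh_last i i.2
    have h3 := hD.bh_lt i i.2 a a.2
    exact ⟨Or.inr ⟨rfl, ha⟩, Or.inr ⟨rfl, by simp only [h2] at h1 ⊢; omega⟩⟩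

/-- The neighbours of the root in its tree are the non-root points with no other non-root point of
the tree to their upper right. -/
theorem Valid.blue_degree (hD : D.Valid t k l d)
    (hex : ∀ p q, ex p < ex q ↔ D.keyX p < D.keyX q)
    (hey : ∀ p q, ey p < ey q ↔ D.keyY p < D.keyY q) (i : Fin t) (root : Fin l)
    (hroot : (root : ℕ) = l - 1) :
    {p | p ∈ blueSet ex i ∧ (hasseGraph (ex.symm.trans ey)).Adj (ex (.inr (i, root))) p}.ncard =
      d := by
  classical
  have hl := hD.l_pos
  have hlast := hD.bh_last i i.2
  have key : {p | p ∈ blueSet ex i ∧ (hasseGraph (ex.symm.trans ey)).Adj (ex (.inr (i, root))) p} =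
      (fun a : Fin l => ex (.inr (i, a))) '' {a : Fin l | (a : ℕ) < l - 1 ∧ ∀ j < l - 1,
        (a : ℕ) < j → D.bh i j < D.bh i a} := by
    ext p
    obtain ⟨p, rfl⟩ := ex.surjective p
    simp only [Set.mem_ofPred_eq, Set.mem_image, EmbeddingLike.apply_eq_iff_eq]
    rw [mem_blueSet, hasseGraph_adj]
    constructor
    · rintro ⟨⟨a, rfl⟩, h⟩
      refine ⟨a, ?_, rfl⟩
      rcases h with h | h
      · have h1 := h.1
        rw [lowerLeft_iff hex hey, hD.keyX_bb, hD.keyY_bb] at h1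
        omega
      · obtain ⟨h1, h2⟩ := h
        rw [lowerLeft_iff hex hey, hD.keyX_bb, hD.keyY_bb, hroot] at h1
        refine ⟨by omega, fun j hj haj => ?_⟩
        by_contra hcon
        have h3 := hD.bh_ne i i.2 j (by omega) a haj
        have h4 := hD.bh_ne i i.2 (l - 1) (by omega) j hj
        have h5 := hD.bh_lt i i.2 j (by omega)
        refine h2 ⟨ex (.inr (i, ⟨j, by omega⟩)), ?_, ?_⟩
        · rw [lowerLeft_iff hex hey, hD.keyX_bb, hD.keyY_bb]
          exact ⟨Or.inr ⟨rfl, haj⟩, Or.inr ⟨rfl, by simp only; omega⟩⟩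
        · rw [lowerLeft_iff hex hey, hD.keyX_bb, hD.keyY_bb, hroot]
          exact ⟨Or.inr ⟨rfl, hj⟩, Or.inr ⟨rfl, by simp only; omega⟩⟩
    · rintro ⟨a, ⟨h1, h2⟩, rfl⟩
      refine ⟨⟨a, rfl⟩, Or.inr ⟨?_, ?_⟩⟩
      · have h4 := hD.bh_ne i i.2 (l - 1) (by omega) a h1
        have h5 := hD.bh_lt i i.2 a a.2
        rw [lowerLeft_iff hex hey, hD.keyX_bb, hD.keyY_bb, hroot]
        omega
      · rintro ⟨m, h3, h4⟩
        obtain ⟨m, rfl⟩ := ex.surjective m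
        rw [lowerLeft_iff hex hey] at h3 h4
        obtain ⟨j, rfl⟩ := hD.blue_convex h3.1 h4.1 h3.2 h4.2
        rw [hD.keyX_bb, hD.keyY_bb] at h3 h4
        have := h2 j (by omega) (by omega)
        omega
  rw [key, Set.ncard_image_of_injective]
  · rw [← hD.bh_degree i i.2, ← Set.ncard_coe_finset]
    refine Set.ncard_congr (fun a _ => (a : ℕ)) ?_ ?_ ?_
    · rintro a ⟨h1, h2⟩
      simp only [Finset.coe_filter, Finset.mem_range, Set.mem_ofPred_eq]
      exact ⟨h1, h2⟩
    · intro a b _ _ h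
      exact Fin.ext h
    · intro j hj
      simp only [Finset.coe_filter, Finset.mem_range, Set.mem_ofPred_eq] at hj
      exact ⟨⟨j, by omega⟩, hj, rfl⟩
  · intro a b h
    simpa using h

theorem Valid.mem_regularAvoiders (hD : D.Valid t k l d)
    (hex : ∀ p q, ex p < ex q ↔ D.keyX p < D.keyX q)
    (hey : ∀ p q, ey p < ey q ↔ D.keyY p < D.keyY q) :
    ex.symm.trans ey ∈ regularAvoiders t k l d := by
  have hl := hD.l_pos
  have hk := hD.k_pos
  have hex' : ∀ p q, ex p ≤ ex q ↔ ¬ D.keyX q < D.keyX p := fun p q => by rw [← hex, not_lt]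
  have hey' : ∀ p q, ey p ≤ ey q ↔ ¬ D.keyY q < D.keyY p := fun p q => by rw [← hey, not_lt]
  constructor
  · rintro ⟨a, b, c, e, h1, h2, h3, h4, h5, h6⟩
    obtain ⟨a, rfl⟩ := ex.surjective a
    obtain ⟨b, rfl⟩ := ex.surjective b
    obtain ⟨c, rfl⟩ := ex.surjective c
    obtain ⟨e, rfl⟩ := ex.surjective e
    simp only [Equiv.trans_apply, Equiv.symm_apply_apply, Fin.val_fin_lt] at h4 h5 h6
    rw [hex] at h1 h2 h3
    rw [hey] at h4 h5 h6
    exact hD.not_1324 a b c e h1 h2 h3 h4 h5 h6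
  · refine ⟨redSet ex, blueSet ex, fun i => ex (.inl (i, ⟨0, hD.k_pos⟩)),
      fun i => ex (.inr (i, ⟨l - 1, by omega⟩)), ?_, ?_, ?_, hD.red_isTree hex hey,
      hD.blue_isTree hex hey, ?_, ?_, ?_, ?_, ?_, ?_, ?_⟩
    · intro p
      obtain ⟨p, rfl⟩ := ex.surjective p
      rcases p with ⟨c, a⟩ | ⟨c, a⟩
      · refine ⟨.inl c, mem_redSet.2 ⟨a, rfl⟩, ?_⟩
        rintro (c' | c') h
        · obtain ⟨a', h⟩ := mem_redSet.1 h
          simp only [Sum.inl.injEq, Prod.mk.injEq] at h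
          rw [h.1]
        · obtain ⟨a', h⟩ := mem_blueSet.1 h
          simp at h
      · refine ⟨.inr c, mem_blueSet.2 ⟨a, rfl⟩, ?_⟩
        rintro (c' | c') h
        · obtain ⟨a', h⟩ := mem_redSet.1 h
          simp at h
        · obtain ⟨a', h⟩ := mem_blueSet.1 h
          simp only [Sum.inr.injEq, Prod.mk.injEq] at h
          rw [h.1]
    · intro i
      rw [redSet, Finset.card_image_of_injective]
      · simp
      · intro a b h; simpa using h
    · intro i
      rw [blueSet, Finset.card_image_of_injective]
      · simp
      · intro a b h; simpa using h
    · exact fun i => mem_redSet.2 ⟨_, rfl⟩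
    · exact fun i => mem_blueSet.2 ⟨_, rfl⟩
    · intro i p hp
      obtain ⟨p, rfl⟩ := ex.surjective p
      obtain ⟨a, rfl⟩ := mem_redSet.1 hp
      have := hD.rh_zero i (by omega)
      simp only [Equiv.trans_apply, Equiv.symm_apply_apply]
      rw [hex', hey', hD.keyX_rr, hD.keyY_rr]
      simp only
      omega
    · intro i p hp
      obtain ⟨p, rfl⟩ := ex.surjective p
      obtain ⟨a, rfl⟩ := mem_blueSet.1 hp
      have := hD.bh_last i i.2
      have := hD.bh_lt i i.2 a a.2
      simp only [Equiv.trans_apply, Equiv.symm_apply_apply]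
      rw [hex', hey', hD.keyX_bb, hD.keyY_bb]
      simp only
      omega
    · exact fun i => hD.blue_degree hex hey i _ rfl
    · intro i p hp q hq
      obtain ⟨p, rfl⟩ := ex.surjective p
      obtain ⟨a, rfl⟩ := mem_redSet.1 hp
      obtain ⟨q, rfl⟩ := ex.surjective q
      obtain ⟨b, rfl⟩ := mem_blueSet.1 hq
      have h1 := hD.hx_pos i i.2 b b.2
      have h2 := hD.hx_last i i.2
      simp only [Equiv.trans_apply, Equiv.symm_apply_apply]
      rw [hex, hex, hey, hD.keyX_rb, hD.keyX_rb, hD.keyY_br]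
      exact ⟨Or.inl (Nat.lt_succ_self _), Or.inr ⟨rfl, h1⟩, Or.inr ⟨rfl, a.2.trans_eq h2.symm⟩⟩
    · intro i q hq p hp
      obtain ⟨p, rfl⟩ := ex.surjective p
      obtain ⟨a, rfl⟩ := mem_redSet.1 hp
      obtain ⟨q, rfl⟩ := ex.surjective q
      obtain ⟨b, rfl⟩ := mem_blueSet.1 hq
      have h1 := hD.hy_pos i i.2 _ (hD.bh_lt i i.2 b b.2)
      have h2 := hD.hy_last i i.2
      have h3 := hD.rh_zero (i + 1) (by omega)
      have h4 := hD.rh_lt (i + 1) (by omega) a a.2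
      have h5 := hD.bh_last i i.2
      simp only [Equiv.trans_apply, Equiv.symm_apply_apply]
      rw [hex, hey, hey, hD.keyX_br, hD.keyY_rb, hD.keyY_rb]
      exact ⟨Or.inl (Nat.lt_succ_self _), Or.inr ⟨rfl, h3.trans_lt h1⟩,
        Or.inr ⟨rfl, h4.trans_eq (by simp only [h5, h2])⟩⟩

end Staircase

/-! ### Recovering a staircase from its permutation -/

theorem Fin.eq_id_of_strictMono {k : ℕ} {f : Fin k → Fin k} (hf : StrictMono f) : f = id :=
  (hf.range_inj strictMono_id).1
    (by rw [(Finite.surjective_of_injective hf.injective).range_eq, Set.range_id])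

theorem Fin.eq_of_injective_of_lt_iff_lt {k : ℕ} {f g : Fin k → Fin k} (hf : Function.Injective f)
    (h : ∀ a b, f a < f b ↔ g a < g b) : f = g := by
  have hf' : Function.Surjective f := Finite.surjective_of_injective hf
  have hm : StrictMono fun a => g (Function.surjInv hf' a) := by
    intro a b hab
    rw [← h, Function.surjInv_eq hf' a, Function.surjInv_eq hf' b]
    exact hab
  have := Fin.eq_id_of_strictMono hm
  ext a
  have h1 := congrFun this (f a)
  simp only [id] at h1
  rw [← h1, hf (Function.surjInv_eq hf' (f a))]

theorem eq_of_lt_iff_lt {k : ℕ} {f g : ℕ → ℕ} (hf : ∀ a < k, f a < k) (hg : ∀ a < k, g a < k)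
    (hne : ∀ b < k, ∀ a < b, f a ≠ f b)
    (h : ∀ a < k, ∀ b < k, (f a < f b ↔ g a < g b)) : ∀ a < k, f a = g a := by
  have := Fin.eq_of_injective_of_lt_iff_lt (f := fun a : Fin k => ⟨f a, hf a a.2⟩)
    (g := fun a : Fin k => ⟨g a, hg a a.2⟩) ?_ fun a b => h a a.2 b b.2
  · intro a ha
    exact congrArg Fin.val (congrFun this ⟨a, ha⟩)
  · intro a b hab
    have hab : f a = f b := congrArg Fin.val hab
    rcases lt_trichotomy (a : ℕ) b with h | h | h
    · exact absurd hab (hne b b.2 a h)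
    · exact Fin.ext h
    · exact absurd hab.symm (hne a a.2 b h)

theorem exists_eq_of_lt_of_ne {k : ℕ} {f : ℕ → ℕ} (hf : ∀ a < k, f a < k)
    (hne : ∀ b < k, ∀ a < b, f a ≠ f b) {y : ℕ} (hy : y < k) : ∃ a < k, f a = y := by
  have hinj : Function.Injective (fun a : Fin k => (⟨f a, hf a a.2⟩ : Fin k)) := by
    intro a b hab
    have hab : f a = f b := congrArg Fin.val hab
    rcases lt_trichotomy (a : ℕ) b with h | h | h
    · exact absurd hab (hne b b.2 a h)
    · exact Fin.ext h
    · exact absurd hab.symm (hne a a.2 b h)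
  obtain ⟨a, ha⟩ := Finite.surjective_of_injective hinj ⟨y, hy⟩
  exact ⟨a, a.2, congrArg Fin.val ha⟩

/-- Both enumerations list the values of `φ` in sorted order, and the sorted list is unique. -/
theorem Equiv.comp_eq_of_monotone {X α : Type*} [PartialOrder α] {n : ℕ} (e e' : X ≃ Fin n)
    (φ : X → α) (h : ∀ p q, e p < e q → φ p ≤ φ q) (h' : ∀ p q, e' p < e' q → φ p ≤ φ q) (p : X) :
    φ (e'.symm (e p)) = φ p := by
  have hm : ∀ e : X ≃ Fin n, (∀ p q, e p < e q → φ p ≤ φ q) → Monotone (φ ∘ e.symm) := by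
    intro e h a b hab
    rcases hab.lt_or_eq with hlt | rfl
    · exact h _ _ (by simpa using hlt)
    · exact le_rfl
  have := Tuple.unique_monotone (f := φ ∘ e.symm) (σ := 1) (τ := e'.symm.trans e)
    (hm e h) (by
      convert hm e' h' using 1
      ext x
      simp)
  have := congrFun this (e p)
  simpa using this.symm

namespace Staircase

variable {t k l d : ℕ} {D D' : Staircase}

/-- The number of the column of a point. -/
def column : StairPoint t k l → ℕ
  | .inl (c, _) => c
  | .inr (c, _) => c

/-- The number of the row of a point, counted from the top. -/
def row : StairPoint t k l → ℕ
  | .inl (c, _) => c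
  | .inr (c, _) => c + 1

theorem Valid.column_le (hD : D.Valid t k l d) {p q : StairPoint t k l}
    (h : D.keyX p < D.keyX q) : column p ≤ column q := by
  rcases p with ⟨c, a⟩ | ⟨c, a⟩ <;> rcases q with ⟨c', a'⟩ | ⟨c', a'⟩ <;>
    simp only [hD.keyX_rr, hD.keyX_rb, hD.keyX_br, hD.keyX_bb, column] at h ⊢ <;> omega

theorem Valid.row_le (hD : D.Valid t k l d) {p q : StairPoint t k l}
    (h : D.keyY p < D.keyY q) : row q ≤ row p := by
  rcases p with ⟨c, a⟩ | ⟨c, a⟩ <;> rcases q with ⟨c', a'⟩ | ⟨c', a'⟩ <;>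
    simp only [hD.keyY_rr, hD.keyY_rb, hD.keyY_br, hD.keyY_bb, row] at h ⊢ <;> omega

variable {n : ℕ} {ex ey ex' ey' : StairPoint t k l ≃ Fin n}

/-- The positions of the points of a staircase are determined by the permutation. -/
theorem Valid.position_eq (hD : D.Valid t k l d) (hD' : D'.Valid t k l d)
    (hex : ∀ p q, ex p < ex q ↔ D.keyX p < D.keyX q)
    (hey : ∀ p q, ey p < ey q ↔ D.keyY p < D.keyY q)
    (hex' : ∀ p q, ex' p < ex' q ↔ D'.keyX p < D'.keyX q)
    (hey' : ∀ p q, ey' p < ey' q ↔ D'.keyY p < D'.keyY q)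
    (h : ex.symm.trans ey = ex'.symm.trans ey') : ex = ex' := by
  -- As the permutations agree, the relabelling of the points is the same whether computed from
  -- horizontal or from vertical positions. It thus preserves both column and row, hence the cell,
  -- and being increasing within each cell it is the identity.
  have hπ : ∀ p, ex'.symm (ex p) = ey'.symm (ey p) := by
    intro p
    have := Equiv.congr_fun h (ex p)
    simp only [Equiv.trans_apply, Equiv.symm_apply_apply] at this
    rw [this, Equiv.symm_apply_apply]
  have hcol : ∀ p, column (ex'.symm (ex p)) = column p :=
    Equiv.comp_eq_of_monotone ex ex' column (fun p q h => hD.column_le ((hex p q).1 h))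
      fun p q h => hD'.column_le ((hex' p q).1 h)
  have hrow : ∀ p, row (ex'.symm (ex p)) = row p := by
    intro p
    rw [hπ]
    exact OrderDual.toDual.injective (Equiv.comp_eq_of_monotone ey ey'
      (fun p => OrderDual.toDual (row p)) (fun p q h => hD.row_le ((hey p q).1 h))
      (fun p q h => hD'.row_le ((hey' p q).1 h)) p)
  have hred : ∀ c a, ∃ a', ex'.symm (ex (.inl (c, a))) = .inl (c, a') := by
    intro c a
    have h1 := hcol (.inl (c, a))
    have h2 := hrow (.inl (c, a))
    rcases hp : ex'.symm (ex (.inl (c, a))) with ⟨c', a'⟩ | ⟨c', a'⟩ <;> rw [hp] at h1 h2 <;>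
      simp only [column, row] at h1 h2
    · exact ⟨a', by rw [Fin.ext h1]⟩
    · omega
  have hblue : ∀ c a, ∃ a', ex'.symm (ex (.inr (c, a))) = .inr (c, a') := by
    intro c a
    have h1 := hcol (.inr (c, a))
    have h2 := hrow (.inr (c, a))
    rcases hp : ex'.symm (ex (.inr (c, a))) with ⟨c', a'⟩ | ⟨c', a'⟩ <;> rw [hp] at h1 h2 <;>
      simp only [column, row] at h1 h2
    · omega
    · exact ⟨a', by rw [Fin.ext h1]⟩
  have hmono : ∀ p q, D.keyX p < D.keyX q →
      D'.keyX (ex'.symm (ex p)) < D'.keyX (ex'.symm (ex q)) := by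
    intro p q h
    rw [← hex', Equiv.apply_symm_apply, Equiv.apply_symm_apply, hex]
    exact h
  choose f hf using hred
  choose g hg using hblue
  have hf' : ∀ c, f c = id := fun c => Fin.eq_id_of_strictMono fun a b hab => by
    have := hmono (.inl (c, a)) (.inl (c, b)) ((hD.keyX_rr _ _ _ _).2 (Or.inr ⟨rfl, hab⟩))
    rw [hf, hf, hD'.keyX_rr] at this
    rw [Fin.lt_def]
    omega
  have hg' : ∀ c, g c = id := fun c => Fin.eq_id_of_strictMono fun a b hab => by
    have := hmono (.inr (c, a)) (.inr (c, b)) ((hD.keyX_bb _ _ _ _).2 (Or.inr ⟨rfl, hab⟩))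
    rw [hg, hg, hD'.keyX_bb] at this
    rw [Fin.lt_def]
    omega
  ext p
  rw [← Equiv.symm_apply_eq (e := ex') |>.1 (show ex'.symm (ex p) = p from ?_)]
  rcases p with ⟨c, a⟩ | ⟨c, a⟩
  · rw [hf, hf', id]
  · rw [hg, hg', id]

/-- A staircase is determined by its permutation. -/
theorem Valid.eq_of_perm_eq (hD : D.Valid t k l d) (hD' : D'.Valid t k l d)
    (hex : ∀ p q, ex p < ex q ↔ D.keyX p < D.keyX q)
    (hey : ∀ p q, ey p < ey q ↔ D.keyY p < D.keyY q)
    (hex' : ∀ p q, ex' p < ex' q ↔ D'.keyX p < D'.keyX q)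
    (hey' : ∀ p q, ey' p < ey' q ↔ D'.keyY p < D'.keyY q)
    (h : ex.symm.trans ey = ex'.symm.trans ey') :
    (∀ c ≤ t, ∀ a < k, D.rh c a = D'.rh c a) ∧ (∀ c < t, ∀ i < l, D.bh c i = D'.bh c i) ∧
      (∀ c < t, ∀ i < l, D.hx c i = D'.hx c i) ∧ ∀ c < t, ∀ j < l, D.hy c j = D'.hy c j := by
  have hX := hD.position_eq hD' hex hey hex' hey' h
  have hY : ey = ey' := by
    ext p
    have := Equiv.congr_fun h (ex p)
    simp only [Equiv.trans_apply, Equiv.symm_apply_apply, hX] at this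
    rw [this]
  subst hX hY
  have kX : ∀ p q : StairPoint t k l, D.keyX p < D.keyX q ↔ D'.keyX p < D'.keyX q :=
    fun p q => (hex p q).symm.trans (hex' p q)
  have kY : ∀ p q : StairPoint t k l, D.keyY p < D.keyY q ↔ D'.keyY p < D'.keyY q :=
    fun p q => (hey p q).symm.trans (hey' p q)
  have hr : ∀ c ≤ t, ∀ a < k, D.rh c a = D'.rh c a := fun c hc =>
    eq_of_lt_iff_lt (hD.rh_lt c hc) (hD'.rh_lt c hc) (hD.rh_ne c hc) fun a ha b hb => by
      have := kY (.inl (⟨c, by omega⟩, ⟨a, ha⟩)) (.inl (⟨c, by omega⟩, ⟨b, hb⟩))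
      rw [hD.keyY_rr, hD'.keyY_rr] at this
      simpa using this
  have hb : ∀ c < t, ∀ a < l, D.bh c a = D'.bh c a := fun c hc =>
    eq_of_lt_iff_lt (hD.bh_lt c hc) (hD'.bh_lt c hc) (hD.bh_ne c hc) fun a ha b hb => by
      have := kY (.inr (⟨c, by omega⟩, ⟨a, ha⟩)) (.inr (⟨c, by omega⟩, ⟨b, hb⟩))
      rw [hD.keyY_bb, hD'.keyY_bb] at this
      simpa using this
  have heq : ∀ u v, u ≤ k → v ≤ k → (∀ a < k, (a < u ↔ a < v)) → u = v := by
    intro u v hu hv h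
    rcases lt_trichotomy u v with h1 | h1 | h1
    · have := h u (by omega); omega
    · exact h1
    · have := h v (by omega); omega
  refine ⟨hr, hb, fun c hc i hi => heq _ _ (hD.hx_le c hc i hi) (hD'.hx_le c hc i hi) fun a ha => ?_,
    fun c hc j hj => heq _ _ (hD.hy_le c hc j hj) (hD'.hy_le c hc j hj) fun y hy => ?_⟩
  · have := kX (.inl (⟨c, by omega⟩, ⟨a, ha⟩)) (.inr (⟨c, hc⟩, ⟨i, hi⟩))
    rw [hD.keyX_rb, hD'.keyX_rb] at this
    simpa using this
  -- `hy` is indexed by blue heights and counts red heights, so both are first realised by points.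
  · obtain ⟨i, hi, rfl⟩ := exists_eq_of_lt_of_ne (hD.bh_lt c hc) (hD.bh_ne c hc) hj
    obtain ⟨a, ha, rfl⟩ := exists_eq_of_lt_of_ne (hD.rh_lt (c + 1) hc) (hD.rh_ne (c + 1) hc) hy
    have := kY (.inl (⟨c + 1, by omega⟩, ⟨a, ha⟩)) (.inr (⟨c, hc⟩, ⟨i, hi⟩))
    rw [hD.keyY_rb, hD'.keyY_rb] at this
    simp only [lt_irrefl, true_and, false_or, ← hb c hc i hi, ← hr (c + 1) hc a ha] at this
    exact this

end Staircase

/-! ### Staircases built from trees and their interleavings -/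

/-- The mirror image of a plane tree. -/
def PlaneTree.mirror (R : PlaneTree) : PlaneTree := ⟨R.children.mirror⟩

theorem PlaneTree.toForest_mirror (R : PlaneTree) : R.mirror.toForest = R.toForest.mirror := rfl

theorem PlaneTree.size_mirror (R : PlaneTree) : R.mirror.size = R.size := by
  rw [PlaneTree.size, PlaneTree.mirror, PlaneForest.size_mirror, PlaneTree.size]

theorem PlaneTree.rootDegree_mirror (R : PlaneTree) : R.mirror.rootDegree = R.rootDegree := by
  rw [PlaneTree.rootDegree, PlaneTree.mirror, PlaneForest.len_eq_length_trees,
    PlaneForest.len_mirror, PlaneTree.rootDegree, PlaneForest.len_eq_length_trees]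

theorem PlaneTree.mirror_mirror (R : PlaneTree) : R.mirror.mirror = R := by
  rw [PlaneTree.mirror, PlaneTree.mirror, PlaneForest.mirror_mirror]

theorem PlaneTree.toForest_injective : Function.Injective PlaneTree.toForest := by
  rintro ⟨c⟩ ⟨c'⟩ h
  simpa [PlaneTree.toForest] using h

theorem mem_treeInterleavings {R B : PlaneTree} {h : List ℕ} :
    h ∈ treeInterleavings R B ↔ (h.length = B.size ∧ ∀ y ∈ h, y ≤ R.size) ∧
      Admissible R.toForest.desc B.toForest h ∧ (∀ y ∈ h, 1 ≤ y) ∧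
      h.getD B.children.size 0 = R.size := by
  simp only [treeInterleavings, Finset.mem_filter, mem_boundedLists]

theorem Admissible.avoids {F G : PlaneForest} {h : List ℕ} (hh : Admissible F.desc G h)
    {i j a b : ℕ} (hj : j < G.size) (hij : i < j) (hb : b < F.size) (hab : a < b)
    (h1 : G.blueHeight i < G.blueHeight j) (h2 : F.redHeight a < F.redHeight b)
    (h3 : h.getD i 0 ≤ a) (h4 : a < h.getD j 0) : ¬ h.getD j 0 ≤ b := by
  have h5 := (PlaneForest.blueHeight_lt_iff hij hj).1.1 h1
  have h6 := (PlaneForest.redHeight_lt_iff hab hb).1.1 h2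
  have := (hh.2 i j hij hj).2 h5 a h3 h4
  omega

namespace Staircase

/-- The staircase with red trees `R c`, blue trees `B c`, horizontal interleavings `H c` and vertical
interleavings `V c`. -/
def ofTrees (R B : ℕ → PlaneTree) (H V : ℕ → List ℕ) : Staircase where
  rh c := (R c).toForest.redHeight
  bh c := (B c).toForest.blueHeight
  hx c i := (H c).getD i 0
  hy c i := (V c).getD i 0

open PlaneForest

/-- In a row the heights play the role of the horizontal positions. By `redHeight_mirror` and
`blueHeight_mirror` this is a horizontal interleaving of the mirrored trees, so rows need no
separate analysis. -/
theorem valid_ofTrees {R B : ℕ → PlaneTree} {H V : ℕ → List ℕ} {t k l d : ℕ} (hk : 0 < k)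
    (hl : 0 < l) (hR : ∀ c ≤ t, (R c).size = k)
    (hB : ∀ c < t, (B c).size = l ∧ (B c).rootDegree = d)
    (hH : ∀ c < t, H c ∈ treeInterleavings (R c) (B c))
    (hV : ∀ c < t, V c ∈ treeInterleavings (R (c + 1)).mirror (B c).mirror) :
    (ofTrees R B H V).Valid t k l d := by
  have hR' : ∀ c ≤ t, (R c).toForest.size = k := hR
  have hB' : ∀ c < t, (B c).toForest.size = l := fun c hc => (hB c hc).1
  have hBc : ∀ c < t, (B c).children.size = l - 1 := by
    intro c hc
    have := (hB c hc).1
    rw [PlaneTree.size] at this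
    omega
  have hH' := fun c hc => mem_treeInterleavings.1 (hH c hc)
  have hV' := fun c hc => mem_treeInterleavings.1 (hV c hc)
  have hmem : ∀ c < t, ∀ i < l, (H c).getD i 0 ∈ H c := fun c hc i hi =>
    getD_mem_of_lt (by rw [(hH' c hc).1.1, (hB c hc).1]; exact hi)
  have hmem' : ∀ c < t, ∀ i < l, (V c).getD i 0 ∈ V c := fun c hc i hi =>
    getD_mem_of_lt (by rw [(hV' c hc).1.1, PlaneTree.size_mirror, (hB c hc).1]; exact hi)
  constructor
  · exact hk
  · exact hl
  · intro c hc a ha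
    exact (redHeight_lt (ha.trans_eq (hR' c hc).symm)).trans_eq (hR' c hc)
  · intro c hc b hb a hab
    exact (redHeight_lt_iff hab (hb.trans_eq (hR' c hc).symm)).2
  · intro c hc
    simp [ofTrees, PlaneTree.toForest, redHeight]
  · intro c hc m hm b hbm a hab h1 h2
    have hm' := hm.trans_eq (hR' c hc).symm
    have h3 := (redHeight_lt_iff (hab.trans hbm) hm').1.1 h2
    have h4 := (redHeight_lt_iff hab (hbm.trans hm')).1.2 (by omega)
    exact lt_asymm h1 h4
  · intro c hc a ha
    exact (blueHeight_lt (ha.trans_eq (hB' c hc).symm)).trans_eq (hB' c hc)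
  · intro c hc b hb a hab
    exact (blueHeight_lt_iff hab (hb.trans_eq (hB' c hc).symm)).2
  · intro c hc
    simp [ofTrees, PlaneTree.toForest, blueHeight, hBc c hc]
  · intro c hc m hm j hjm i hij h1 h2
    have hm' := hm.trans_eq (hB' c hc).symm
    have h3 := (blueHeight_lt_iff (hij.trans hjm) hm').1.1 h1
    have h4 := (blueHeight_lt_iff hjm hm').1.2 (by omega)
    exact lt_asymm h2 h4
  · intro c hc
    rw [← (hB c hc).2, PlaneTree.rootDegree, len_eq_length_trees, ← card_blue_roots, hBc c hc]
    congr 1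
    refine Finset.filter_congr fun i hi => forall₂_congr fun j hj => ?_
    rw [Finset.mem_range] at hi
    simp [ofTrees, PlaneTree.toForest, blueHeight, hBc c hc, hi, hj]
  · intro c hc j hj i hij
    exact ((hH' c hc).2.1.2 i j hij (hj.trans_eq (hB' c hc).symm)).1
  · intro c hc i hi
    exact (hH' c hc).2.2.1 _ (hmem c hc i hi)
  · intro c hc i hi
    exact ((hH' c hc).1.2 _ (hmem c hc i hi)).trans_eq (hR c hc.le)
  · intro c hc
    have := (hH' c hc).2.2.2
    rw [hBc c hc, hR c hc.le] at this
    exact this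
  · intro c hc j hj i hij b hb a hab h1 h2 h3 h4
    exact (hH' c hc).2.1.avoids (hj.trans_eq (hB' c hc).symm) hij (hb.trans_eq (hR' c hc.le).symm)
      hab h1 h2 h3 h4
  · intro c hc j hj i hij
    exact ((hV' c hc).2.1.2 i j hij (by
      rw [PlaneTree.size_toForest, PlaneTree.size_mirror, (hB c hc).1]; exact hj)).1
  · intro c hc i hi
    exact (hV' c hc).2.2.1 _ (hmem' c hc i hi)
  · intro c hc i hi
    exact ((hV' c hc).1.2 _ (hmem' c hc i hi)).trans_eq
      ((PlaneTree.size_mirror _).trans (hR (c + 1) hc))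
  · intro c hc
    have := (hV' c hc).2.2.2
    rw [PlaneTree.mirror, PlaneForest.size_mirror, hBc c hc, PlaneTree.size_mirror,
      hR (c + 1) hc] at this
    exact this
  · intro c hc j hj i hij b hb a hab h1 h2 h3 h4
    have hj' := hj.trans_eq (hB' c hc).symm
    have hb' := hb.trans_eq (hR' (c + 1) hc).symm
    refine (hV' c hc).2.1.avoids ?_ h1 ?_ h2 ?_ ?_ h3 h4
    · rw [PlaneTree.toForest_mirror, PlaneForest.size_mirror]
      exact blueHeight_lt hj'
    · rw [PlaneTree.toForest_mirror, PlaneForest.size_mirror]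
      exact redHeight_lt hb'
    · rw [PlaneTree.toForest_mirror]
      simp only [ofTrees]
      rw [blueHeight_mirror hj', blueHeight_mirror (hij.trans hj')]
      exact hij
    · rw [PlaneTree.toForest_mirror]
      simp only [ofTrees]
      rw [redHeight_mirror hb', redHeight_mirror (hab.trans hb')]
      exact hab

theorem Valid.exists_perm {D : Staircase} {t k l d : ℕ} (hD : D.Valid t k l d) :
    ∃ ex ey : StairPoint t k l ≃ Fin ((t + 1) * k + t * l),
      (∀ p q, ex p < ex q ↔ D.keyX p < D.keyX q) ∧ ∀ p q, ey p < ey q ↔ D.keyY p < D.keyY q := by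
  have hcard : Fintype.card (StairPoint t k l) = (t + 1) * k + t * l := by simp
  obtain ⟨ex, hex⟩ := exists_rank hcard hD.keyX_injective
  obtain ⟨ey, hey⟩ := exists_rank hcard hD.keyY_injective
  exact ⟨ex, ey, hex, hey⟩

end Staircase

theorem List.eq_of_getD_eq {h h' : List ℕ} {n : ℕ} (hn : h.length = n) (hn' : h'.length = n)
    (heq : ∀ i < n, h.getD i 0 = h'.getD i 0) : h = h' := by
  refine List.ext_getElem (hn.trans hn'.symm) fun i h1 h2 => ?_
  have := heq i (h1.trans_eq hn)
  rwa [List.getD_eq_getElem _ _ h1, List.getD_eq_getElem _ _ h2] at this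

/-- The extension of a finite sequence to a sequence. -/
def Fin.extend {α : Type*} (x : α) {n : ℕ} (f : Fin n → α) (i : ℕ) : α :=
  if h : i < n then f ⟨i, h⟩ else x

theorem Fin.extend_apply {α : Type*} (x : α) {n : ℕ} (f : Fin n → α) {i : ℕ} (h : i < n) :
    Fin.extend x f i = f ⟨i, h⟩ := dif_pos h

open PlaneForest in
-- The map from staircase data to permutations is injective: the permutation determines the heights,
-- which determine the trees, and the two families of counts.
theorem sum_prod_le_ncard_regularAvoiders {t k l d : ℕ} (hk : 0 < k) (hl : 0 < l)
    [Fintype (RedTree k)] [Fintype (BlueTree l d)] :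
    ∑ x : (Fin (t + 1) → RedTree k) × (Fin t → BlueTree l d),
      (∏ c : Fin t, (treeInterleavings (x.1 c.castSucc).1 (x.2 c).1).card) *
        ∏ c : Fin t, (treeInterleavings (x.1 c.succ).1.mirror (x.2 c).1.mirror).card ≤
    (regularAvoiders t k l d).ncard := by
  classical
  let S : Finset (Σ _ : (Fin (t + 1) → RedTree k) × (Fin t → BlueTree l d),
      (Fin t → List ℕ) × (Fin t → List ℕ)) :=
    Finset.univ.sigma fun x =>
      Fintype.piFinset (fun c : Fin t => treeInterleavings (x.1 c.castSucc).1 (x.2 c).1) ×ˢ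
        Fintype.piFinset fun c : Fin t => treeInterleavings (x.1 c.succ).1.mirror (x.2 c).1.mirror
  let D := fun x : Σ _ : (Fin (t + 1) → RedTree k) × (Fin t → BlueTree l d),
      (Fin t → List ℕ) × (Fin t → List ℕ) =>
    Staircase.ofTrees (Fin.extend ⟨nil⟩ fun c => (x.1.1 c).1) (Fin.extend ⟨nil⟩ fun c => (x.1.2 c).1)
      (Fin.extend [] x.2.1) (Fin.extend [] x.2.2)
  have hS : S.card = ∑ x : (Fin (t + 1) → RedTree k) × (Fin t → BlueTree l d),
      (∏ c : Fin t, (treeInterleavings (x.1 c.castSucc).1 (x.2 c).1).card) *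
        ∏ c : Fin t, (treeInterleavings (x.1 c.succ).1.mirror (x.2 c).1.mirror).card := by
    simp only [S, Finset.card_sigma, Finset.card_product, Fintype.card_piFinset]
  have hmem : ∀ x ∈ S,
      (∀ c : Fin t, x.2.1 c ∈ treeInterleavings (x.1.1 c.castSucc).1 (x.1.2 c).1) ∧
      ∀ c : Fin t, x.2.2 c ∈ treeInterleavings (x.1.1 c.succ).1.mirror (x.1.2 c).1.mirror := by
    intro x hx
    simpa only [S, Finset.mem_sigma, Finset.mem_univ, true_and, Finset.mem_product,
      Fintype.mem_piFinset] using hx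
  have hvalid : ∀ x ∈ S, (D x).Valid t k l d := by
    intro x hx
    refine Staircase.valid_ofTrees hk hl ?_ ?_ ?_ ?_
    · intro c hc
      rw [Fin.extend_apply _ _ (by omega)]
      exact (x.1.1 _).2
    · intro c hc
      rw [Fin.extend_apply _ _ hc]
      exact (x.1.2 _).2
    · intro c hc
      rw [Fin.extend_apply _ _ hc, Fin.extend_apply _ _ hc, Fin.extend_apply _ _ (by omega)]
      exact (hmem x hx).1 ⟨c, hc⟩
    · intro c hc
      rw [Fin.extend_apply _ _ hc, Fin.extend_apply _ _ hc, Fin.extend_apply _ _ (by omega)]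
      exact (hmem x hx).2 ⟨c, hc⟩
  rw [← hS, ← Set.ncard_coe_finset]
  have hperm : ∀ x : S, ∃ σ, ∃ ex ey : StairPoint t k l ≃ Fin ((t + 1) * k + t * l),
      (∀ p q, ex p < ex q ↔ (D x.1).keyX p < (D x.1).keyX q) ∧
      (∀ p q, ey p < ey q ↔ (D x.1).keyY p < (D x.1).keyY q) ∧ σ = ex.symm.trans ey := by
    intro x
    obtain ⟨ex, ey, h1, h2⟩ := (hvalid x.1 x.2).exists_perm
    exact ⟨_, ex, ey, h1, h2, rfl⟩
  choose σ ex ey hex hey hσ using hperm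
  refine Set.ncard_le_ncard_of_injOn (fun x => if hx : x ∈ S then σ ⟨x, hx⟩ else 1) ?_ ?_
    (Set.toFinite _)
  · intro x hx
    have hx : x ∈ S := hx
    simp only [dif_pos hx, hσ]
    exact (hvalid x hx).mem_regularAvoiders (hex ⟨x, hx⟩) (hey ⟨x, hx⟩)
  · intro x hx y hy hxy
    have hx : x ∈ S := hx
    have hy : y ∈ S := hy
    simp only [dif_pos hx, dif_pos hy, hσ] at hxy
    obtain ⟨h1, h2, h3, h4⟩ := (hvalid x hx).eq_of_perm_eq (hvalid y hy) (hex ⟨x, hx⟩)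
      (hey ⟨x, hx⟩) (hex ⟨y, hy⟩) (hey ⟨y, hy⟩) hxy
    have hR : x.1.1 = y.1.1 := by
      funext c
      refine Subtype.ext (PlaneTree.toForest_injective (eq_of_redHeight_eq ?_ fun a ha => ?_))
      · rw [PlaneTree.size_toForest, PlaneTree.size_toForest, (x.1.1 c).2, (y.1.1 c).2]
      · have := h1 c (by omega) a (by rwa [PlaneTree.size_toForest, (x.1.1 c).2] at ha)
        simpa only [D, Staircase.ofTrees, Fin.extend_apply _ _ c.2] using this
    have hB : x.1.2 = y.1.2 := by
      funext c
      refine Subtype.ext (PlaneTree.toForest_injective (eq_of_blueHeight_eq ?_ fun a ha => ?_))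
      · rw [PlaneTree.size_toForest, PlaneTree.size_toForest, (x.1.2 c).2.1, (y.1.2 c).2.1]
      · have := h2 c c.2 a (by rwa [PlaneTree.size_toForest, (x.1.2 c).2.1] at ha)
        simpa only [D, Staircase.ofTrees, Fin.extend_apply _ _ c.2] using this
    have hlen : ∀ z ∈ S, ∀ c, (z.2.1 c).length = l ∧ (z.2.2 c).length = l := by
      intro z hz c
      refine ⟨?_, ?_⟩
      · rw [(mem_treeInterleavings.1 ((hmem z hz).1 c)).1.1, (z.1.2 c).2.1]
      · rw [(mem_treeInterleavings.1 ((hmem z hz).2 c)).1.1, PlaneTree.size_mirror,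
          (z.1.2 c).2.1]
    have hH : x.2.1 = y.2.1 := by
      funext c
      refine List.eq_of_getD_eq (hlen x hx c).1 (hlen y hy c).1 fun i hi => ?_
      have := h3 c c.2 i hi
      simpa only [D, Staircase.ofTrees, Fin.extend_apply _ _ c.2] using this
    have hV : x.2.2 = y.2.2 := by
      funext c
      refine List.eq_of_getD_eq (hlen x hx c).2 (hlen y hy c).2 fun i hi => ?_
      have := h4 c c.2 i hi
      simpa only [D, Staircase.ofTrees, Fin.extend_apply _ _ c.2] using this
    obtain ⟨⟨x1, x2⟩, x3, x4⟩ := x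
    obtain ⟨⟨y1, y2⟩, y3, y4⟩ := y
    simp only at hR hB hH hV
    rw [hR, hB, hH, hV]

/-! ### A lower bound for the number of staircases -/

/-- Jensen's inequality for the logarithm with the uniform distribution. -/
theorem log_card_add_le_log_sum {X : Type*} [Fintype X] [Nonempty X] {f : X → ℝ}
    (hf : ∀ x, 0 < f x) :
    Real.log (Fintype.card X) + (∑ x, Real.log (f x)) / Fintype.card X ≤ Real.log (∑ x, f x) := by
  have hN : (0 : ℝ) < Fintype.card X := by exact_mod_cast Fintype.card_pos
  have hsum : 0 < ∑ x, f x := Finset.sum_pos (fun x _ => hf x) Finset.univ_nonempty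
  have := strictConcaveOn_log_Ioi.concaveOn.le_map_sum (t := Finset.univ)
    (w := fun _ : X => (Fintype.card X : ℝ)⁻¹) (p := f) (fun _ _ => by positivity)
    (by simp [hN.ne']) (fun x _ => hf x)
  simp only [smul_eq_mul, ← Finset.mul_sum] at this
  rw [Real.log_mul (inv_ne_zero hN.ne') hsum.ne', Real.log_inv] at this
  rw [div_eq_inv_mul]
  linarith

/-- One coordinate of a uniformly random function is uniformly distributed; stated without division.
-/
theorem sum_comp_apply_mul_card {ι α : Type*} [Fintype ι] [DecidableEq ι] [Fintype α] (i : ι)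
    (g : α → ℝ) :
    (∑ f : ι → α, g (f i)) * Fintype.card α = Fintype.card (ι → α) * ∑ a, g a := by
  have h1 : ∑ f : ι → α, g (f i) = ∑ x : α × ({j // j ≠ i} → α), g x.1 :=
    Fintype.sum_equiv (Equiv.funSplitAt i α) _ _ fun f => rfl
  rw [h1, Fintype.card_congr (Equiv.funSplitAt i α), Fintype.card_prod, Fintype.sum_prod_type]
  simp only [Finset.sum_const, Finset.card_univ, nsmul_eq_mul, ← Finset.mul_sum]
  push_cast
  ring

/-- If there are no interleavings, the convention `Real.log 0 = 0` still gives the inequality. -/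
theorem log_interleavings_le (T : PlaneTree) (F : PlaneForest) :
    Real.log (interleavings T F) ≤ Real.log (admissibles T.children F).card := by
  rcases Nat.eq_zero_or_pos (interleavings T F) with h | h
  · rw [h, Nat.cast_zero, Real.log_zero]
    exact Real.log_natCast_nonneg _
  · exact Real.log_le_log (by exact_mod_cast h)
      (by exact_mod_cast interleavings_le_card_admissibles T F)

open Classical in
-- A blue root matches at most one pair in `S`; if it matches none, the bound is the nonnegativity
-- of the right-hand side.
theorem sum_log_interleavings_le (S : Finset (PlaneTree × PlaneForest)) (G : PlaneForest) (i : ℕ)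
    (F : PlaneForest) :
    ∑ x ∈ S, (if G.trees[i]? = some x.1 ∧ F = x.2 then (1 : ℝ) else 0) *
      Real.log (interleavings x.1 x.2) ≤
    Real.log (admissibles (G.trees.getD i ⟨PlaneForest.nil⟩).children F).card := by
  have h0 : ∀ c F, 0 ≤ Real.log (admissibles c F).card := fun _ _ => Real.log_natCast_nonneg _
  cases hT : G.trees[i]? with
  | none => simpa using h0 _ _
  | some T =>
    rw [List.getD_eq_getElem?_getD, hT, Option.getD_some]
    simp only [Option.some.injEq, ite_mul, one_mul, zero_mul]
    rw [← Finset.sum_filter]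
    have hsub : {x ∈ S | T = x.1 ∧ F = x.2} ⊆ {(T, F)} := by
      intro x hx
      obtain ⟨-, h1, h2⟩ := Finset.mem_filter.1 hx
      rw [Finset.mem_singleton, h1, h2]
    rcases Finset.subset_singleton_iff.1 hsub with h | h
    · rw [h, Finset.sum_empty]
      exact h0 _ _
    · rw [h, Finset.sum_singleton]
      exact log_interleavings_le T F

/-- The average over all pre-interleaved pairs of the proportion of `(T, F)`-subtrees. -/
noncomputable def averageProportion (k l d : ℕ) (T : PlaneTree) (F : PlaneForest) : ℝ :=
  (∑ᶠ x : PreInterleavedPair k l d, subtreeProportion x.1.1 x.2.1.1 x.2.2 T F) /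
    (Nat.card (PreInterleavedPair k l d) : ℝ)

theorem nonempty_preInterleaving {k d : ℕ} (hk : 0 < k) : Nonempty (PreInterleaving k d) :=
  ⟨⟨fun _ => ⟨0, hk⟩, fun _ _ _ => le_rfl⟩⟩

theorem card_treeInterleavings_pos {k l d : ℕ} (hk : 0 < k) (R : RedTree k) (B : BlueTree l d) :
    0 < (treeInterleavings R.1 B.1).card := by
  have := Fintype.ofFinite (PreInterleaving k d)
  obtain ⟨P⟩ := nonempty_preInterleaving (d := d) hk
  refine lt_of_lt_of_le ?_ (sum_prod_le_card_treeInterleavings R.1 B.1 R.2 B.2.2)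
  exact Finset.sum_pos (fun P _ => Finset.prod_pos fun i _ => card_admissibles_pos _ _)
    ⟨P, Finset.mem_univ P⟩

/-- Jensen over the pre-interleavings. The logarithm of the product becomes a sum over blue roots,
bounded below by the number of roots matching each pair, which is `d` times a proportion. -/
theorem log_card_treeInterleavings_ge {k l d : ℕ} (hk : 0 < k) (R : RedTree k) (B : BlueTree l d)
    [Fintype (PreInterleaving k d)] (S : Finset (PlaneTree × PlaneForest)) :
    Real.log (Fintype.card (PreInterleaving k d)) + d * (∑ x ∈ S, (∑ P : PreInterleaving k d,
      subtreeProportion R.1 B.1 P x.1 x.2) * Real.log (interleavings x.1 x.2)) /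
        Fintype.card (PreInterleaving k d) ≤ Real.log (treeInterleavings R.1 B.1).card := by
  classical
  have := nonempty_preInterleaving (d := d) hk
  have hpos : ∀ P : PreInterleaving k d, (0 : ℝ) < ∏ i : Fin d,
      ((admissibles (B.1.children.trees.getD i ⟨PlaneForest.nil⟩).children
        (redFringe R.1 (P i) (gapSize P i))).card : ℝ) := fun P =>
    Finset.prod_pos fun i _ => by exact_mod_cast card_admissibles_pos _ _
  have h1 := sum_prod_le_card_treeInterleavings R.1 B.1 R.2 B.2.2
  have h2 := log_card_add_le_log_sum hpos
  have h3 : Real.log (∑ P : PreInterleaving k d, ∏ i : Fin d,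
      ((admissibles (B.1.children.trees.getD i ⟨PlaneForest.nil⟩).children
        (redFringe R.1 (P i) (gapSize P i))).card : ℝ)) ≤
      Real.log (treeInterleavings R.1 B.1).card :=
    Real.log_le_log (Finset.sum_pos (fun P _ => hpos P) Finset.univ_nonempty) (by exact_mod_cast h1)
  refine le_trans (le_trans (add_le_add_right ?_ _) h2) h3
  gcongr
  rw [Finset.mul_sum]
  simp only [Finset.sum_mul, Finset.mul_sum]
  rw [Finset.sum_comm]
  refine Finset.sum_le_sum fun P _ => ?_
  rw [Real.log_prod (fun i _ => by exact_mod_cast (card_admissibles_pos _ _).ne')]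
  refine le_trans (le_of_eq ?_) (Finset.sum_le_sum fun i (_ : i ∈ Finset.univ) =>
    sum_log_interleavings_le S B.1.children i (redFringe R.1 (P i) (gapSize P i)))
  rw [Finset.sum_comm]
  refine Finset.sum_congr rfl fun x _ => ?_
  rw [subtreeProportion_eq_sum, ← Finset.sum_mul, ← mul_assoc]
  congr 1
  rcases Nat.eq_zero_or_pos d with rfl | hd
  · simp
  · rw [mul_div_cancel₀ _ (by positivity)]

theorem sum_log_card_treeInterleavings_ge {k l d : ℕ} (hk : 0 < k) [Fintype (RedTree k)]
    [Fintype (BlueTree l d)] (S : Finset (PlaneTree × PlaneForest)) :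
    (Fintype.card (RedTree k) * Fintype.card (BlueTree l d) : ℝ) *
      (Real.log (Nat.card (PreInterleaving k d)) +
        d * ∑ x ∈ S, averageProportion k l d x.1 x.2 * Real.log (interleavings x.1 x.2)) ≤
    ∑ R : RedTree k, ∑ B : BlueTree l d, Real.log (treeInterleavings R.1 B.1).card := by
  have := Fintype.ofFinite (PreInterleaving k d)
  have := nonempty_preInterleaving (d := d) hk
  refine le_trans (le_of_eq ?_) (Finset.sum_le_sum fun R _ => Finset.sum_le_sum fun B _ =>
    log_card_treeInterleavings_ge hk R B S)
  simp only [Finset.sum_add_distrib, Finset.sum_const, Finset.card_univ, nsmul_eq_mul,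
    Nat.card_eq_fintype_card, averageProportion, finsum_eq_sum_of_fintype, Fintype.card_prod,
    Fintype.sum_prod_type]
  rw [mul_add, mul_assoc]
  congr 1
  simp only [← Finset.sum_div, ← Finset.mul_sum]
  have hP : (Fintype.card (PreInterleaving k d) : ℝ) ≠ 0 := by
    exact_mod_cast Fintype.card_ne_zero
  rcases Nat.eq_zero_or_pos (Fintype.card (RedTree k)) with hR | hR
  · have := Fintype.card_eq_zero_iff.1 hR
    simp
  rcases Nat.eq_zero_or_pos (Fintype.card (BlueTree l d)) with hB | hB
  · have := Fintype.card_eq_zero_iff.1 hB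
    simp
  have hswap : ∑ R : RedTree k, ∑ B : BlueTree l d, ∑ x ∈ S, (∑ P : PreInterleaving k d,
      subtreeProportion R.1 B.1 P x.1 x.2) * Real.log (interleavings x.1 x.2) =
      ∑ x ∈ S, (∑ R : RedTree k, ∑ B : BlueTree l d, ∑ P : PreInterleaving k d,
        subtreeProportion R.1 B.1 P x.1 x.2) * Real.log (interleavings x.1 x.2) := by
    rw [Finset.sum_congr rfl fun R _ => Finset.sum_comm, Finset.sum_comm]
    simp only [Finset.sum_mul]
  rw [hswap]
  simp only [div_mul_eq_mul_div, ← Finset.sum_div]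
  push_cast
  field_simp

theorem exp_le_ncard_regularAvoiders {t k l d : ℕ} (hk : 0 < k) (hl : 0 < l)
    [Nonempty (RedTree k)] [Nonempty (BlueTree l d)] (S : Finset (PlaneTree × PlaneForest)) :
    Real.exp ((t + 1) * Real.log (Nat.card (RedTree k)) + t * Real.log (Nat.card (BlueTree l d)) +
      2 * t * (Real.log (Nat.card (PreInterleaving k d)) +
        d * ∑ x ∈ S, averageProportion k l d x.1 x.2 * Real.log (interleavings x.1 x.2))) ≤
    (regularAvoiders t k l d).ncard := by
  have := Fintype.ofFinite (RedTree k)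
  have := Fintype.ofFinite (BlueTree l d)
  set A := Real.log (Nat.card (PreInterleaving k d)) +
        d * ∑ x ∈ S, averageProportion k l d x.1 x.2 * Real.log (interleavings x.1 x.2) with hA
  have hmR : ∀ R : RedTree k, R.1.mirror.size = k := fun R => R.1.size_mirror.trans R.2
  have hmB : ∀ B : BlueTree l d, B.1.mirror.size = l ∧ B.1.mirror.rootDegree = d := fun B =>
    ⟨B.1.size_mirror.trans B.2.1, B.1.rootDegree_mirror.trans B.2.2⟩
  let eR : RedTree k ≃ RedTree k := ⟨fun R => ⟨R.1.mirror, hmR R⟩, fun R => ⟨R.1.mirror, hmR R⟩,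
    fun R => Subtype.ext R.1.mirror_mirror, fun R => Subtype.ext R.1.mirror_mirror⟩
  let eB : BlueTree l d ≃ BlueTree l d := ⟨fun R => ⟨R.1.mirror, hmB R⟩,
    fun R => ⟨R.1.mirror, hmB R⟩, fun R => Subtype.ext R.1.mirror_mirror,
    fun R => Subtype.ext R.1.mirror_mirror⟩
  let g : RedTree k → BlueTree l d → ℝ := fun R B => Real.log (treeInterleavings R.1 B.1).card
  have hg : ∑ R, ∑ B, g (eR R) (eB B) = ∑ R, ∑ B, g R B := by
    rw [Equiv.sum_comp eR fun R => ∑ B, g R (eB B)]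
    exact Finset.sum_congr rfl fun R _ => Equiv.sum_comp eB (g R)
  have hgA := sum_log_card_treeInterleavings_ge (l := l) (d := d) hk S
  have hNR : (0 : ℝ) < Fintype.card (RedTree k) := by exact_mod_cast Fintype.card_pos
  have hNB : (0 : ℝ) < Fintype.card (BlueTree l d) := by exact_mod_cast Fintype.card_pos
  -- In a uniformly random sequence of trees each adjacent red-blue pair is uniformly distributed,
  -- so its mean logarithm is at least `A`. The hypothesis also covers the vertical pairs, since
  -- mirroring permutes the trees.
  have hmarg : ∀ (h : RedTree k → BlueTree l d → ℝ), ∑ R, ∑ B, h R B = ∑ R, ∑ B, g R B →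
      ∀ (c : Fin (t + 1)) (c' : Fin t), (Fintype.card (Fin (t + 1) → RedTree k) *
        Fintype.card (Fin t → BlueTree l d) : ℝ) * A ≤
      ∑ x : (Fin (t + 1) → RedTree k) × (Fin t → BlueTree l d), h (x.1 c) (x.2 c') := by
    intro h hh c c'
    rw [← hh] at hgA
    rw [Fintype.sum_prod_type]
    have h1 : ∀ R, (∑ f : Fin t → BlueTree l d, h R (f c')) * Fintype.card (BlueTree l d) =
      Fintype.card (Fin t → BlueTree l d) * ∑ B, h R B := fun R => sum_comp_apply_mul_card c' (h R)
    have h2 := sum_comp_apply_mul_card c fun R => ∑ f : Fin t → BlueTree l d, h R (f c')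
    refine le_of_mul_le_mul_right ?_ (mul_pos hNR hNB)
    have h3 : (∑ x : Fin (t + 1) → RedTree k, ∑ y : Fin t → BlueTree l d, h (x c) (y c')) *
        (Fintype.card (RedTree k) * Fintype.card (BlueTree l d) : ℝ) =
        (Fintype.card (Fin (t + 1) → RedTree k) * Fintype.card (Fin t → BlueTree l d) : ℝ) *
          ∑ R, ∑ B, h R B := by
      rw [← mul_assoc, h2, mul_assoc, Finset.sum_mul]
      simp only [h1, ← Finset.mul_sum]
      ring
    rw [h3]
    calc _ = (Fintype.card (Fin (t + 1) → RedTree k) *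
        Fintype.card (Fin t → BlueTree l d) : ℝ) *
          ((Fintype.card (RedTree k) * Fintype.card (BlueTree l d) : ℝ) * A) := by ring
      _ ≤ _ := mul_le_mul_of_nonneg_left hgA (by positivity)
  have hposH : ∀ R B, 0 < (treeInterleavings (R : RedTree k).1 (B : BlueTree l d).1).card :=
    card_treeInterleavings_pos hk
  have hpos : ∀ x : (Fin (t + 1) → RedTree k) × (Fin t → BlueTree l d),
      (0 : ℝ) < (∏ c : Fin t, ((treeInterleavings (x.1 c.castSucc).1 (x.2 c).1).card : ℝ)) *
        ∏ c : Fin t, ((treeInterleavings (x.1 c.succ).1.mirror (x.2 c).1.mirror).card : ℝ) := by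
    intro x
    refine mul_pos (Finset.prod_pos fun c _ => ?_) (Finset.prod_pos fun c _ => ?_)
    · exact_mod_cast hposH _ _
    · exact_mod_cast hposH (eR _) (eB _)
  -- The second use of Jensen, over all sequences of trees: `t` horizontal and `t` vertical pairs
  -- each contribute at least `A`.
  have h1 := log_card_add_le_log_sum hpos
  have h2 := sum_prod_le_ncard_regularAvoiders (t := t) (d := d) hk hl
  refine le_trans ((Real.le_log_iff_exp_le
    (Finset.sum_pos (fun x _ => hpos x) Finset.univ_nonempty)).1 (le_trans ?_ h1))
    (by exact_mod_cast h2)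
  have h3 : ∀ x : (Fin (t + 1) → RedTree k) × (Fin t → BlueTree l d),
      Real.log ((∏ c : Fin t, ((treeInterleavings (x.1 c.castSucc).1 (x.2 c).1).card : ℝ)) *
        ∏ c : Fin t, ((treeInterleavings (x.1 c.succ).1.mirror (x.2 c).1.mirror).card : ℝ)) =
      (∑ c : Fin t, g (x.1 c.castSucc) (x.2 c)) + ∑ c : Fin t, g (eR (x.1 c.succ)) (eB (x.2 c)) := by
    intro x
    have hH : ∀ c : Fin t, ((treeInterleavings (x.1 c.castSucc).1 (x.2 c).1).card : ℝ) ≠ 0 :=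
      fun c => by exact_mod_cast (hposH _ _).ne'
    have hV : ∀ c : Fin t,
        ((treeInterleavings (x.1 c.succ).1.mirror (x.2 c).1.mirror).card : ℝ) ≠ 0 :=
      fun c => by exact_mod_cast (hposH (eR _) (eB _)).ne'
    rw [Real.log_mul (Finset.prod_ne_zero_iff.2 fun c _ => hH c)
      (Finset.prod_ne_zero_iff.2 fun c _ => hV c), Real.log_prod fun c _ => hH c,
      Real.log_prod fun c _ => hV c]
    rfl
  simp only [h3, Finset.sum_add_distrib]
  rw [Finset.sum_comm (s := Finset.univ) (t := (Finset.univ : Finset (Fin t))),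
    Finset.sum_comm (s := Finset.univ) (t := (Finset.univ : Finset (Fin t)))]
  have h4 := Finset.sum_le_sum fun (c : Fin t) (_ : c ∈ Finset.univ) => hmarg g rfl c.castSucc c
  have h5 := Finset.sum_le_sum fun (c : Fin t) (_ : c ∈ Finset.univ) =>
    hmarg (fun R B => g (eR R) (eB B)) hg c.succ c
  rw [Finset.sum_const, Finset.card_univ, Fintype.card_fin, nsmul_eq_mul] at h4 h5
  rw [Fintype.card_prod, Nat.cast_mul]
  have hN : (0 : ℝ) < Fintype.card (Fin (t + 1) → RedTree k) *
      Fintype.card (Fin t → BlueTree l d) := by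
    refine mul_pos ?_ ?_ <;> exact_mod_cast Fintype.card_pos
  refine le_trans (le_of_eq ?_) (add_le_add_right (div_le_div_of_nonneg_right (add_le_add h4 h5)
    hN.le) _)
  have h6 : ∀ N : ℝ, 0 < N → (t * (N * A) + t * (N * A)) / N = 2 * t * A := by
    intro N hN
    field_simp
    ring
  rw [h6 _ hN, Fintype.card_fun, Fintype.card_fun, Nat.cast_pow, Nat.cast_pow,
    Real.log_mul (pow_ne_zero _ hNR.ne') (pow_ne_zero _ hNB.ne'), Real.log_pow, Real.log_pow,
    Fintype.card_fin, Fintype.card_fin, Nat.card_eq_fintype_card, Nat.card_eq_fintype_card]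
  push_cast
  ring

/-! ### Asymptotics -/

theorem tendsto_log_factorial :
    Tendsto (fun n : ℕ => (Real.log n.factorial - n * Real.log n + n) / n) atTop (𝓝 0) := by
  have h1 : Tendsto (fun n : ℕ => Real.log (Stirling.stirlingSeq n)) atTop
      (𝓝 (Real.log (Real.sqrt Real.pi))) :=
    Stirling.tendsto_stirlingSeq_sqrt_pi.log (by positivity)
  have h2 : Tendsto (fun n : ℕ => (n : ℝ)⁻¹) atTop (𝓝 0) := tendsto_inv_atTop_nhds_zero_nat
  have h3 : Tendsto (fun n : ℕ => Real.log n / n) atTop (𝓝 0) :=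
    (Real.isLittleO_log_id_atTop.comp_tendsto tendsto_natCast_atTop_atTop).tendsto_div_nhds_zero
  have h4 := ((h1.mul h2).add (h2.const_mul (1 / 2 * Real.log 2))).add (h3.const_mul (1 / 2))
  simp only [mul_zero, add_zero] at h4
  refine h4.congr' ?_
  filter_upwards [eventually_gt_atTop 0] with n hn
  have hn' : (n : ℝ) ≠ 0 := by positivity
  rw [Stirling.log_stirlingSeq_formula, Real.log_mul two_ne_zero hn',
    Real.log_div hn' (Real.exp_ne_zero 1), Real.log_exp]
  field_simp
  ring

theorem tendsto_log_nat_div : Tendsto (fun k : ℕ => Real.log k / k) atTop (𝓝 0) :=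
  (Real.isLittleO_log_id_atTop.comp_tendsto tendsto_natCast_atTop_atTop).tendsto_div_nhds_zero

/-- The subtracted multiple of `Real.log k` is additive in `a`, so it cancels in a binomial
coefficient. -/
theorem HasSlope.tendsto_log_factorial {a : ℕ → ℕ} {α : ℝ} (ha : HasSlope a α) (hα : 0 < α) :
    Tendsto (fun k => Real.log (a k).factorial / k - a k / k * Real.log k) atTop
      (𝓝 (α * Real.log α - α)) := by
  have h1 := (_root_.tendsto_log_factorial.comp (ha.tendsto hα)).mul ha
  have h2 := ((Tendsto.mul ha (Tendsto.log ha hα.ne')).sub ha).add h1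
  rw [zero_mul, add_zero] at h2
  refine h2.congr' ?_
  filter_upwards [eventually_gt_atTop 0, (ha.tendsto hα).eventually_gt_atTop 0] with k hk hak
  have hk' : (k : ℝ) ≠ 0 := by positivity
  have hak' : (a k : ℝ) ≠ 0 := by positivity
  simp only [Function.comp]
  rw [Real.log_div hak' hk']
  field_simp
  ring

theorem tendsto_log_choose {a b : ℕ → ℕ} {α β : ℝ} (ha : HasSlope a α) (hb : HasSlope b β)
    (hβ : 0 < β) (h : β < α) :
    Tendsto (fun k => Real.log ((a k).choose (b k)) / k) atTop
      (𝓝 (α * Real.log α - β * Real.log β - (α - β) * Real.log (α - β))) := by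
  have h1 := ((ha.tendsto_log_factorial (hβ.trans h)).sub (hb.tendsto_log_factorial hβ)).sub
    ((ha.sub hb h).tendsto_log_factorial (sub_pos.2 h))
  have h2 : α * Real.log α - α - (β * Real.log β - β) -
      ((α - β) * Real.log (α - β) - (α - β)) =
      α * Real.log α - β * Real.log β - (α - β) * Real.log (α - β) := by ring
  rw [h2] at h1
  refine h1.congr' ?_
  filter_upwards [ha.eventually_lt hb h] with k hk
  have hfac : ∀ n : ℕ, (n.factorial : ℝ) ≠ 0 := fun n => by exact_mod_cast n.factorial_ne_zero
  rw [Nat.cast_choose ℝ hk.le, Real.log_div (hfac _) (mul_ne_zero (hfac _) (hfac _)),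
    Real.log_mul (hfac _) (hfac _), Nat.cast_sub hk.le]
  ring

theorem tendsto_log_card_redTree :
    Tendsto (fun k : ℕ => Real.log (Nat.card (RedTree k)) / k) atTop (𝓝 (Real.log 4)) := by
  have hk : HasSlope (fun k => k - 1) 1 := hasSlope_id.sub_const one_pos 1
  have h := (tendsto_log_choose (hk.add hk) hk one_pos (by norm_num)).sub tendsto_log_nat_div
  have h4 : (1 + 1 : ℝ) * Real.log (1 + 1) - 1 * Real.log 1 - (1 + 1 - 1) * Real.log (1 + 1 - 1) - 0
      = Real.log 4 := by
    rw [show (4 : ℝ) = 2 ^ 2 by norm_num, Real.log_pow]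
    norm_num
  rw [h4] at h
  refine h.congr' ?_
  filter_upwards [eventually_gt_atTop 0] with k hk
  obtain ⟨K, rfl⟩ : ∃ K, k = K + 1 := ⟨k - 1, by omega⟩
  have h1 := succ_mul_catalan_eq_centralBinom K
  have h2 : ((K + 1 : ℕ) : ℝ) * catalan K = ((K + K).choose K : ℕ) := by
    rw [← two_mul, ← Nat.centralBinom_eq_two_mul_choose, ← h1]
    push_cast
    ring
  have h3 : (catalan K : ℝ) ≠ 0 := by
    intro h0
    rw [h0, mul_zero] at h2
    exact (Nat.choose_pos (show K ≤ K + K by omega)).ne (by exact_mod_cast h2)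
  rw [card_redTree, Nat.add_sub_cancel, ← h2, Real.log_mul (by positivity) h3]
  ring

theorem tendsto_log_card_preInterleaving {d : ℕ → ℕ} {β : ℝ} (hd : HasSlope d β) (hβ : 0 < β) :
    Tendsto (fun k : ℕ => Real.log (Nat.card (PreInterleaving k (d k))) / k) atTop
      (𝓝 ((1 + β) * Real.log (1 + β) - β * Real.log β)) := by
  have hk : HasSlope (fun k => k - 1) 1 := hasSlope_id.sub_const one_pos 1
  have h := tendsto_log_choose (hk.add hd) hd hβ (by linarith)
  rw [add_sub_cancel_right, Real.log_one, mul_zero, sub_zero] at h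
  refine h.congr' ?_
  filter_upwards [eventually_gt_atTop 0] with k hk
  have h1 := card_preInterleaving (k - 1) (d k)
  rw [Nat.sub_add_cancel hk] at h1
  rw [h1]

theorem eventually_card_blueTree {l d : ℕ → ℕ} {α β : ℝ} (hl : HasSlope l α) (hd : HasSlope d β)
    (hβ : 0 < β) (h : β < α) :
    ∀ᶠ k in atTop, 0 < d k ∧ d k < l k - 1 ∧ (Nat.card (BlueTree (l k) (d k)) : ℝ) =
      d k / (l k - 1 : ℕ) * (2 * (l k - 1) - d k - 1).choose (l k - 1 - d k) := by
  have hα := hβ.trans h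
  filter_upwards [(hd.tendsto hβ).eventually_gt_atTop 0, (hl.sub_const hα 1).eventually_lt hd h]
    with k h1 h2
  refine ⟨h1, h2, ?_⟩
  rw [← card_ofLenSize_eq h1 h2.le, ← card_blueTree, Nat.sub_add_cancel (by omega)]

/-- The rational factor of the ballot number has a bounded logarithm and disappears on division by
`k`. -/
theorem tendsto_log_card_blueTree {l d : ℕ → ℕ} {α β : ℝ} (hl : HasSlope l α) (hd : HasSlope d β)
    (hβ : 0 < β) (h : β < α) :
    Tendsto (fun k : ℕ => Real.log (Nat.card (BlueTree (l k) (d k))) / k) atTop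
      (𝓝 ((2 * α - β) * Real.log (2 * α - β) - (α - β) * Real.log (α - β) - α * Real.log α)) := by
  have hα := hβ.trans h
  have hn := hl.sub_const hα 1
  have h1 := tendsto_log_choose (((hn.add hn).sub hd (by linarith)).sub_const (by linarith) 1)
    (hn.sub hd h) (sub_pos.2 h) (by linarith)
  have h2 : Tendsto (fun k : ℕ => Real.log ((d k : ℝ) / (l k - 1 : ℕ)) * (k : ℝ)⁻¹) atTop
      (𝓝 (Real.log (β / α) * 0)) :=
    ((hd.div hn hα.ne').log (by positivity)).mul tendsto_inv_atTop_nhds_zero_nat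
  have h3 := h2.add h1
  rw [mul_zero, zero_add] at h3
  convert h3.congr' ?_ using 2
  · rw [show α + α - β - (α - β) = α by ring, show α + α - β = 2 * α - β by ring]
  filter_upwards [eventually_card_blueTree hl hd hβ h] with k hk
  obtain ⟨h4, h5, h6⟩ := hk
  have h7 : (0 : ℝ) < (l k - 1 : ℕ) := by exact_mod_cast (by omega : 0 < l k - 1)
  have h8 : (0 : ℝ) < d k := by exact_mod_cast h4
  have h9 : ((2 * (l k - 1) - d k - 1).choose (l k - 1 - d k) : ℝ) ≠ 0 := by
    exact_mod_cast (Nat.choose_pos (by omega)).ne'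
  rw [h6, Real.log_mul (by positivity) h9, ← two_mul, add_div, div_eq_mul_inv (Real.log (_ / _))]

/-- This is an inequality only because of `n = 0`, where the right-hand side is 1. -/
theorem natCast_rpow_le_exp (n : ℕ) (x : ℝ) : (n : ℝ) ^ x ≤ Real.exp (x * Real.log n) := by
  rcases Nat.eq_zero_or_pos n with rfl | hn
  · simpa using Real.zero_rpow_le_one x
  · rw [Real.rpow_def_of_pos (by exact_mod_cast hn), mul_comm]

theorem growthE_pos {lam δ : ℝ} (hlam : 0 < lam) (hδ₀ : 0 < δ) (hδ₁ : δ < 1) :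
    0 < growthE lam δ := by
  have h1 : 0 < 1 - δ := by linarith
  have h2 : 0 < 2 - δ := by linarith
  unfold growthE
  positivity

theorem log_growthE {lam δ : ℝ} (hlam : 0 < lam) (hδ₀ : 0 < δ) (hδ₁ : δ < 1) :
    Real.log (growthE lam δ) = Real.log 4 +
      ((2 * lam - δ * lam) * Real.log (2 * lam - δ * lam) -
        (lam - δ * lam) * Real.log (lam - δ * lam) - lam * Real.log lam) +
      2 * ((1 + δ * lam) * Real.log (1 + δ * lam) - δ * lam * Real.log (δ * lam)) := by
  have h1 : 0 < 1 - δ := by linarith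
  have h2 : 0 < 2 - δ := by linarith
  unfold growthE
  rw [show 2 * lam - δ * lam = (2 - δ) * lam by ring, show lam - δ * lam = (1 - δ) * lam by ring,
    Real.log_mul h1.ne' hlam.ne', Real.log_mul h2.ne' hlam.ne',
    Real.log_mul (by positivity) (by positivity), Real.log_mul (by positivity) (by positivity),
    Real.log_div (by positivity) (by positivity), Real.log_div (by positivity) (by positivity),
    Real.log_rpow h2, Real.log_rpow h1, Real.log_rpow (by positivity), Real.log_rpow (by positivity)]
  ring

/-- With `t = k`, both the exponent of the lower bound and the length of the permutations are of
order `k ^ 2`; the length is asymptotically `(1 + lam) * k ^ 2`, whence the denominators `1 + lam`.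
-/
theorem le_lowerGrowthRate {lam δ : ℝ} (hlam : 0 < lam) (hδ₀ : 0 < δ) (hδ₁ : δ < 1)
    {μ : PlaneTree → PlaneForest → ℝ}
    (hμ : ∀ T F, Tendsto (fun k : ℕ => meanProportion lam δ k T F) atTop (𝓝 (μ T F)))
    (S : Finset (PlaneTree × PlaneForest)) :
    ENNReal.ofReal (growthE lam δ ^ (1 / (1 + lam)) *
        ∏ x ∈ S, (interleavings x.1 x.2 : ℝ) ^ (2 * δ * lam * μ x.1 x.2 / (1 + lam)))
      ≤ lowerGrowthRate lam δ := by
  have hβ : 0 < δ * lam := by positivity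
  have hlt : δ * lam < lam := by nlinarith
  have hd : HasSlope (blueDegree lam δ) (δ * lam) := hasSlope_ceil hβ.le
  have hl : HasSlope (blueSize lam) lam := hasSlope_ceil hlam.le
  let X : ℕ → ℝ := fun k => (k + 1) * Real.log (Nat.card (RedTree k)) +
    k * Real.log (Nat.card (BlueTree (blueSize lam k) (blueDegree lam δ k))) +
      2 * k * (Real.log (Nat.card (PreInterleaving k (blueDegree lam δ k))) +
        blueDegree lam δ k * ∑ x ∈ S, meanProportion lam δ k x.1 x.2 *
          Real.log (interleavings x.1 x.2))
  have hexp : ∀ᶠ k in atTop, Real.exp (X k / (k * (k + blueSize lam k + 1) : ℕ)) ≤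
      rootCount lam δ k := by
    filter_upwards [eventually_gt_atTop 0, eventually_card_blueTree hl hd hβ hlt] with k hk hB
    obtain ⟨h1, h2, h3⟩ := hB
    have hne : Nonempty (BlueTree (blueSize lam k) (blueDegree lam δ k)) := by
      refine (Nat.card_pos_iff.1 ?_).1
      rw [← Nat.cast_pos (α := ℝ), h3]
      have h4 : (0 : ℝ) < (blueSize lam k - 1 : ℕ) := by
        exact_mod_cast (by omega : 0 < blueSize lam k - 1)
      have h5 : (0 : ℝ) < blueDegree lam δ k := by exact_mod_cast h1
      have h6 : (0 : ℝ) < ((2 * (blueSize lam k - 1) - blueDegree lam δ k - 1).choose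
          (blueSize lam k - 1 - blueDegree lam δ k) : ℝ) := by
        exact_mod_cast Nat.choose_pos (by omega)
      positivity
    have hne' : Nonempty (RedTree k) := by
      refine (Nat.card_pos_iff.1 ?_).1
      rw [← Nat.sub_add_cancel hk, card_redTree]
      have := succ_mul_catalan_eq_centralBinom (k - 1)
      exact Nat.pos_of_mul_pos_left (this ▸ Nat.centralBinom_pos _)
    have h := exp_le_ncard_regularAvoiders (t := k) (l := blueSize lam k) (d := blueDegree lam δ k)
      hk (by omega) S
    rw [rootCount, div_eq_mul_one_div, Real.exp_mul]
    exact Real.rpow_le_rpow (Real.exp_pos _).le h (by positivity)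
  have hX : Tendsto (fun k : ℕ => X k / (k * (k + blueSize lam k + 1) : ℕ)) atTop
      (𝓝 ((Real.log (growthE lam δ) + 2 * (δ * lam * ∑ x ∈ S, μ x.1 x.2 *
        Real.log (interleavings x.1 x.2))) / (1 + lam))) := by
    have h1 : HasSlope (fun k => k + blueSize lam k + 1) (1 + lam) :=
      (hasSlope_id.add hl).add_const 1
    have h2 : HasSlope (fun k => k + 1) 1 := hasSlope_id.add_const 1
    have h3 := tendsto_finsetSum S fun x _ =>
      (hμ x.1 x.2).mul_const (Real.log (interleavings x.1 x.2))
    have h4 := (((Tendsto.mul h2 tendsto_log_card_redTree).add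
      (tendsto_log_card_blueTree hl hd hβ hlt)).add
      (((tendsto_log_card_preInterleaving hd hβ).add (Tendsto.mul hd h3)).const_mul 2)).div h1
      (by positivity)
    convert h4.congr' ?_ using 2
    · rw [log_growthE hlam hδ₀ hδ₁]
      congr 1
      ring
    · filter_upwards [eventually_gt_atTop 0] with k hk
      have hk' : (k : ℝ) ≠ 0 := by positivity
      simp only [X, Pi.div_apply]
      push_cast
      field_simp
  have hlim : Tendsto (fun k : ℕ =>
      ENNReal.ofReal (Real.exp (X k / (k * (k + blueSize lam k + 1) : ℕ)))) atTop _ :=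
    (ENNReal.continuous_ofReal.comp Real.continuous_exp).continuousAt.tendsto.comp hX
  refine le_trans ?_ (hlim.liminf_eq.symm.trans_le
    (liminf_le_liminf (hexp.mono fun k hk => ENNReal.ofReal_le_ofReal hk)))
  refine ENNReal.ofReal_le_ofReal ?_
  rw [add_div, Real.exp_add]
  refine mul_le_mul (le_of_eq ?_) ?_ (Finset.prod_nonneg fun x _ => by positivity)
    (Real.exp_pos _).le
  · rw [Real.rpow_def_of_pos (growthE_pos hlam hδ₀ hδ₁), mul_one_div]
  · refine (Finset.prod_le_prod (fun x _ => by positivity) fun x _ =>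
      natCast_rpow_le_exp (interleavings x.1 x.2) _).trans_eq ?_
    rw [← Real.exp_sum, Finset.mul_sum, Finset.mul_sum, Finset.sum_div]
    congr 1
    refine Finset.sum_congr rfl fun x _ => ?_
    ring

theorem mainTheorem3 (lam δ : ℝ) (hlam : 0 < lam) (hδ₀ : 0 < δ) (hδ₁ : δ < 1) :
    ∃ μ : PlaneTree → PlaneForest → ℝ,
      (∀ T F, Tendsto (fun k : ℕ => meanProportion lam δ k T F) atTop (𝓝 (μ T F))) ∧
      ∀ S : Finset (PlaneTree × PlaneForest),
        ENNReal.ofReal (growthE lam δ ^ (1 / (1 + lam)) *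
            ∏ x ∈ S, (interleavings x.1 x.2 : ℝ) ^ (2 * δ * lam * μ x.1 x.2 / (1 + lam)))
          ≤ lowerGrowthRate lam δ ∧
        ENNReal.ofReal (growthE lam δ ^ (1 / (1 + lam)) *
            ∏ x ∈ S, (interleavings x.1 x.2 : ℝ) ^ (2 * δ * lam * μ x.1 x.2 / (1 + lam)))
          ≤ upperGrowthRate lam δ := by
  choose μ hμ using fun T F => exists_tendsto_meanProportion hlam hδ₀ hδ₁ T F
  refine ⟨μ, hμ, fun S => ?_⟩
  have h := le_lowerGrowthRate hlam hδ₀ hδ₁ hμ S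
  exact ⟨h, h.trans liminf_le_limsup⟩
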